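/- **Setting.** Fix integers $d\ge 3$, $r\ge 1$ and reals $\beta_1,\dots,\beta_r\ge 0$. Consider a sequence of sizes $(n_1,\dots,n_d)$ (the index of the sequence is suppressed), and put $N=\sum_{\ell=1}^d n_\ell$. For each size let $\mathcal W\in\mathbb R^{n_1\times\cdots\times n_d}$ be a random tensor with i.i.d. $\mathcal N(0,1)$ entries, all on one probability space, with one tensor per size and an arbitrary joint law of the tensors of different sizes. Let $x_{i,\ell}\in\mathbb R^{n_\ell}$ be deterministic unit vectors, and set $$\mathcal T_1=\sum_{i=1}^r\beta_i\,x_{i,1}\otimes\cdots\otimes x_{i,d}+\tfrac1{\sqrt N}\mathcal W,\qquad \mathcal T_{i+1}=\mathcal T_i-\hat\lambda_i\,\hat u_{i,1}\otimes\cdots\otimes\hat u_{i,d},$$ where, for each $i\in[r]$, $(\hat\lambda_i,\hat u_{i,1},\dots,\hat u_{i,d})$ is a critical point of the best rank-one approximation problem of $\mathcal T_i$, i.e. $\hat\lambda_i>0$, $\|\hat u_{i,\ell}\|=1$ and $$\mathcal T_i(\hat u_{i,1},\dots,\hat u_{i,\ell-1},\,\cdot\,,\hat u_{i,\ell+1},\dots,\hat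 u_{i,d})=\hat\lambda_i\hat u_{i,\ell}\quad\text{for all }\ell\in[d]$$ (almost surely, at all sufficiently late indices of the sequence). For a tensor $\mathcal X$ and vectors $a_\ell\in\mathbb R^{n_\ell}$ let $\Phi_d(\mathcal X,a_1,\dots,a_d)$ be the symmetric $N\times N$ matrix with blocks indexed by $(\ell,m)\in[d]^2$: its diagonal blocks are zero, its $(\ell,m)$ block for $\ell<m$ is the $n_\ell\times n_m$ matrix obtained by contracting $\mathcal X$ with $a_k$ in every mode $k\ne\ell,m$, and its $(m,\ell)$ block is the transpose of that. For a probability measure $\mu$ on $\mathbb R$ with support $\mathcal S(\mu)$ and Stieltjes transform $g(z)=\int\frac{d\mu(t)}{t-z}$, and for $c\in\mathbb R^d$, let $(\star_c)$ be the condition that $\Im g(z)>0$ whenever $\Im z>0$, and that for $z\notin\mathcal S(\mu)$ one can write $$g(z)=\sum_{\ell=1}^d g_\ell(z)\quad\text{with}\quad g_\ell(z)^2-(g(z)+z)\,g_\ell(z)-c_\ell=0\ \text{ for all }\ell\in[d].$$ **Assumptions.** Along the sequence, $n_\ell\to\infty$ and $n_\ell/N\to c_\ell$ for every $\ell\in[d]$;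 $|\langle x_{i,\ell},x_{j,\ell}\rangle|\to\alpha_{ij,\ell}$; and, almost surely, $\hat\lambda_i\to\lambda_i$, $|\langle x_{i,\ell},\hat u_{j,\ell}\rangle|\to\rho_{ij,\ell}$ and $|\langle\hat u_{i,\ell},\hat u_{j,\ell}\rangle|\to\eta_{ij,\ell}$ for all $i,j\in[r]$, $\ell\in[d]$, with deterministic limits; moreover $\rho_{ij,\ell}>0$, and $\lambda_i\notin\mathcal S(\mu)$ for the measure $\mu$ satisfying $(\star_c)$. **Theorem.** There is exactly one probability measure $\mu$ on $\mathbb R$ that satisfies $(\star_c)$. For every $i\in[r]$, almost surely, the empirical spectral measure of $M=\Phi_d(\mathcal T_i,\hat u_{i,1},\dots,\hat u_{i,d})$ converges weakly to $\mu$. In particular, with $R(z)=(M-zI_N)^{-1}$, almost surely $\frac1N\operatorname{Tr}R(z)\to g(z)$ for every $z\in\mathbb C\setminus\mathbb R$, and also for every $z\notin\mathcal S(\mu)$ whose distance to the spectrum of $M$ stays bounded away from $0$ at all sufficiently late indices of the sequence. -/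

import Mathlib

open MeasureTheory ProbabilityTheory Filter Topology

namespace SpikedTensor

/-- Real tensors of order `d` and size `(n 0, …, n (d - 1))`. -/
abbrev Tensor {d : ℕ} (n : Fin d → ℕ) : Type := ((ℓ : Fin d) → Fin (n ℓ)) → ℝ

/-- Families of `d` vectors, the `ℓ`-th one in `ℝ ^ (n ℓ)` (with the Euclidean norm). -/
abbrev Vectors {d : ℕ} (n : Fin d → ℕ) : Type := (ℓ : Fin d) → EuclideanSpace ℝ (Fin (n ℓ))

/-- `N = n 0 + ⋯ + n (d - 1)`. -/
def totalDim {d : ℕ} (n : Fin d → ℕ) : ℕ := ∑ ℓ, n ℓ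

/-- The outer product `a 0 ⊗ ⋯ ⊗ a (d - 1)`. -/
def outer {d : ℕ} {n : Fin d → ℕ} (a : Vectors n) : Tensor n := fun p => ∏ ℓ, a ℓ (p ℓ)

/-- The partial contraction `X (a 0, …, a (ℓ - 1), ·, a (ℓ + 1), …, a (d - 1)) ∈ ℝ ^ (n ℓ)`. -/
def contractOne {d : ℕ} {n : Fin d → ℕ} (X : Tensor n) (a : Vectors n) (ℓ : Fin d) :
    EuclideanSpace ℝ (Fin (n ℓ)) :=
  WithLp.toLp 2 fun q => ∑ p : ((k : Fin d) → Fin (n k)),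
    if p ℓ = q then X p * ∏ k ∈ Finset.univ.filter (fun k => k ≠ ℓ), a k (p k) else 0

/-- The entry in row `q` and column `q'` of the partial contraction of `X` against all the `a k`
with `k ≠ ℓ, m`. For `ℓ < m` this is the entry of the block `X^{ℓm}`, an `n ℓ × n m` matrix; for
`ℓ > m` it is the entry of its transpose. -/
def contractTwo {d : ℕ} {n : Fin d → ℕ} (X : Tensor n) (a : Vectors n) (ℓ m : Fin d)
    (q : Fin (n ℓ)) (q' : Fin (n m)) : ℝ :=
  ∑ p : ((k : Fin d) → Fin (n k)),
    if p ℓ = q ∧ p m = q' then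
      X p * ∏ k ∈ Finset.univ.filter (fun k => k ≠ ℓ ∧ k ≠ m), a k (p k)
    else 0

/-- The block matrix `Φ_d (X, a 0, …, a (d - 1))`, with zero diagonal blocks. Its rows and columns
are indexed by the pairs `⟨ℓ, q⟩` of a block `ℓ` and a position `q` inside that block. -/
def blockMatrix {d : ℕ} {n : Fin d → ℕ} (X : Tensor n) (a : Vectors n) :
    Matrix (Σ ℓ : Fin d, Fin (n ℓ)) (Σ ℓ : Fin d, Fin (n ℓ)) ℝ :=
  fun s t => if s.1 = t.1 then 0 else contractTwo X a s.1 t.1 s.2 t.2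

theorem blockMatrix_isHermitian {d : ℕ} {n : Fin d → ℕ} (X : Tensor n) (a : Vectors n) :
    (blockMatrix X a).IsHermitian := by
  ext s t
  simp only [Matrix.conjTranspose_apply, blockMatrix, contractTwo, star_trivial, eq_comm, and_comm]

/-- The empirical spectral measure of a real symmetric matrix: the average of the Dirac masses at
its eigenvalues, counted with multiplicity. -/
noncomputable def empiricalSpectralMeasure {ι : Type} [Fintype ι] [DecidableEq ι]
    (M : Matrix ι ι ℝ) (hM : M.IsHermitian) : FiniteMeasure ℝ :=
  ((Fintype.card ι : NNReal)⁻¹) • ∑ j, (diracProba (hM.eigenvalues j)).toFiniteMeasure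

/-- The resolvent `(M - z I)⁻¹`. -/
noncomputable def resolventMatrix {ι : Type} [Fintype ι] [DecidableEq ι]
    (M : Matrix ι ι ℝ) (z : ℂ) : Matrix ι ι ℂ :=
  (M.map (fun t : ℝ => (t : ℂ)) - z • (1 : Matrix ι ι ℂ))⁻¹

/-- The normalized trace of the resolvent. -/
noncomputable def normalizedResolventTrace {ι : Type} [Fintype ι] [DecidableEq ι]
    (M : Matrix ι ι ℝ) (z : ℂ) : ℂ :=
  ((Fintype.card ι : ℂ)⁻¹) * (resolventMatrix M z).trace

/-- The Stieltjes transform `g_μ (z) = ∫ (t - z)⁻¹ dμ(t)`. -/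
noncomputable def stieltjes (μ : Measure ℝ) (z : ℂ) : ℂ := ∫ t : ℝ, ((t : ℂ) - z)⁻¹ ∂μ

/-- The support of a measure on `ℝ`, as a subset of `ℂ`. -/
def supportC (μ : Measure ℝ) : Set ℂ := (fun t : ℝ => (t : ℂ)) '' μ.support

/-- `μ` is a probability measure whose Stieltjes transform `g` has positive imaginary part on the
upper half-plane and is, off the support of `μ`, of the form `g = ∑ ℓ, g_ℓ` where
`g_ℓ ^ 2 - (g + z) g_ℓ - c_ℓ = 0` for every `ℓ`. -/
def IsLimitMeasure {d : ℕ} (c : Fin d → ℝ) (μ : ProbabilityMeasure ℝ) : Prop :=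
  (∀ z : ℂ, 0 < z.im → 0 < (stieltjes μ z).im) ∧
  ∃ g : Fin d → ℂ → ℂ, ∀ z : ℂ, z ∉ supportC μ →
    stieltjes μ z = ∑ ℓ, g ℓ z ∧
    ∀ ℓ, (g ℓ z) ^ 2 - (stieltjes μ z + z) * g ℓ z - (c ℓ : ℂ) = 0

/-- The spiked tensor `∑ i, β i • x i 0 ⊗ ⋯ ⊗ x i (d - 1) + N ^ (-1/2) • W`. -/
noncomputable def spiked {d r : ℕ} {n : Fin d → ℕ} (β : Fin r → ℝ) (x : Fin r → Vectors n)
    (W : Tensor n) : Tensor n :=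
  ∑ i, β i • outer (x i) + (Real.sqrt (totalDim n))⁻¹ • W

/-- The `i`-th deflated tensor: `T_i = T - ∑ j < i, lam j • u j 0 ⊗ ⋯ ⊗ u j (d - 1)`. It is the
solution of `T_{i + 1} = T_i - lam i • u i 0 ⊗ ⋯ ⊗ u i (d - 1)` that starts from `T`. -/
def deflated {d r : ℕ} {n : Fin d → ℕ} (T : Tensor n) (lam : Fin r → ℝ) (u : Fin r → Vectors n)
    (i : Fin r) : Tensor n :=
  T - ∑ j ∈ Finset.univ.filter (fun j => j < i), lam j • outer (u j)

/-- `(l, a)` is a critical point of the rank-one approximation problem for `T`: `l > 0`, the `a ℓ`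
are unit vectors, and `T (a 0, …, a (ℓ - 1), ·, a (ℓ + 1), …, a (d - 1)) = l a_ℓ` for all `ℓ`. -/
def IsCriticalPoint {d : ℕ} {n : Fin d → ℕ} (T : Tensor n) (l : ℝ) (a : Vectors n) : Prop :=
  0 < l ∧ (∀ ℓ, ‖a ℓ‖ = 1) ∧ ∀ ℓ, contractOne T a ℓ = l • a ℓ

/-- The entries of the random tensor `W` are i.i.d. standard Gaussian random variables. -/
def IsGaussianNoise {d : ℕ} {n : Fin d → ℕ} {Ω : Type*} [MeasurableSpace Ω] (P : Measure Ω)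
    (W : Ω → Tensor n) : Prop :=
  (∀ p, HasLaw (fun ω => W ω p) (gaussianReal 0 1) P) ∧ iIndepFun (fun p ω => W ω p) P

end SpikedTensor

open SpikedTensor

/-! ### Gaussian calculus: concentration of Lipschitz functions and integration by parts. -/

section GaussianCalculus

variable {E : Type*} [NormedAddCommGroup E] [InnerProductSpace ℝ E] [FiniteDimensional ℝ E]
  [MeasurableSpace E] [BorelSpace E]

/-! The vectors found by deflation depend on the noise, so no conditioning on them is possible.
Instead, everything about the noise is proved uniformly over all families of unit vectors `a`. For
such a family the spikes and the deflation terms change the block matrix by a matrix of rank at most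
`2 * r * d` (`exists_blockMatrix_deflated_sub`). By the resolvent identity, a perturbation of
bounded rank moves the unnormalized trace of any diagonal block of the resolvent by a bounded amount
(`norm_trace_diagonal_resolvent_sub_le_card`), which disappears after division by `N`. What remains
is the matrix `A` of the pure noise, contracted against `a`.

For fixed `a`, let `T_ℓ` be the trace of the `ℓ`-th block of the resolvent `R` of `A`. Take the
trace of `A R = 1 + z R` over that block and integrate by parts. The entries of `A` are correlated
in an untidy way, but after compression to the orthogonal complements of the `a_k`, which is again a
perturbation of bounded rank, their covariance is a product of projections. The outcome is `n_ℓ + z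
E T_ℓ + N⁻¹ E T_ℓ (∑ E T_m - E T_ℓ) = O(1)`, see `norm_meanEquation_le`. Divided by `N`, this is the
quadratic equation for `g_ℓ` in the limit.

Uniformity in `a` comes from concentration. The unnormalized traces are Lipschitz in the noise with
a constant independent of `N`, so a deviation of size `N t` has probability of order `exp (-c N²
t²)`. A net of polynomially small mesh has only `exp (O(N log N))` points, so a union bound over it,
and over all sizes with the same `N`, is summable. Borel-Cantelli then gives almost sure convergence
whatever the joint law of the different tensors (`ae_eventually_notMem_deviationSet`).

The rest is deterministic. Asymptotic equations for the block traces force tightness of the spectral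
measures, and every cluster point satisfies the exact equations. For large `Im z` these have a
single bounded solution, and a Stieltjes transform on one horizontal line determines the measure.
Hence there is a single cluster point (`exists_isLimitMeasure_and_tendsto`). The existence of `μ` is
a by-product: it is the limit along one typical sample. -/

theorem integral_rotation_stdGaussian {G : Type*} [NormedAddCommGroup G] [NormedSpace ℝ G]
    {F : E × E → G} (hF : AEStronglyMeasurable F ((stdGaussian E).prod (stdGaussian E))) (θ : ℝ) :
    ∫ p : E × E, F (Real.cos θ • p.1 + Real.sin θ • p.2, -Real.sin θ • p.1 + Real.cos θ • p.2)
      ∂((stdGaussian E).prod (stdGaussian E)) =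
    ∫ p, F p ∂((stdGaussian E).prod (stdGaussian E)) := by
  have h := IsGaussian.map_rotation_eq_self (μ := stdGaussian E)
    (by simp) θ
  have hm : AEMeasurable (ContinuousLinearMap.rotation (E := E) θ)
    ((stdGaussian E).prod (stdGaussian E)) := by fun_prop
  conv_rhs => rw [← h]
  rw [integral_map hm (by rw [h]; exact hF)]
  rfl

theorem integrable_exp_mul_norm_stdGaussian (c : ℝ) :
    Integrable (fun x : E => Real.exp (c * ‖x‖)) (stdGaussian E) := by
  obtain ⟨C, hC, hint⟩ := IsGaussian.exists_integrable_exp_sq (stdGaussian E)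
  refine (hint.const_mul (Real.exp (c ^ 2 / (4 * C)))).mono' (by fun_prop) ?_
  filter_upwards with x
  rw [Real.norm_eq_abs, abs_of_pos (Real.exp_pos _), ← Real.exp_add]
  refine Real.exp_le_exp.2 ?_
  -- Completing the square dominates the linear exponent by the quadratic one of Fernique's theorem.
  have h1 : c ^ 2 / (4 * C) + C * ‖x‖ ^ 2 - c * ‖x‖ = (c - 2 * C * ‖x‖) ^ 2 / (4 * C) := by
    field_simp; ring
  have h2 : 0 ≤ (c - 2 * C * ‖x‖) ^ 2 / (4 * C) := by positivity
  linarith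

theorem integral_exp_clm_stdGaussian (L : E →L[ℝ] ℝ) :
    ∫ x, Real.exp (L x) ∂(stdGaussian E) = Real.exp (‖L‖ ^ 2 / 2) := by
  have h := IsGaussian.map_eq_gaussianReal (μ := stdGaussian E) L
  rw [integral_strongDual_stdGaussian, variance_dual_stdGaussian] at h
  have h2 := mgf_gaussianReal h 1
  simp only [mgf, one_mul] at h2
  rw [h2]
  congr 1
  simp

/-- One step of the Maurey-Pisier argument, before the number of steps goes to infinity. -/
theorem integral_exp_sub_le_step {f : E → ℝ} {K : NNReal} (hL : LipschitzWith K f) {B : ℝ}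
    (hB : ∀ x, |f x| ≤ B) (t : ℝ) (n : ℕ) (hn : 0 < n) :
    ∫ p : E × E, Real.exp (t * (f p.1 - f p.2)) ∂((stdGaussian E).prod (stdGaussian E)) ≤
    ∫ p : E × E, Real.exp (n * t * (f p.1 - f (Real.cos (Real.pi / 2 / n) • p.1 +
      Real.sin (Real.pi / 2 / n) • p.2))) ∂((stdGaussian E).prod (stdGaussian E)) := by
  set δ : ℝ := Real.pi / 2 / n with hδ
  have hn' : (0 : ℝ) < n := by exact_mod_cast hn
  have hfc : Continuous f := hL.continuous
  -- The path from `p.1` to `p.2` along a quarter circle, cut into `n` equal arcs.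
  let X : ℕ → E × E → E := fun j p => Real.cos (j * δ) • p.1 + Real.sin (j * δ) • p.2
  have hXc : ∀ j, Continuous (X j) := fun j => by fun_prop
  have hX0 : ∀ p, X 0 p = p.1 := fun p => by simp [X]
  have hXn : ∀ p, X n p = p.2 := fun p => by
    have : (n : ℝ) * δ = Real.pi / 2 := by rw [hδ]; field_simp
    simp [X, this]
  let G : E × E → ℝ := fun p => Real.exp (n * t * (f p.1 - f (Real.cos δ • p.1 +
      Real.sin δ • p.2)))
  have hGc : Continuous G := by fun_prop
  have hbd : ∀ a b : E, |f a - f b| ≤ 2 * B := fun a b => by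
    have := abs_sub (f a) (f b); linarith [hB a, hB b]
  have hint : ∀ (s : ℝ) (u v : E × E → E), Continuous u → Continuous v →
      Integrable (fun p => Real.exp (s * (f (u p) - f (v p))))
        ((stdGaussian E).prod (stdGaussian E)) := by
    intro s u v hu hv
    refine Integrable.of_bound (C := Real.exp (|s| * (2 * B))) (by
      apply Continuous.aestronglyMeasurable; fun_prop) ?_
    filter_upwards with p
    rw [Real.norm_eq_abs, abs_of_pos (Real.exp_pos _)]
    refine Real.exp_le_exp.2 ((le_abs_self _).trans ?_)
    rw [abs_mul]
    exact mul_le_mul_of_nonneg_left (hbd _ _) (abs_nonneg _)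
  -- A rotation by `j * δ` carries the first arc to the `j`-th one and preserves the law, so all
  -- increments have the same distribution.
  have hstep : ∀ j : ℕ, ∫ p : E × E, Real.exp (n * t * (f (X j p) - f (X (j + 1) p)))
      ∂((stdGaussian E).prod (stdGaussian E)) = ∫ p, G p
      ∂((stdGaussian E).prod (stdGaussian E)) := by
    intro j
    rw [← integral_rotation_stdGaussian hGc.aestronglyMeasurable (j * δ)]
    congr 1
    ext p
    simp only [G, X]
    have : Real.cos ((j + 1 : ℕ) * δ) • p.1 + Real.sin ((j + 1 : ℕ) * δ) • p.2 =
        Real.cos δ • (Real.cos (j * δ) • p.1 + Real.sin (j * δ) • p.2) +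
        Real.sin δ • (-Real.sin (j * δ) • p.1 + Real.cos (j * δ) • p.2) := by
      push_cast
      rw [add_mul, one_mul, Real.cos_add, Real.sin_add]
      module
    rw [this]
  -- Jensen's inequality with weights `1 / n`, applied to the telescoping sum of the increments.
  have hpt : ∀ p : E × E, Real.exp (t * (f p.1 - f p.2)) ≤
      ∑ j ∈ Finset.range n, (n : ℝ)⁻¹ * Real.exp (n * t * (f (X j p) - f (X (j + 1) p))) := by
    intro p
    have h := convexOn_exp.map_sum_le (t := Finset.range n) (w := fun _ => (n : ℝ)⁻¹)
      (p := fun j => n * t * (f (X j p) - f (X (j + 1) p))) (fun _ _ => by positivity)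
      (by simp [hn'.ne']) (fun _ _ => Set.mem_univ _)
    simp only [smul_eq_mul] at h
    refine le_trans (le_of_eq ?_) h
    congr 1
    have : ∀ j ∈ Finset.range n, (n : ℝ)⁻¹ * (n * t * (f (X j p) - f (X (j + 1) p))) =
        t * (f (X j p) - f (X (j + 1) p)) := fun j _ => by field_simp
    rw [Finset.sum_congr rfl this, ← Finset.mul_sum, Finset.sum_range_sub', hX0, hXn]
  calc _ ≤ ∫ p : E × E, ∑ j ∈ Finset.range n, (n : ℝ)⁻¹ *
          Real.exp (n * t * (f (X j p) - f (X (j + 1) p)))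
          ∂((stdGaussian E).prod (stdGaussian E)) := by
        refine integral_mono (hint _ _ _ continuous_fst continuous_snd)
          (integrable_finsetSum _ fun j _ => (hint _ _ _ (hXc _) (hXc _)).const_mul _) hpt
    _ = ∑ j ∈ Finset.range n, (n : ℝ)⁻¹ * ∫ p, G p ∂((stdGaussian E).prod (stdGaussian E)) := by
        rw [integral_finsetSum _ fun j _ => (hint _ _ _ (hXc _) (hXc _)).const_mul _]
        refine Finset.sum_congr rfl fun j _ => ?_
        rw [integral_const_mul, hstep]
    _ = _ := by
        rw [Finset.sum_const, Finset.card_range, nsmul_eq_mul, ← mul_assoc,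
          mul_inv_cancel₀ hn'.ne', one_mul]

/-- As the number of arcs grows, `n` times one increment tends to `-(π / 2)` times the derivative of
`f` at `p.1` in the direction `p.2`. Given `p.1`, this is a centred Gaussian of variance at most `(π
/ 2)² K²`, which gives the constant `π² / 8`. -/
theorem integral_exp_sub_le {f : E → ℝ} {K : NNReal} (hL : LipschitzWith K f)
    (hd : Differentiable ℝ f) {B : ℝ} (hB : ∀ x, |f x| ≤ B) (t : ℝ) :
    ∫ p : E × E, Real.exp (t * (f p.1 - f p.2)) ∂((stdGaussian E).prod (stdGaussian E)) ≤
      Real.exp (Real.pi ^ 2 * t ^ 2 * K ^ 2 / 8) := by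
  have hfc : Continuous f := hL.continuous
  let H : E × E → ℝ := fun p => Real.exp (-(t * (Real.pi / 2)) * fderiv ℝ f p.1 p.2)
  have hmeas : Measurable H := by
    -- The derivative of `f` is not assumed continuous, so the limiting integrand is only known to
    -- be measurable.
    have h1 : Measurable (fun p : E × E => fderiv ℝ f p.1 p.2) := by
      have h0 := measurable_fderiv ℝ f
      have : (fun p : E × E => fderiv ℝ f p.1 p.2) =
        (fun q : (E →L[ℝ] ℝ) × E => q.1 q.2) ∘ (fun p : E × E => (fderiv ℝ f p.1, p.2)) := rfl
      rw [this]
      refine Measurable.comp ?_ (by fun_prop)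
      exact (isBoundedBilinearMap_apply.continuous).measurable
    fun_prop
  have hlim : Tendsto (fun n : ℕ => ∫ p : E × E, Real.exp ((n + 1 : ℕ) * t *
      (f p.1 - f (Real.cos (Real.pi / 2 / (n + 1 : ℕ)) • p.1 +
      Real.sin (Real.pi / 2 / (n + 1 : ℕ)) • p.2))) ∂((stdGaussian E).prod (stdGaussian E)))
      atTop (𝓝 (∫ p, H p ∂((stdGaussian E).prod (stdGaussian E)))) := by
    refine tendsto_integral_of_dominated_convergence
      (fun p => Real.exp (|t| * K * 2 * ‖p.1‖) * Real.exp (|t| * K * 2 * ‖p.2‖)) ?_ ?_ ?_ ?_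
    · intro n
      apply Continuous.aestronglyMeasurable
      fun_prop
    · exact (integrable_exp_mul_norm_stdGaussian _).mul_prod (integrable_exp_mul_norm_stdGaussian _)
    · intro n
      filter_upwards with p
      rw [Real.norm_eq_abs, abs_of_pos (Real.exp_pos _), ← Real.exp_add]
      refine Real.exp_le_exp.2 ((le_abs_self _).trans ?_)
      set m : ℝ := ((n + 1 : ℕ) : ℝ) with hm
      have hm0 : 1 ≤ m := by rw [hm]; push_cast; linarith [Nat.cast_nonneg (α := ℝ) n]
      set δ := Real.pi / 2 / m with hδ
      have hδ0 : 0 ≤ δ := by positivity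
      -- The product of the number of arcs and the angle is `π / 2`, which makes the dominating
      -- function independent of the number of arcs. The bound `δ ≤ 2` then turns `1 - cos δ ≤ δ² /
      -- 2` into a bound linear in `δ`.
      have hmδ : m * δ ≤ 2 := by
        rw [hδ, mul_div_cancel₀ _ (by positivity)]; linarith [Real.pi_le_four]
      have hδ2 : δ ≤ 2 := le_trans (by nlinarith) hmδ
      have h1 : |f p.1 - f (Real.cos δ • p.1 + Real.sin δ • p.2)| ≤
          K * (δ * ‖p.1‖ + δ * ‖p.2‖) := by
        rw [← Real.dist_eq]
        refine (hL.dist_le_mul _ _).trans (mul_le_mul_of_nonneg_left ?_ K.2)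
        rw [dist_eq_norm]
        have : p.1 - (Real.cos δ • p.1 + Real.sin δ • p.2) =
            (1 - Real.cos δ) • p.1 - Real.sin δ • p.2 := by module
        rw [this]
        refine (norm_sub_le _ _).trans (add_le_add ?_ ?_)
        · rw [norm_smul]
          refine mul_le_mul_of_nonneg_right ?_ (norm_nonneg _)
          rw [Real.norm_eq_abs, abs_of_nonneg (by linarith [Real.cos_le_one δ])]
          have := Real.one_sub_sq_div_two_le_cos (x := δ)
          nlinarith
        · rw [norm_smul]
          refine mul_le_mul_of_nonneg_right ?_ (norm_nonneg _)
          rw [Real.norm_eq_abs]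
          exact (Real.abs_sin_le_abs).trans (abs_of_nonneg hδ0).le
      rw [abs_mul, abs_mul, abs_of_nonneg (by linarith : 0 ≤ m)]
      calc m * |t| * |f p.1 - f (Real.cos δ • p.1 + Real.sin δ • p.2)|
          ≤ m * |t| * (K * (δ * ‖p.1‖ + δ * ‖p.2‖)) := by gcongr
        _ = (m * δ) * (|t| * K * (‖p.1‖ + ‖p.2‖)) := by ring
        _ ≤ 2 * (|t| * K * (‖p.1‖ + ‖p.2‖)) := by gcongr
        _ = _ := by ring
    · filter_upwards with p
      refine (Real.continuous_exp.tendsto _).comp ?_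
      have hcurve : HasDerivAt (fun θ : ℝ => f (Real.cos θ • p.1 + Real.sin θ • p.2))
          (fderiv ℝ f p.1 p.2) 0 := by
        have h1 : HasDerivAt (fun θ : ℝ => Real.cos θ • p.1 + Real.sin θ • p.2) p.2 0 := by
          have := ((Real.hasDerivAt_cos 0).smul_const p.1).add
            ((Real.hasDerivAt_sin 0).smul_const p.2)
          refine this.congr_deriv ?_
          simp
        have h2 : HasFDerivAt f (fderiv ℝ f p.1)
            ((fun θ : ℝ => Real.cos θ • p.1 + Real.sin θ • p.2) 0) := by
          simpa using (hd p.1).hasFDerivAt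
        exact h2.comp_hasDerivAt 0 h1
      have hslope := hcurve.tendsto_slope
      have hseq : Tendsto (fun n : ℕ => Real.pi / 2 / ((n + 1 : ℕ) : ℝ)) atTop (𝓝[≠] 0) := by
        refine tendsto_nhdsWithin_iff.2 ⟨?_, ?_⟩
        · exact (tendsto_const_div_atTop_nhds_zero_nat _).comp (tendsto_add_atTop_nat 1)
        · filter_upwards with n
          have : 0 < Real.pi / 2 / ((n + 1 : ℕ) : ℝ) := by positivity
          exact this.ne'
      have h3 := (hslope.comp hseq).const_mul (-(t * (Real.pi / 2)))
      refine h3.congr fun n => ?_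
      simp only [Function.comp, slope_def_field, Real.cos_zero, Real.sin_zero, one_smul, zero_smul,
        add_zero, sub_zero]
      have : ((n + 1 : ℕ) : ℝ) ≠ 0 := by positivity
      field_simp
      ring
  have hle : ∫ p, H p ∂((stdGaussian E).prod (stdGaussian E)) ≤
      Real.exp (Real.pi ^ 2 * t ^ 2 * K ^ 2 / 8) := by
    have hfd : ∀ x, ‖fderiv ℝ f x‖ ≤ K := fun x => norm_fderiv_le_of_lipschitz ℝ hL
    have hHint : Integrable H ((stdGaussian E).prod (stdGaussian E)) := by
      refine ((integrable_const (1 : ℝ)).mul_prod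
        (integrable_exp_mul_norm_stdGaussian (E := E) (|t| * (Real.pi / 2) * K))).mono'
        hmeas.aestronglyMeasurable ?_
      filter_upwards with p
      rw [Real.norm_eq_abs, abs_of_pos (Real.exp_pos _), one_mul]
      refine Real.exp_le_exp.2 ((le_abs_self _).trans ?_)
      rw [abs_mul, abs_neg, abs_mul, abs_of_pos (by positivity : (0 : ℝ) < Real.pi / 2), mul_assoc _ (K : ℝ)]
      refine mul_le_mul_of_nonneg_left ?_ (by positivity)
      exact ((fderiv ℝ f p.1).le_opNorm p.2).trans
        (mul_le_mul_of_nonneg_right (hfd _) (norm_nonneg _))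
    rw [integral_prod _ hHint]
    have hin : ∀ x : E, ∫ y, H (x, y) ∂(stdGaussian E) ≤
        Real.exp (Real.pi ^ 2 * t ^ 2 * K ^ 2 / 8) := by
      intro x
      have := integral_exp_clm_stdGaussian ((-(t * (Real.pi / 2))) • fderiv ℝ f x)
      simp only [FunLike.coe_smul, Pi.smul_apply, smul_eq_mul] at this
      simp only [H]
      rw [this]
      refine Real.exp_le_exp.2 ?_
      rw [norm_smul, mul_pow, Real.norm_eq_abs, sq_abs]
      have h1 : ‖fderiv ℝ f x‖ ^ 2 ≤ (K : ℝ) ^ 2 := by gcongr; exact hfd x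
      have h2 : (-(t * (Real.pi / 2))) ^ 2 * ‖fderiv ℝ f x‖ ^ 2 ≤
        (-(t * (Real.pi / 2))) ^ 2 * (K : ℝ) ^ 2 := by gcongr
      nlinarith
    calc _ ≤ ∫ _ : E, Real.exp (Real.pi ^ 2 * t ^ 2 * K ^ 2 / 8) ∂(stdGaussian E) :=
          integral_mono hHint.integral_prod_left (integrable_const _) hin
      _ = _ := by simp
  exact (ge_of_tendsto' hlim fun n => integral_exp_sub_le_step hL hB t (n + 1) (by omega)).trans hle

/-- Exponential moments of a Lipschitz function of a Gaussian vector (Maurey-Pisier). -/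
theorem integral_exp_sub_integral_le {f : E → ℝ} {K : NNReal} (hL : LipschitzWith K f)
    (hd : Differentiable ℝ f) {B : ℝ} (hB : ∀ x, |f x| ≤ B) (t : ℝ) :
    ∫ x, Real.exp (t * (f x - ∫ y, f y ∂(stdGaussian E))) ∂(stdGaussian E) ≤
      Real.exp (Real.pi ^ 2 * t ^ 2 * K ^ 2 / 8) := by
  have hfc : Continuous f := hL.continuous
  set m := ∫ y, f y ∂(stdGaussian E) with hm
  have hfint : Integrable f (stdGaussian E) :=
    Integrable.of_bound hfc.aestronglyMeasurable B (ae_of_all _ hB)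
  have hint : ∀ s : ℝ, Integrable (fun x => Real.exp (s * (f x - m))) (stdGaussian E) := by
    intro s
    refine Integrable.of_bound (C := Real.exp (|s| * (B + |m|))) (by
      apply Continuous.aestronglyMeasurable; fun_prop) ?_
    filter_upwards with p
    rw [Real.norm_eq_abs, abs_of_pos (Real.exp_pos _)]
    refine Real.exp_le_exp.2 ((le_abs_self _).trans ?_)
    rw [abs_mul]
    exact mul_le_mul_of_nonneg_left ((abs_sub _ _).trans (by linarith [hB p])) (abs_nonneg _)
  -- The exponential of a centred variable has mean at least one, so the factor of the independent
  -- copy can be dropped.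
  have h1 : 1 ≤ ∫ y, Real.exp (-t * (f y - m)) ∂(stdGaussian E) := by
    have : ∫ y, (1 + -t * (f y - m)) ∂(stdGaussian E) = 1 := by
      have h0 : Integrable (fun y => -t * (f y - m)) (stdGaussian E) :=
        (hfint.sub (integrable_const _)).const_mul _
      rw [integral_add (integrable_const _) h0,
        integral_const_mul, integral_sub hfint (integrable_const _)]
      simp [hm]
    rw [← this]
    refine integral_mono ((integrable_const _).add
      ((hfint.sub (integrable_const _)).const_mul _)) (hint _) fun y => ?_
    simpa [add_comm] using Real.add_one_le_exp (-t * (f y - m))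
  have h2 := integral_exp_sub_le hL hd hB t
  have h3 : ∫ p : E × E, Real.exp (t * (f p.1 - f p.2)) ∂((stdGaussian E).prod (stdGaussian E)) =
      (∫ x, Real.exp (t * (f x - m)) ∂(stdGaussian E)) *
        ∫ y, Real.exp (-t * (f y - m)) ∂(stdGaussian E) := by
    rw [← integral_prod_mul]
    congr 1; ext p
    rw [← Real.exp_add]; congr 1; ring
  rw [h3] at h2
  have h0 : 0 ≤ ∫ x, Real.exp (t * (f x - m)) ∂(stdGaussian E) :=
    integral_nonneg fun x => (Real.exp_pos _).le
  nlinarith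

theorem integrable_exp_of_bounded {f : E → ℝ} (hfc : Continuous f) {B : ℝ} (hB : ∀ x, |f x| ≤ B)
    (s m : ℝ) : Integrable (fun x => Real.exp (s * (f x - m))) (stdGaussian E) := by
  refine Integrable.of_bound (C := Real.exp (|s| * (B + |m|))) (by
    apply Continuous.aestronglyMeasurable; fun_prop) ?_
  filter_upwards with p
  rw [Real.norm_eq_abs, abs_of_pos (Real.exp_pos _)]
  refine Real.exp_le_exp.2 ((le_abs_self _).trans ?_)
  rw [abs_mul]
  exact mul_le_mul_of_nonneg_left ((abs_sub _ _).trans (by linarith [hB p])) (abs_nonneg _)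

/-- Chernoff's bound for the Maurey-Pisier exponential moment. With `π² ≤ 10` the exponent is at
most `-s t + (5 / 4) s² K²`, and `s = 2 t / (5 K²)` minimizes it. -/
theorem measureReal_sub_integral_ge_le {f : E → ℝ} {K : NNReal} (hK : 0 < K)
    (hL : LipschitzWith K f) (hd : Differentiable ℝ f) {B : ℝ} (hB : ∀ x, |f x| ≤ B) {t : ℝ}
    (ht : 0 ≤ t) :
    (stdGaussian E).real {x | t ≤ f x - ∫ y, f y ∂(stdGaussian E)} ≤
      Real.exp (-(t ^ 2 / (5 * K ^ 2))) := by
  set m := ∫ y, f y ∂(stdGaussian E) with hm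
  have hK' : (0 : ℝ) < K := hK
  set s : ℝ := t * (2 / (5 * K ^ 2)) with hs
  have hs0 : 0 ≤ s := by positivity
  have h1 := measure_ge_le_exp_mul_mgf (μ := stdGaussian E) (X := fun x => f x - m) t hs0
    (integrable_exp_of_bounded hL.continuous hB s m)
  refine h1.trans ?_
  have h2 := integral_exp_sub_integral_le hL hd hB s
  rw [mgf]
  calc _ ≤ Real.exp (-s * t) * Real.exp (Real.pi ^ 2 * s ^ 2 * K ^ 2 / 8) := by gcongr
    _ ≤ _ := by
      rw [← Real.exp_add]
      refine Real.exp_le_exp.2 ?_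
      have hpi : Real.pi ^ 2 ≤ 10 := by nlinarith [Real.pi_lt_d2, Real.pi_pos]
      have h4 : Real.pi ^ 2 * s ^ 2 * K ^ 2 / 8 ≤ 10 * s ^ 2 * K ^ 2 / 8 := by gcongr
      have h5 : 10 * s ^ 2 * K ^ 2 / 8 = t ^ 2 / (5 * K ^ 2) := by
        rw [hs]; field_simp; ring
      have h6 : s * t = 2 * (t ^ 2 / (5 * K ^ 2)) := by rw [hs]; field_simp
      linarith

theorem measureReal_abs_sub_integral_ge_le {f : E → ℝ} {K : NNReal} (hK : 0 < K)
    (hL : LipschitzWith K f) (hd : Differentiable ℝ f) {B : ℝ} (hB : ∀ x, |f x| ≤ B) {t : ℝ}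
    (ht : 0 ≤ t) :
    (stdGaussian E).real {x | t ≤ |f x - ∫ y, f y ∂(stdGaussian E)|} ≤
      2 * Real.exp (-(t ^ 2 / (5 * K ^ 2))) := by
  have h1 := measureReal_sub_integral_ge_le hK hL hd hB ht
  have h2 := measureReal_sub_integral_ge_le (f := fun x => - f x) hK hL.neg hd.neg
    (B := B) (by simpa using hB) ht
  rw [integral_neg] at h2
  refine (measureReal_mono (s₂ := {x | t ≤ f x - ∫ y, f y ∂(stdGaussian E)} ∪
    {x | t ≤ - f x - -∫ y, f y ∂(stdGaussian E)}) ?_).trans ((measureReal_union_le _ _).trans ?_)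
  · intro x hx
    simp only [Set.mem_ofPred_eq, Set.mem_union] at hx ⊢
    rcases le_abs.1 hx with h | h
    · exact Or.inl h
    · right; linarith
  · linarith

/-- Use `|v| ≤ exp v + exp (-v)` for `v = (f - m) / K` and the exponential moments at `± 1 / K`. The
bound is of order `K` in every dimension. -/
theorem integral_abs_sub_integral_le {f : E → ℝ} {K : NNReal} (hK : 0 < K)
    (hL : LipschitzWith K f) (hd : Differentiable ℝ f) {B : ℝ} (hB : ∀ x, |f x| ≤ B) :
    ∫ x, |f x - ∫ y, f y ∂(stdGaussian E)| ∂(stdGaussian E) ≤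
      2 * Real.exp (Real.pi ^ 2 / 8) * K := by
  set m := ∫ y, f y ∂(stdGaussian E) with hm
  have hK' : (0 : ℝ) < K := hK
  have h1 := integral_exp_sub_integral_le hL hd hB (1 / K)
  have h2 := integral_exp_sub_integral_le hL hd hB (-(1 / K))
  have e1 : Real.pi ^ 2 * (1 / (K : ℝ)) ^ 2 * K ^ 2 / 8 = Real.pi ^ 2 / 8 := by field_simp
  have e2 : Real.pi ^ 2 * (-(1 / (K : ℝ))) ^ 2 * K ^ 2 / 8 = Real.pi ^ 2 / 8 := by field_simp
  rw [e1, ← hm] at h1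
  rw [e2, ← hm] at h2
  have i1 := integrable_exp_of_bounded hL.continuous hB (1 / K) m
  have i2 := integrable_exp_of_bounded hL.continuous hB (-(1 / K)) m
  have h3 : ∫ x, |f x - m| ∂(stdGaussian E) ≤ ∫ x, K * (Real.exp (1 / K * (f x - m)) +
      Real.exp (-(1 / K) * (f x - m))) ∂(stdGaussian E) := by
    have hc := hL.continuous
    refine integral_mono (Integrable.of_bound (C := B + |m|) (by
      apply Continuous.aestronglyMeasurable; fun_prop) ?_) ((i1.add i2).const_mul _) fun x => ?_
    · filter_upwards with x
      rw [Real.norm_eq_abs, abs_abs]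
      exact (abs_sub _ _).trans (by linarith [hB x])
    · have ha := Real.add_one_le_exp (1 / K * (f x - m))
      have hb := Real.add_one_le_exp (-(1 / K) * (f x - m))
      have ha0 := Real.exp_pos (1 / K * (f x - m))
      have hb0 := Real.exp_pos (-(1 / K) * (f x - m))
      have : |1 / K * (f x - m)| ≤ Real.exp (1 / K * (f x - m)) +
          Real.exp (-(1 / K) * (f x - m)) := by
        refine abs_le.2 ⟨?_, ?_⟩ <;> nlinarith
      rw [abs_mul, abs_of_pos (by positivity : 0 < 1 / (K : ℝ))] at this
      calc |f x - m| = K * (1 / K * |f x - m|) := by field_simp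
        _ ≤ _ := by gcongr
  refine h3.trans ?_
  rw [integral_const_mul, integral_add i1 i2]
  nlinarith

/-- Gaussian integration by parts. -/
theorem integral_stdGaussian_byParts {F : E → E →L[ℝ] ℂ} (hF : ContDiff ℝ 1 F) {B B' : ℝ}
    (hB : ∀ x, ‖F x‖ ≤ B) (hB' : ∀ x, ‖fderiv ℝ F x‖ ≤ B') :
    ∫ x, F x x ∂(stdGaussian E) =
      ∫ x, ∫ y, fderiv ℝ F x y y ∂(stdGaussian E) ∂(stdGaussian E) := by
  have hFc : Continuous F := hF.continuous
  have hF'c : Continuous (fderiv ℝ F) := hF.continuous_fderiv one_ne_zero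
  have hFd : Differentiable ℝ F := hF.differentiable one_ne_zero
  have hB0 : 0 ≤ B := (norm_nonneg _).trans (hB 0)
  have hB'0 : 0 ≤ B' := (norm_nonneg (fderiv ℝ F 0)).trans (hB' 0)
  -- `(X θ, Y θ)` is a rotated pair of independent Gaussians and `Y` is the derivative of `X`. The
  -- mean of `F (X θ) (Y θ)` does not depend on `θ`, and the vanishing of its derivative at `θ = 0`
  -- is the formula.
  let X : ℝ → E × E → E := fun θ p => Real.cos θ • p.1 + Real.sin θ • p.2
  let Y : ℝ → E × E → E := fun θ p => -Real.sin θ • p.1 + Real.cos θ • p.2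
  have hXn : ∀ θ p, ‖X θ p‖ ≤ ‖p.1‖ + ‖p.2‖ := fun θ p => by
    refine (norm_add_le _ _).trans (add_le_add ?_ ?_) <;> rw [norm_smul]
    · exact mul_le_of_le_one_left (norm_nonneg _) (Real.abs_cos_le_one _)
    · exact mul_le_of_le_one_left (norm_nonneg _) (Real.abs_sin_le_one _)
  have hYn : ∀ θ p, ‖Y θ p‖ ≤ ‖p.1‖ + ‖p.2‖ := fun θ p => by
    refine (norm_add_le _ _).trans (add_le_add ?_ ?_) <;> rw [norm_smul]
    · rw [norm_neg]
      exact mul_le_of_le_one_left (norm_nonneg _) (Real.abs_sin_le_one _)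
    · exact mul_le_of_le_one_left (norm_nonneg _) (Real.abs_cos_le_one _)
  have hXd : ∀ θ p, HasDerivAt (fun θ => X θ p) (Y θ p) θ := fun θ p =>
    ((Real.hasDerivAt_cos θ).smul_const p.1).add ((Real.hasDerivAt_sin θ).smul_const p.2)
  have hYd : ∀ θ p, HasDerivAt (fun θ => Y θ p) (-X θ p) θ := fun θ p => by
    have := ((Real.hasDerivAt_sin θ).neg.smul_const p.1).add
      ((Real.hasDerivAt_cos θ).smul_const p.2)
    refine this.congr_deriv ?_
    simp only [X]; module
  have happ : Continuous (fun q : (E →L[ℝ] ℂ) × E => q.1 q.2) :=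
    isBoundedBilinearMap_apply.continuous
  have hn1 : Integrable (fun p : E × E => ‖p.1‖ + ‖p.2‖)
      ((stdGaussian E).prod (stdGaussian E)) := by
    have : Integrable (fun x : E => ‖x‖) (stdGaussian E) := IsGaussian.integrable_id.norm
    exact (this.comp_fst _).add (this.comp_snd _)
  have hn2 : Integrable (fun p : E × E => (‖p.1‖ + ‖p.2‖) ^ 2)
      ((stdGaussian E).prod (stdGaussian E)) := by
    have h2 : Integrable (fun x : E => ‖x‖ ^ 2) (stdGaussian E) :=
      (IsGaussian.memLp_id (stdGaussian E) 2 (by simp)).integrable_norm_pow (by simp)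
    refine (((h2.comp_fst _).add (h2.comp_snd _)).const_mul 2).mono' (by
      apply Continuous.aestronglyMeasurable; fun_prop) ?_
    filter_upwards with p
    rw [Real.norm_eq_abs, abs_of_nonneg (by positivity)]
    simp only [Pi.add_apply]
    nlinarith [sq_nonneg (‖p.1‖ - ‖p.2‖)]
  have hcont : ∀ θ, Continuous (fun p : E × E => F (X θ p) (Y θ p)) := fun θ =>
    happ.comp ((hFc.comp (by fun_prop)).prodMk (by fun_prop))
  have hDc : ∀ θ, Continuous (fun p : E × E => fderiv ℝ F (X θ p) (Y θ p) (Y θ p)) := fun θ => by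
    have hX : Continuous (X θ) := by fun_prop
    have hY : Continuous (Y θ) := by fun_prop
    exact ((hF'c.comp hX).clm_apply hY).clm_apply hY
  have hSc : ∀ θ, Continuous (fun p : E × E => F (X θ p) (X θ p)) := fun θ => by
    have hX : Continuous (X θ) := by fun_prop
    exact (hFc.comp hX).clm_apply hX
  have hconst : ∀ θ, ∫ p, F (X θ p) (Y θ p) ∂((stdGaussian E).prod (stdGaussian E)) =
      ∫ p : E × E, F p.1 p.2 ∂((stdGaussian E).prod (stdGaussian E)) := fun θ =>
    integral_rotation_stdGaussian (F := fun p : E × E => F p.1 p.2)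
      ((hFc.comp continuous_fst).clm_apply continuous_snd).aestronglyMeasurable θ
  have hderiv := hasDerivAt_integral_of_dominated_loc_of_deriv_le
    (μ := (stdGaussian E).prod (stdGaussian E))
    (F := fun θ p => F (X θ p) (Y θ p))
    (F' := fun θ p => fderiv ℝ F (X θ p) (Y θ p) (Y θ p) + F (X θ p) (-X θ p))
    (x₀ := (0 : ℝ)) (s := Set.univ) (bound := fun p => B' * (‖p.1‖ + ‖p.2‖) ^ 2 +
      B * (‖p.1‖ + ‖p.2‖)) univ_mem
    (Eventually.of_forall fun θ => (hcont θ).aestronglyMeasurable)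
    (by
      refine (hn1.const_mul B).mono' (hcont 0).aestronglyMeasurable ?_
      filter_upwards with p
      exact ((F _).le_opNorm _).trans (mul_le_mul (hB _) (hYn _ _) (norm_nonneg _) hB0))
    (((hDc 0).add (by simp only [map_neg]; exact (hSc 0).neg)).aestronglyMeasurable)
    (by
      filter_upwards with p θ _
      refine (norm_add_le _ _).trans (add_le_add ?_ ?_)
      · refine ((fderiv ℝ F (X θ p) (Y θ p)).le_opNorm _).trans ?_
        rw [sq, ← mul_assoc]
        refine mul_le_mul ?_ (hYn _ _) (norm_nonneg _) (by positivity)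
        exact ((fderiv ℝ F (X θ p)).le_opNorm _).trans
          (mul_le_mul (hB' _) (hYn _ _) (norm_nonneg _) hB'0)
      · refine ((F _).le_opNorm _).trans (mul_le_mul (hB _) ?_ (norm_nonneg _) hB0)
        rw [norm_neg]; exact hXn _ _)
    ((hn2.const_mul B').add (hn1.const_mul B))
    (by
      filter_upwards with p θ _
      have h1 : HasDerivAt (fun θ => F (X θ p)) (fderiv ℝ F (X θ p) (Y θ p)) θ :=
        (hFd (X θ p)).hasFDerivAt.comp_hasDerivAt θ (hXd θ p)
      exact h1.clm_apply (hYd θ p))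
  have h0 := hderiv.2.unique (by
    rw [funext hconst]; exact hasDerivAt_const (0 : ℝ) _)
  have hX0 : ∀ p : E × E, X 0 p = p.1 := fun p => by simp [X]
  have hY0 : ∀ p : E × E, Y 0 p = p.2 := fun p => by simp [Y]
  simp only [hX0, hY0, map_neg] at h0
  have hD0 := hDc 0
  have hS0 := hSc 0
  simp only [hX0, hY0] at hD0 hS0
  have iD : Integrable (fun p : E × E => fderiv ℝ F p.1 p.2 p.2)
      ((stdGaussian E).prod (stdGaussian E)) := by
    refine (hn2.const_mul B').mono' hD0.aestronglyMeasurable ?_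
    filter_upwards with p
    refine ((fderiv ℝ F p.1 p.2).le_opNorm _).trans ?_
    have h1 : ‖p.2‖ ≤ ‖p.1‖ + ‖p.2‖ := by linarith [norm_nonneg p.1]
    rw [sq, ← mul_assoc]
    exact mul_le_mul (((fderiv ℝ F p.1).le_opNorm _).trans
      (mul_le_mul (hB' _) h1 (norm_nonneg _) hB'0)) h1 (norm_nonneg _) (by positivity)
  have iS : Integrable (fun p : E × E => F p.1 p.1)
      ((stdGaussian E).prod (stdGaussian E)) := by
    refine (hn1.const_mul B).mono' hS0.aestronglyMeasurable ?_
    filter_upwards with p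
    exact ((F _).le_opNorm _).trans (mul_le_mul (hB _) (by linarith [norm_nonneg p.2])
      (norm_nonneg _) hB0)
  simp only [← sub_eq_add_neg] at h0
  rw [integral_sub iD iS, integral_prod _ iD] at h0
  have h5 : ∫ p : E × E, F p.1 p.1 ∂((stdGaussian E).prod (stdGaussian E)) =
      ∫ x, F x x ∂(stdGaussian E) := by
    rw [integral_prod _ iS]; simp
  rw [h5] at h0
  exact (sub_eq_zero.1 h0).symm

end GaussianCalculus

/-! ### Resolvents of symmetric matrices: norm bounds and trace perturbation. -/

section Resolvent

set_option linter.unusedSectionVars false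

open scoped Matrix.Norms.L2Operator

variable {ι : Type} [Fintype ι] [DecidableEq ι]

theorem norm_entry_le_l2OpNorm (A : Matrix ι ι ℂ) (i j : ι) : ‖A i j‖ ≤ ‖A‖ := by
  have h := Matrix.l2_opNorm_mulVec A (EuclideanSpace.single j 1)
  simp only [PiLp.norm_single, norm_one, mul_one] at h
  refine le_trans ?_ h
  have := PiLp.norm_apply_le (p := 2) ((EuclideanSpace.equiv ι ℂ).symm
    (A.mulVec (EuclideanSpace.single j (1 : ℂ)))) i
  simpa using this

/-- Every column is the image of a unit vector, so its Euclidean norm is at most the operator norm.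
-/
theorem sum_norm_sq_le_l2OpNorm (A : Matrix ι ι ℂ) :
    ∑ i, ∑ j, ‖A i j‖ ^ 2 ≤ Fintype.card ι * ‖A‖ ^ 2 := by
  rw [Finset.sum_comm]
  have : ∀ j, ∑ i, ‖A i j‖ ^ 2 ≤ ‖A‖ ^ 2 := by
    intro j
    have h := Matrix.l2_opNorm_mulVec A (EuclideanSpace.single j 1)
    simp only [PiLp.norm_single, norm_one, mul_one] at h
    have h2 := pow_le_pow_left₀ (norm_nonneg _) h 2
    refine le_trans (le_of_eq ?_) h2
    rw [EuclideanSpace.norm_sq_eq]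
    simp
  calc _ ≤ ∑ _j : ι, ‖A‖ ^ 2 := Finset.sum_le_sum fun j _ => this j
    _ = _ := by simp

theorem norm_trace_mul_le (A B : Matrix ι ι ℂ) :
    ‖(A * B).trace‖ ≤ √(∑ i, ∑ j, ‖A i j‖ ^ 2) * √(∑ i, ∑ j, ‖B i j‖ ^ 2) := by
  have h1 : ‖(A * B).trace‖ ≤ ∑ p : ι × ι, ‖A p.1 p.2‖ * ‖B p.2 p.1‖ := by
    rw [Matrix.trace, Fintype.sum_prod_type]
    refine (norm_sum_le _ _).trans (Finset.sum_le_sum fun i _ => ?_)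
    rw [Matrix.diag_apply, Matrix.mul_apply]
    refine (norm_sum_le _ _).trans (Finset.sum_le_sum fun j _ => ?_)
    rw [norm_mul]
  refine h1.trans ((Real.sum_mul_le_sqrt_mul_sqrt _ _ _).trans (le_of_eq ?_))
  rw [Fintype.sum_prod_type, Fintype.sum_prod_type, Finset.sum_comm (f := fun i j => ‖B i j‖ ^ 2)]

/-- The trace can be computed on the range of `A`. In an orthonormal basis of the range it is a sum
of as many terms as the rank, each at most the operator norm. -/
theorem norm_trace_le_rank_mul (A : Matrix ι ι ℂ) : ‖A.trace‖ ≤ A.rank * ‖A‖ := by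
  set T := Matrix.toEuclideanLin A with hT
  have hr : A.rank = Module.finrank ℂ (LinearMap.range T) := by
    rw [hT, Matrix.toEuclideanLin_eq_toLin_orthonormal]
    exact A.rank_eq_finrank_range_toLin _ _
  have htr : LinearMap.trace ℂ _ T = A.trace := by
    rw [hT, Matrix.toEuclideanLin_eq_toLin_orthonormal, Matrix.trace_toLin_eq]
  set p := LinearMap.range T
  have h2 := LinearMap.trace_restrict_eq_of_forall_mem p T (fun x => LinearMap.mem_range_self T x)
  rw [← htr, ← h2, LinearMap.trace_eq_sum_inner _ (stdOrthonormalBasis ℂ p)]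
  refine (norm_sum_le _ _).trans ?_
  calc _ ≤ ∑ _i : Fin (Module.finrank ℂ p), ‖A‖ := Finset.sum_le_sum fun i _ => by
        refine (norm_inner_le_norm _ _).trans ?_
        rw [(stdOrthonormalBasis ℂ p).norm_eq_one, one_mul]
        have h3 := Matrix.l2_opNorm_mulVec A (stdOrthonormalBasis ℂ p i : EuclideanSpace ℂ ι)
        have h4 : ‖((stdOrthonormalBasis ℂ p i : p) : EuclideanSpace ℂ ι)‖ = 1 :=
          (stdOrthonormalBasis ℂ p).norm_eq_one i
        rw [h4, mul_one] at h3
        exact h3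
    _ = _ := by simp [hr]

/-- The quadratic form of `H` is real, so the imaginary part of the quadratic form of `H - z` at `v`
is `-z.im * ‖v‖ ^ 2`; Cauchy-Schwarz finishes. Both the invertibility of `H - z` and the bound for
the resolvent follow from this. -/
theorem norm_le_norm_sub_smul_mulVec {H : Matrix ι ι ℂ} (hH : H.IsHermitian) (z : ℂ)
    (v : EuclideanSpace ℂ ι) :
    |z.im| * ‖v‖ ≤ ‖Matrix.toEuclideanCLM (n := ι) (𝕜 := ℂ) (H - z • 1) v‖ := by
  have hs : (Matrix.toEuclideanLin H).IsSymmetric := Matrix.isSymmetric_toEuclideanLin_iff.2 hH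
  have h0 := hs.im_inner_self_apply v
  have h1 : Matrix.toEuclideanCLM (n := ι) (𝕜 := ℂ) (H - z • 1) v =
      Matrix.toEuclideanLin H v - z • v := by
    simp [map_sub]
    rfl
  have h2 : |z.im| * ‖v‖ ^ 2 ≤ ‖v‖ * ‖Matrix.toEuclideanLin H v - z • v‖ := by
    refine le_trans ?_ (norm_inner_le_norm (𝕜 := ℂ) v _)
    refine le_trans (le_of_eq ?_) (Complex.abs_im_le_norm _)
    rw [inner_sub_right, inner_smul_right, inner_self_eq_norm_sq_to_K, Complex.sub_im]
    have h5 : (inner ℂ v (Matrix.toEuclideanLin H v)).im = 0 := by simpa using h0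
    rw [h5, zero_sub, abs_neg]
    have : (z * ((‖v‖ : ℝ) : ℂ) ^ 2).im = z.im * ‖v‖ ^ 2 := by
      rw [← Complex.ofReal_pow, Complex.im_mul_ofReal]
    refine Eq.trans ?_ (congrArg abs this.symm)
    rw [abs_mul, abs_of_nonneg (sq_nonneg ‖v‖)]
  rw [h1]
  rcases eq_or_lt_of_le (norm_nonneg v) with h | h
  · rw [← h]; simp
  · refine le_of_mul_le_mul_left ?_ h
    calc ‖v‖ * (|z.im| * ‖v‖) = |z.im| * ‖v‖ ^ 2 := by ring
      _ ≤ _ := h2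

theorem isHermitian_map_ofReal {M : Matrix ι ι ℝ} (hM : M.IsHermitian) :
    (M.map (fun t : ℝ => (t : ℂ))).IsHermitian := by
  ext i j
  have := hM.apply i j
  simp only [star_trivial] at this
  simp [Matrix.conjTranspose_apply, this]

theorem isUnit_sub_smul_one {M : Matrix ι ι ℝ} (hM : M.IsHermitian) {z : ℂ} (hz : z.im ≠ 0) :
    IsUnit (M.map (fun t : ℝ => (t : ℂ)) - z • (1 : Matrix ι ι ℂ)) := by
  rw [← Matrix.mulVec_injective_iff_isUnit]
  refine (injective_iff_map_eq_zero
    (Matrix.mulVecLin (M.map (fun t : ℝ => (t : ℂ)) - z • (1 : Matrix ι ι ℂ)))).2 fun v hv => ?_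
  have h := norm_le_norm_sub_smul_mulVec (isHermitian_map_ofReal hM) z (WithLp.toLp 2 v)
  rw [Matrix.toEuclideanCLM_toLp] at h
  have hv' : (M.map (fun t : ℝ => (t : ℂ)) - z • (1 : Matrix ι ι ℂ)).mulVec v = 0 := hv
  rw [hv'] at h
  simp only [WithLp.toLp_zero, norm_zero] at h
  have h2 : ‖WithLp.toLp 2 v‖ ≤ 0 := by
    have : 0 < |z.im| := abs_pos.2 hz
    nlinarith [norm_nonneg (WithLp.toLp 2 v)]
  simpa using h2

theorem mul_resolventMatrix {M : Matrix ι ι ℝ} (hM : M.IsHermitian) {z : ℂ} (hz : z.im ≠ 0) :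
    (M.map (fun t : ℝ => (t : ℂ)) - z • (1 : Matrix ι ι ℂ)) * resolventMatrix M z = 1 :=
  Matrix.mul_nonsing_inv _ ((Matrix.isUnit_iff_isUnit_det _).1 (isUnit_sub_smul_one hM hz))

theorem resolventMatrix_mul {M : Matrix ι ι ℝ} (hM : M.IsHermitian) {z : ℂ} (hz : z.im ≠ 0) :
    resolventMatrix M z * (M.map (fun t : ℝ => (t : ℂ)) - z • (1 : Matrix ι ι ℂ)) = 1 :=
  Matrix.nonsing_inv_mul _ ((Matrix.isUnit_iff_isUnit_det _).1 (isUnit_sub_smul_one hM hz))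

theorem norm_resolventMatrix_le {M : Matrix ι ι ℝ} (hM : M.IsHermitian) {z : ℂ} (hz : z.im ≠ 0) :
    ‖resolventMatrix M z‖ ≤ |z.im|⁻¹ := by
  have h0 : 0 < |z.im| := abs_pos.2 hz
  rw [Matrix.cstar_norm_def]
  refine ContinuousLinearMap.opNorm_le_bound _ (by positivity) fun v => ?_
  have h := norm_le_norm_sub_smul_mulVec (isHermitian_map_ofReal hM) z
    (Matrix.toEuclideanCLM (n := ι) (𝕜 := ℂ) (resolventMatrix M z) v)
  rw [← mul_apply_eq_comp, ← map_mul, mul_resolventMatrix hM hz, map_one,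
    one_apply_eq_self] at h
  rw [inv_mul_eq_div, le_div_iff₀ h0, mul_comm]
  exact h

theorem transpose_resolventMatrix {M : Matrix ι ι ℝ} (hM : M.IsHermitian) (z : ℂ) :
    (resolventMatrix M z).transpose = resolventMatrix M z := by
  rw [resolventMatrix, Matrix.transpose_nonsing_inv]
  congr 1
  ext i j
  have := hM.apply i j
  simp only [star_trivial] at this
  simp [this, Matrix.one_apply, eq_comm]

theorem resolventMatrix_sub {M₁ M₂ : Matrix ι ι ℝ} (h₁ : M₁.IsHermitian) (h₂ : M₂.IsHermitian)
    {z : ℂ} (hz : z.im ≠ 0) :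
    resolventMatrix M₁ z - resolventMatrix M₂ z =
      resolventMatrix M₁ z * (M₂ - M₁).map (fun t : ℝ => (t : ℂ)) * resolventMatrix M₂ z := by
  have e : (M₂ - M₁).map (fun t : ℝ => (t : ℂ)) =
      (M₂.map (fun t : ℝ => (t : ℂ)) - z • (1 : Matrix ι ι ℂ)) -
      (M₁.map (fun t : ℝ => (t : ℂ)) - z • (1 : Matrix ι ι ℂ)) := by
    ext i j; simp
  rw [e, mul_sub, sub_mul, mul_assoc, mul_resolventMatrix h₂ hz, resolventMatrix_mul h₁ hz]
  simp

theorem norm_diagonal_le_one {w : ι → ℂ} (hw : ∀ s, ‖w s‖ ≤ 1) : ‖Matrix.diagonal w‖ ≤ 1 := by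
  rw [Matrix.l2_opNorm_diagonal]
  exact (pi_norm_le_iff_of_nonneg zero_le_one).2 hw

theorem norm_trace_diagonal_resolvent_le {M : Matrix ι ι ℝ} (hM : M.IsHermitian) {z : ℂ}
    (hz : z.im ≠ 0) {w : ι → ℂ} (hw : ∀ s, ‖w s‖ ≤ 1) :
    ‖(Matrix.diagonal w * resolventMatrix M z).trace‖ ≤ Fintype.card ι * |z.im|⁻¹ := by
  rw [Matrix.trace]
  refine (norm_sum_le _ _).trans ?_
  calc _ ≤ ∑ _s : ι, |z.im|⁻¹ := Finset.sum_le_sum fun s _ => by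
        rw [Matrix.diag_apply, Matrix.diagonal_mul, norm_mul]
        exact (mul_le_of_le_one_left (norm_nonneg _) (hw s)).trans
          ((norm_entry_le_l2OpNorm _ _ _).trans (norm_resolventMatrix_le hM hz))
    _ = _ := by simp

/-- By the resolvent identity and cyclicity, the difference is the trace of `R₂ D R₁` times `M₂ -
M₁`. Cauchy-Schwarz for the Hilbert-Schmidt inner product applies, and the first factor has
Hilbert-Schmidt norm at most the square root of the dimension times its operator norm. -/
theorem norm_trace_diagonal_resolvent_sub_le {M₁ M₂ : Matrix ι ι ℝ} (h₁ : M₁.IsHermitian)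
    (h₂ : M₂.IsHermitian) {z : ℂ} (hz : z.im ≠ 0) {w : ι → ℂ} (hw : ∀ s, ‖w s‖ ≤ 1) :
    ‖(Matrix.diagonal w * resolventMatrix M₁ z).trace -
      (Matrix.diagonal w * resolventMatrix M₂ z).trace‖ ≤
      √(Fintype.card ι) * |z.im|⁻¹ ^ 2 * √(∑ i, ∑ j, (M₁ i j - M₂ i j) ^ 2) := by
  have h0 : 0 < |z.im| := abs_pos.2 hz
  rw [← Matrix.trace_sub, ← mul_sub, resolventMatrix_sub h₁ h₂ hz, ← mul_assoc,
    Matrix.trace_mul_comm, ← mul_assoc, ← mul_assoc]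
  refine (norm_trace_mul_le _ _).trans ?_
  refine mul_le_mul ?_ (le_of_eq ?_) (Real.sqrt_nonneg _) (by positivity)
  · have hn : ‖resolventMatrix M₂ z * Matrix.diagonal w * resolventMatrix M₁ z‖ ≤ |z.im|⁻¹ ^ 2 := by
      refine (norm_mul_le _ _).trans ?_
      rw [sq]
      refine mul_le_mul ((norm_mul_le _ _).trans ?_) (norm_resolventMatrix_le h₁ hz)
        (norm_nonneg _) (by positivity)
      exact (mul_le_of_le_one_right (norm_nonneg _) (norm_diagonal_le_one hw)).trans
        (norm_resolventMatrix_le h₂ hz)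
    refine (Real.sqrt_le_sqrt (sum_norm_sq_le_l2OpNorm _)).trans ?_
    rw [Real.sqrt_mul (by positivity), Real.sqrt_sq (norm_nonneg _)]
    gcongr
  · congr 1
    refine Finset.sum_congr rfl fun i _ => Finset.sum_congr rfl fun j _ => ?_
    simp only [Matrix.map_apply, Matrix.sub_apply, Complex.norm_real, Real.norm_eq_abs, sq_abs]
    ring

/-- By the resolvent identity the difference of the resolvents has at most the rank of `M₂ - M₁`,
while its norm is at most `2 / |Im z|` however large the perturbation is. This is what makes spikes,
deflation and compression invisible in the limit. -/
theorem norm_trace_diagonal_resolvent_sub_le_card {J : Type*} [Fintype J] {M₁ M₂ : Matrix ι ι ℝ}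
    (h₁ : M₁.IsHermitian) (h₂ : M₂.IsHermitian) (u v : J → ι → ℝ)
    (huv : ∀ s t, M₁ s t - M₂ s t = ∑ j, u j s * v j t) {z : ℂ} (hz : z.im ≠ 0) {w : ι → ℂ}
    (hw : ∀ s, ‖w s‖ ≤ 1) :
    ‖(Matrix.diagonal w * resolventMatrix M₁ z).trace -
      (Matrix.diagonal w * resolventMatrix M₂ z).trace‖ ≤ Fintype.card J * (2 * |z.im|⁻¹) := by
  have h0 : 0 < |z.im| := abs_pos.2 hz
  rw [← Matrix.trace_sub, ← mul_sub]
  refine (norm_trace_le_rank_mul _).trans ?_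
  have hn : ‖Matrix.diagonal w * (resolventMatrix M₁ z - resolventMatrix M₂ z)‖ ≤ 2 * |z.im|⁻¹ := by
    refine (norm_mul_le _ _).trans ?_
    refine (mul_le_of_le_one_left (norm_nonneg _) (norm_diagonal_le_one hw)).trans ?_
    refine (norm_sub_le _ _).trans ?_
    linarith [norm_resolventMatrix_le h₁ hz, norm_resolventMatrix_le h₂ hz]
  refine mul_le_mul ?_ hn (norm_nonneg _) (by positivity)
  rw [Nat.cast_le]
  have e : (M₂ - M₁).map (fun t : ℝ => (t : ℂ)) =
      (Matrix.of fun s j => -(u j s : ℂ) : Matrix ι J ℂ) *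
        (Matrix.of fun j t => (v j t : ℂ) : Matrix J ι ℂ) := by
    ext s t
    have := huv s t
    simp only [Matrix.map_apply, Matrix.sub_apply, Matrix.mul_apply, Matrix.of_apply]
    rw [← neg_sub, this]
    push_cast
    rw [← Finset.sum_neg_distrib]
    simp
  rw [resolventMatrix_sub h₁ h₂ hz, e]
  refine (Matrix.rank_mul_le_right _ _).trans ?_
  refine (Matrix.rank_mul_le_left _ _).trans ?_
  refine (Matrix.rank_mul_le_right _ _).trans ?_
  exact (Matrix.rank_mul_le_left _ _).trans (Matrix.rank_le_card_width _)

/-! ### Integration by parts for resolvents of linear families of matrices. -/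

section Gaussian

variable {E : Type*} [NormedAddCommGroup E] [InnerProductSpace ℝ E] [FiniteDimensional ℝ E]

/-- A linear family of real matrices, viewed as a continuous linear family of complex ones. -/
noncomputable def complexFamily (A : E →ₗ[ℝ] Matrix ι ι ℝ) : E →L[ℝ] Matrix ι ι ℂ :=
  LinearMap.toContinuousLinearMap
    { toFun := fun x => (A x).map (fun t : ℝ => (t : ℂ))
      map_add' := fun x y => by ext; simp
      map_smul' := fun c x => by ext; simp }

theorem complexFamily_apply (A : E →ₗ[ℝ] Matrix ι ι ℝ) (x : E) :
    complexFamily A x = (A x).map (fun t : ℝ => (t : ℂ)) := rfl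

theorem resolventMatrix_eq_ringInverse (A : E →ₗ[ℝ] Matrix ι ι ℝ) (z : ℂ) (x : E) :
    resolventMatrix (A x) z = Ring.inverse (complexFamily A x - z • (1 : Matrix ι ι ℂ)) := by
  rw [resolventMatrix, Matrix.nonsing_inv_eq_ringInverse, complexFamily_apply]

theorem contDiff_resolventMatrix {A : E →ₗ[ℝ] Matrix ι ι ℝ} (hA : ∀ x, (A x).IsHermitian) {z : ℂ}
    (hz : z.im ≠ 0) : ContDiff ℝ 1 (fun x => resolventMatrix (A x) z) := by
  rw [funext (resolventMatrix_eq_ringInverse A z)]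
  rw [contDiff_iff_contDiffAt]
  intro x
  obtain ⟨u, hu⟩ := isUnit_sub_smul_one (hA x) hz
  have h1 : ContDiffAt ℝ 1 (Ring.inverse : Matrix ι ι ℂ → Matrix ι ι ℂ)
      (complexFamily A x - z • (1 : Matrix ι ι ℂ)) := by
    rw [complexFamily_apply, ← hu]
    exact contDiffAt_ringInverse ℝ u
  have h2 : ContDiffAt ℝ 1 (fun x => complexFamily A x - z • (1 : Matrix ι ι ℂ)) x := by fun_prop
  exact ContDiffAt.comp x h1 h2

theorem fderiv_resolventMatrix {A : E →ₗ[ℝ] Matrix ι ι ℝ} (hA : ∀ x, (A x).IsHermitian) {z : ℂ}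
    (hz : z.im ≠ 0) (x y : E) : fderiv ℝ (fun x => resolventMatrix (A x) z) x y =
      -(resolventMatrix (A x) z * complexFamily A y * resolventMatrix (A x) z) := by
  have e := resolventMatrix_eq_ringInverse A z x
  rw [funext (resolventMatrix_eq_ringInverse A z)]
  obtain ⟨u, hu⟩ := isUnit_sub_smul_one (hA x) hz
  have h1 : HasFDerivAt (Ring.inverse : Matrix ι ι ℂ → Matrix ι ι ℂ)
      (-ContinuousLinearMap.mulLeftRight ℝ (Matrix ι ι ℂ) ↑u⁻¹ ↑u⁻¹)
      (complexFamily A x - z • (1 : Matrix ι ι ℂ)) := by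
    rw [complexFamily_apply, ← hu]
    exact hasFDerivAt_ringInverse u
  have h2 : HasFDerivAt (fun x => complexFamily A x - z • (1 : Matrix ι ι ℂ))
      (complexFamily A) x := (complexFamily A).hasFDerivAt.sub_const _
  have h4 : HasFDerivAt (fun x => Ring.inverse (complexFamily A x - z • (1 : Matrix ι ι ℂ)))
      ((-ContinuousLinearMap.mulLeftRight ℝ (Matrix ι ι ℂ) ↑u⁻¹ ↑u⁻¹).comp (complexFamily A)) x :=
    HasFDerivAt.comp (g := (Ring.inverse : Matrix ι ι ℂ → Matrix ι ι ℂ))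
      (f := fun x => complexFamily A x - z • (1 : Matrix ι ι ℂ)) x h1 h2
  rw [h4.fderiv]
  have h3 : resolventMatrix (A x) z = ↑u⁻¹ := by
    rw [e, complexFamily_apply, ← hu, Ring.inverse_unit]
  rw [h3]
  simp [ContinuousLinearMap.mulLeftRight_apply]

variable [MeasurableSpace E] [BorelSpace E]

/-- Gaussian integration by parts for the resolvent of a linear family of symmetric matrices. -/
theorem integral_trace_mul_resolvent {A : E →ₗ[ℝ] Matrix ι ι ℝ} (hA : ∀ x, (A x).IsHermitian)
    {z : ℂ} (hz : z.im ≠ 0) (D : Matrix ι ι ℂ) :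
    ∫ x, (D * (complexFamily A x * resolventMatrix (A x) z)).trace ∂(stdGaussian E) =
      -∫ x, ∫ y, (D * (complexFamily A y * (resolventMatrix (A x) z * complexFamily A y *
        resolventMatrix (A x) z))).trace ∂(stdGaussian E) ∂(stdGaussian E) := by
  let τ : Matrix ι ι ℂ →L[ℝ] ℂ := LinearMap.toContinuousLinearMap
    ((Matrix.traceLinearMap ι ℝ ℂ).comp (LinearMap.mulLeft ℝ D))
  have hτ : ∀ B, τ B = (D * B).trace := fun B => rfl
  let Λ : Matrix ι ι ℂ →L[ℝ] (E →L[ℝ] ℂ) := LinearMap.toContinuousLinearMap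
    { toFun := fun B => τ.comp (((ContinuousLinearMap.mul ℝ (Matrix ι ι ℂ)).flip B).comp
        (complexFamily A))
      map_add' := fun B C => by ext; simp
      map_smul' := fun c B => by ext; simp }
  -- The integration by parts is applied to the field of functionals `y ↦ tr (D A(y) R(x))`; its
  -- value at `y = x` is the integrand on the left.
  have hΛ : ∀ B y, Λ B y = (D * (complexFamily A y * B)).trace := fun B y => rfl
  have hc := contDiff_resolventMatrix hA hz
  have h := integral_stdGaussian_byParts (F := fun x => Λ (resolventMatrix (A x) z))
    (B := ‖Λ‖ * |z.im|⁻¹) (B' := ‖Λ‖ * (|z.im|⁻¹ * ‖complexFamily A‖ * |z.im|⁻¹))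
    (Λ.contDiff.comp hc) (fun x => (Λ.le_opNorm _).trans (by
      gcongr; exact norm_resolventMatrix_le (hA x) hz)) (fun x => by
      have : fderiv ℝ (fun x => Λ (resolventMatrix (A x) z)) x =
          Λ.comp (fderiv ℝ (fun x => resolventMatrix (A x) z) x) :=
        (Λ.hasFDerivAt.comp x ((hc.differentiable one_ne_zero) x).hasFDerivAt).fderiv
      rw [this]
      refine (ContinuousLinearMap.opNorm_comp_le _ _).trans ?_
      gcongr
      refine ContinuousLinearMap.opNorm_le_bound _ (by positivity) fun y => ?_
      rw [fderiv_resolventMatrix hA hz, norm_neg]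
      have hR := norm_resolventMatrix_le (hA x) hz
      calc _ ≤ ‖resolventMatrix (A x) z‖ * ‖complexFamily A y‖ * ‖resolventMatrix (A x) z‖ :=
            norm_mul₃_le
        _ ≤ |z.im|⁻¹ * (‖complexFamily A‖ * ‖y‖) * |z.im|⁻¹ := by
            gcongr
            exact (complexFamily A).le_opNorm y
        _ = _ := by ring)
  have hf : ∀ x y, fderiv ℝ (fun x => Λ (resolventMatrix (A x) z)) x y y =
      -(D * (complexFamily A y * (resolventMatrix (A x) z * complexFamily A y *
        resolventMatrix (A x) z))).trace := fun x y => by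
    have : fderiv ℝ (fun x => Λ (resolventMatrix (A x) z)) x =
        Λ.comp (fderiv ℝ (fun x => resolventMatrix (A x) z) x) :=
      (Λ.hasFDerivAt.comp x ((hc.differentiable one_ne_zero) x).hasFDerivAt).fderiv
    rw [this, ContinuousLinearMap.comp_apply, fderiv_resolventMatrix hA hz, hΛ, mul_neg, mul_neg,
      Matrix.trace_neg]
  simp only [hf, integral_neg] at h
  simpa only [hΛ] using h

end Gaussian

end Resolvent

/-! ### Contractions of tensors: size, compression and rank of the block matrices. -/

section Contractions

variable {d : ℕ} {n : Fin d → ℕ}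

/-- The contraction of `X` against a vector in every mode. -/
def contractAll (X : Tensor n) (v : (k : Fin d) → Fin (n k) → ℝ) : ℝ :=
  ∑ p, X p * ∏ k, v k (p k)

/-- The vectors `a k`, with those in the modes `ℓ` and `m` replaced by `f` and `g`. -/
def replaceTwo (a : (k : Fin d) → Fin (n k) → ℝ) (ℓ m : Fin d) (f : Fin (n ℓ) → ℝ)
    (g : Fin (n m) → ℝ) : (k : Fin d) → Fin (n k) → ℝ :=
  Function.update (Function.update a ℓ f) m g

/-- The coordinates of a family of vectors. -/
def coords (a : Vectors n) : (k : Fin d) → Fin (n k) → ℝ := fun k => (a k).ofLp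

theorem replaceTwo_left (a : (k : Fin d) → Fin (n k) → ℝ) {ℓ m : Fin d} (h : ℓ ≠ m)
    (f : Fin (n ℓ) → ℝ) (g : Fin (n m) → ℝ) : replaceTwo a ℓ m f g ℓ = f := by
  simp [replaceTwo, Function.update_of_ne h]

theorem replaceTwo_right (a : (k : Fin d) → Fin (n k) → ℝ) {ℓ m : Fin d}
    (f : Fin (n ℓ) → ℝ) (g : Fin (n m) → ℝ) : replaceTwo a ℓ m f g m = g := by
  simp [replaceTwo]

theorem replaceTwo_of_ne (a : (k : Fin d) → Fin (n k) → ℝ) {ℓ m k : Fin d} (h : k ≠ ℓ)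
    (h' : k ≠ m) (f : Fin (n ℓ) → ℝ) (g : Fin (n m) → ℝ) : replaceTwo a ℓ m f g k = a k := by
  simp [replaceTwo, Function.update_of_ne h, Function.update_of_ne h']

theorem replaceTwo_comm (a : (k : Fin d) → Fin (n k) → ℝ) {ℓ m : Fin d} (h : ℓ ≠ m)
    (f : Fin (n ℓ) → ℝ) (g : Fin (n m) → ℝ) :
    replaceTwo a ℓ m f g = replaceTwo a m ℓ g f := Function.update_comm h.symm _ _ _ |>.symm

theorem prod_eq_mul_mul_prod {M : Type*} [CommMonoid M] (F : Fin d → M) {ℓ m : Fin d}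
    (h : ℓ ≠ m) :
    ∏ k, F k = F ℓ * F m * ∏ k ∈ Finset.univ.filter (fun k => k ≠ ℓ ∧ k ≠ m), F k := by
  have h1 : (Finset.univ : Finset (Fin d)) =
      insert ℓ (insert m (Finset.univ.filter (fun k => k ≠ ℓ ∧ k ≠ m))) := by
    ext k; simp; tauto
  conv_lhs => rw [h1]
  rw [Finset.prod_insert (by simp [h]), Finset.prod_insert (by simp), mul_assoc]

theorem prod_replaceTwo {M : Type*} [CommMonoid M] (φ : (k : Fin d) → (Fin (n k) → ℝ) → M)
    (a : (k : Fin d) → Fin (n k) → ℝ) {ℓ m : Fin d} (h : ℓ ≠ m)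
    (f : Fin (n ℓ) → ℝ) (g : Fin (n m) → ℝ) :
    ∏ k, φ k (replaceTwo a ℓ m f g k) = φ ℓ f * φ m g *
      ∏ k ∈ Finset.univ.filter (fun k => k ≠ ℓ ∧ k ≠ m), φ k (a k) := by
  rw [prod_eq_mul_mul_prod _ h, replaceTwo_left a h, replaceTwo_right]
  congr 1
  refine Finset.prod_congr rfl fun k hk => ?_
  simp only [Finset.mem_filter, Finset.mem_univ, true_and] at hk
  rw [replaceTwo_of_ne a hk.1 hk.2]

/-- With basis vectors in the two free modes, every entry becomes an inner product of `X` with a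
rank-one tensor. Covariances of entries are then products of dot products. -/
theorem contractTwo_eq_contractAll (X : Tensor n) (a : Vectors n) {ℓ m : Fin d} (h : ℓ ≠ m)
    (q : Fin (n ℓ)) (q' : Fin (n m)) :
    contractTwo X a ℓ m q q' =
      contractAll X (replaceTwo (coords a) ℓ m (Pi.single q 1) (Pi.single q' 1)) := by
  refine Finset.sum_congr rfl fun p _ => ?_
  rw [prod_replaceTwo (fun k v => v (p k)) _ h]
  simp only [Pi.single_apply, coords]
  by_cases h1 : p ℓ = q <;> by_cases h2 : p m = q' <;> simp [h1, h2]

theorem sum_prod_mul_prod (v w : (k : Fin d) → Fin (n k) → ℝ) :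
    ∑ p : ((k : Fin d) → Fin (n k)), (∏ k, v k (p k)) * ∏ k, w k (p k) =
      ∏ k, v k ⬝ᵥ w k := by
  simp only [dotProduct]
  rw [Finset.prod_univ_sum, Fintype.piFinset_univ]
  exact Finset.sum_congr rfl fun p _ => Finset.prod_mul_distrib.symm

theorem dotProduct_coords_self {a : Vectors n} (ha : ∀ k, ‖a k‖ = 1) (k : Fin d) :
    coords a k ⬝ᵥ coords a k = 1 := by
  have := EuclideanSpace.norm_sq_eq (a k)
  rw [ha k] at this
  simp only [coords, dotProduct]
  simp only [Real.norm_eq_abs, sq_abs, one_pow] at this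
  rw [this]
  exact Finset.sum_congr rfl fun i _ => (sq _).symm

theorem abs_coords_le_one {a : Vectors n} (ha : ∀ k, ‖a k‖ = 1) (k : Fin d) (j : Fin (n k)) :
    |coords a k j| ≤ 1 := by
  have := PiLp.norm_apply_le (a k) j
  rwa [ha k] at this

/-- The entry of a block matrix as a linear function of the tensor, as a full contraction. -/
theorem blockMatrix_apply_of_ne (X : Tensor n) (a : Vectors n)
    {s t : Σ ℓ : Fin d, Fin (n ℓ)} (h : s.1 ≠ t.1) :
    blockMatrix X a s t =
      contractAll X (replaceTwo (coords a) s.1 t.1 (Pi.single s.2 1) (Pi.single t.2 1)) := by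
  rw [blockMatrix, if_neg h, contractTwo_eq_contractAll X a h]

/-- Cauchy-Schwarz against a unit rank-one tensor supported on the slice of the two fixed indices.
Restricting the right side to that slice lets the sum over all entries of a block give back the norm
of `X` only once. -/
theorem contractTwo_sq_le (X : Tensor n) {a : Vectors n} (ha : ∀ k, ‖a k‖ = 1) {ℓ m : Fin d}
    (h : ℓ ≠ m) (q : Fin (n ℓ)) (q' : Fin (n m)) :
    contractTwo X a ℓ m q q' ^ 2 ≤
      ∑ p : ((k : Fin d) → Fin (n k)), if p ℓ = q ∧ p m = q' then X p ^ 2 else 0 := by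
  have h1 : contractTwo X a ℓ m q q' = ∑ p : ((k : Fin d) → Fin (n k)),
      (if p ℓ = q ∧ p m = q' then X p else 0) *
      ∏ k, replaceTwo (coords a) ℓ m (Pi.single q 1) (Pi.single q' 1) k (p k) := by
    rw [contractTwo_eq_contractAll X a h, contractAll]
    refine Finset.sum_congr rfl fun p _ => ?_
    rw [prod_replaceTwo (fun k v => v (p k)) _ h]
    simp only [Pi.single_apply]
    by_cases h1 : p ℓ = q <;> by_cases h2 : p m = q' <;> simp [h1, h2]
  have h2 : ∑ p : ((k : Fin d) → Fin (n k)),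
      (∏ k, replaceTwo (coords a) ℓ m (Pi.single q 1) (Pi.single q' 1) k (p k)) ^ 2 = 1 := by
    simp only [sq]
    rw [sum_prod_mul_prod, prod_replaceTwo (fun k v => v ⬝ᵥ v) _ h,
      Finset.prod_congr rfl fun k _ => dotProduct_coords_self ha k]
    simp
  rw [h1]
  refine (Finset.sum_mul_sq_le_sq_mul_sq _ _ _).trans (le_of_eq ?_)
  rw [h2, mul_one]
  exact Finset.sum_congr rfl fun p _ => by split_ifs <;> simp

/-- Each of the `d ^ 2` blocks is a contraction against unit vectors, so its Hilbert-Schmidt norm is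
at most that of the tensor. -/
theorem sum_blockMatrix_sq_le (X : Tensor n) {a : Vectors n} (ha : ∀ k, ‖a k‖ = 1) :
    ∑ s, ∑ t, blockMatrix X a s t ^ 2 ≤ d ^ 2 * ∑ p, X p ^ 2 := by
  have key : ∀ ℓ m : Fin d, ∑ q : Fin (n ℓ), ∑ q' : Fin (n m),
      blockMatrix X a ⟨ℓ, q⟩ ⟨m, q'⟩ ^ 2 ≤ ∑ p, X p ^ 2 := by
    intro ℓ m
    by_cases h : ℓ = m
    · simp only [blockMatrix, h, if_true]
      simp only [ne_eq, OfNat.ofNat_ne_zero, not_false_eq_true, zero_pow, Finset.sum_const_zero]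
      positivity
    · calc _ ≤ ∑ q : Fin (n ℓ), ∑ q' : Fin (n m), ∑ p : ((k : Fin d) → Fin (n k)),
            (if p ℓ = q ∧ p m = q' then X p ^ 2 else 0) :=
            Finset.sum_le_sum fun q _ => Finset.sum_le_sum fun q' _ => by
              rw [blockMatrix, if_neg h]; exact contractTwo_sq_le X ha h q q'
        _ = ∑ q : Fin (n ℓ), ∑ p : ((k : Fin d) → Fin (n k)), ∑ q' : Fin (n m),
            (if p ℓ = q ∧ p m = q' then X p ^ 2 else 0) :=
            Finset.sum_congr rfl fun q _ => Finset.sum_comm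
        _ = ∑ p : ((k : Fin d) → Fin (n k)), ∑ q : Fin (n ℓ), ∑ q' : Fin (n m),
            (if p ℓ = q ∧ p m = q' then X p ^ 2 else 0) := Finset.sum_comm
        _ = _ := Finset.sum_congr rfl fun p _ => by simp [ite_and]
  calc _ = ∑ ℓ : Fin d, ∑ m : Fin d, ∑ q : Fin (n ℓ), ∑ q' : Fin (n m),
        blockMatrix X a ⟨ℓ, q⟩ ⟨m, q'⟩ ^ 2 := by
        rw [Fintype.sum_sigma]
        refine Finset.sum_congr rfl fun ℓ _ => ?_
        simp only [Fintype.sum_sigma]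
        exact Finset.sum_comm
    _ ≤ ∑ _ℓ : Fin d, ∑ _m : Fin d, ∑ p, X p ^ 2 :=
        Finset.sum_le_sum fun ℓ _ => Finset.sum_le_sum fun m _ => key ℓ m
    _ = _ := by simp only [Finset.sum_const, Finset.card_univ, Fintype.card_fin, nsmul_eq_mul]; ring

theorem contractAll_add (X Y : Tensor n) (v : (k : Fin d) → Fin (n k) → ℝ) :
    contractAll (X + Y) v = contractAll X v + contractAll Y v := by
  simp [contractAll, add_mul, Finset.sum_add_distrib]

theorem contractAll_smul (c : ℝ) (X : Tensor n) (v : (k : Fin d) → Fin (n k) → ℝ) :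
    contractAll (c • X) v = c * contractAll X v := by
  simp [contractAll, mul_assoc, Finset.mul_sum]

/-- The block matrix as a linear function of the tensor. -/
def blockMatrixLinear (a : Vectors n) :
    Tensor n →ₗ[ℝ] Matrix (Σ ℓ : Fin d, Fin (n ℓ)) (Σ ℓ : Fin d, Fin (n ℓ)) ℝ where
  toFun X := blockMatrix X a
  map_add' X Y := by
    ext s t
    by_cases h : s.1 = t.1
    · simp [blockMatrix, h]
    · simp only [Matrix.add_apply]
      rw [blockMatrix_apply_of_ne _ a h, blockMatrix_apply_of_ne _ a h,
        blockMatrix_apply_of_ne _ a h, contractAll_add]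
  map_smul' c X := by
    ext s t
    by_cases h : s.1 = t.1
    · simp [blockMatrix, h]
    · simp only [Matrix.smul_apply, RingHom.id_apply, smul_eq_mul]
      rw [blockMatrix_apply_of_ne _ a h, blockMatrix_apply_of_ne _ a h, contractAll_smul]

/-- The `s`-th row of the block diagonal projection onto the orthogonal complements of the `a k`. -/
def projRow (a : Vectors n) (s : Σ ℓ : Fin d, Fin (n ℓ)) : Fin (n s.1) → ℝ :=
  Pi.single s.2 1 - coords a s.1 s.2 • coords a s.1

/-- The block diagonal projection onto the orthogonal complements of the `a k`. -/
def projMatrix (a : Vectors n) :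
    Matrix (Σ ℓ : Fin d, Fin (n ℓ)) (Σ ℓ : Fin d, Fin (n ℓ)) ℝ :=
  fun s t => (if s = t then 1 else 0) -
    if s.1 = t.1 then coords a s.1 s.2 * coords a t.1 t.2 else 0

/-- The compression of the block matrix by the projection `projMatrix a`. -/
def projBlockMatrix (X : Tensor n) (a : Vectors n) :
    Matrix (Σ ℓ : Fin d, Fin (n ℓ)) (Σ ℓ : Fin d, Fin (n ℓ)) ℝ :=
  fun s t => if s.1 = t.1 then 0 else
    contractAll X (replaceTwo (coords a) s.1 t.1 (projRow a s) (projRow a t))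

theorem projBlockMatrix_isHermitian (X : Tensor n) (a : Vectors n) :
    (projBlockMatrix X a).IsHermitian := by
  ext s t
  simp only [Matrix.conjTranspose_apply, star_trivial, projBlockMatrix]
  by_cases h : s.1 = t.1
  · simp [h]
  · rw [if_neg h, if_neg (Ne.symm h), replaceTwo_comm _ h]

/-- The compressed block matrix as a linear function of the tensor. -/
def projBlockMatrixLinear (a : Vectors n) :
    Tensor n →ₗ[ℝ] Matrix (Σ ℓ : Fin d, Fin (n ℓ)) (Σ ℓ : Fin d, Fin (n ℓ)) ℝ where
  toFun X := projBlockMatrix X a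
  map_add' X Y := by
    ext s t
    by_cases h : s.1 = t.1
    · simp [projBlockMatrix, h]
    · simp [projBlockMatrix, h, contractAll_add]
  map_smul' c X := by
    ext s t
    by_cases h : s.1 = t.1
    · simp [projBlockMatrix, h]
    · simp [projBlockMatrix, h, contractAll_smul]

theorem projRow_dotProduct_coords {a : Vectors n} (ha : ∀ k, ‖a k‖ = 1)
    (s : Σ ℓ : Fin d, Fin (n ℓ)) : projRow a s ⬝ᵥ coords a s.1 = 0 := by
  rw [projRow, sub_dotProduct, smul_dotProduct, dotProduct_coords_self ha]
  simp

/-- A symmetric projection is idempotent: the first row is orthogonal to `a`, so the correction in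
the second row drops out. -/
theorem projRow_dotProduct_projRow {a : Vectors n} (ha : ∀ k, ‖a k‖ = 1) {ℓ : Fin d}
    (q q' : Fin (n ℓ)) : projRow a ⟨ℓ, q⟩ ⬝ᵥ projRow a ⟨ℓ, q'⟩ = projMatrix a ⟨ℓ, q⟩ ⟨ℓ, q'⟩ := by
  have h := projRow_dotProduct_coords ha ⟨ℓ, q⟩
  conv_lhs => rw [projRow.eq_def a ⟨ℓ, q'⟩]
  rw [dotProduct_sub, dotProduct_smul]
  dsimp only at h ⊢
  rw [h]
  simp [projRow, projMatrix, Pi.single_apply, eq_comm, mul_comm]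

theorem projMatrix_of_ne (a : Vectors n) {s t : Σ ℓ : Fin d, Fin (n ℓ)} (h : s.1 ≠ t.1) :
    projMatrix a s t = 0 := by
  have : s ≠ t := fun e => h (by rw [e])
  simp [projMatrix, h, this]

/-- In the mode of `s` the factor is a projected row against `a` itself, hence zero. The compression
is introduced for this reason: without it, entries in different blocks would be correlated through
the coordinates of `a`. -/
theorem prod_dotProduct_replaceTwo_eq_zero {a : Vectors n} (ha : ∀ k, ‖a k‖ = 1)
    {s t u v : Σ ℓ : Fin d, Fin (n ℓ)} (hst : s.1 ≠ t.1) (hu : s.1 ≠ u.1) (hv : s.1 ≠ v.1) :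
    ∏ k, replaceTwo (coords a) s.1 t.1 (projRow a s) (projRow a t) k ⬝ᵥ
      replaceTwo (coords a) u.1 v.1 (projRow a u) (projRow a v) k = 0 := by
  refine Finset.prod_eq_zero (Finset.mem_univ s.1) ?_
  rw [replaceTwo_left _ hst, replaceTwo_of_ne _ hu hv, projRow_dotProduct_coords ha]

theorem prod_dotProduct_replaceTwo_same {a : Vectors n} (ha : ∀ k, ‖a k‖ = 1)
    {ℓ m : Fin d} (h : ℓ ≠ m) (q q' : Fin (n ℓ)) (r r' : Fin (n m)) :
    ∏ k, replaceTwo (coords a) ℓ m (projRow a ⟨ℓ, q⟩) (projRow a ⟨m, r⟩) k ⬝ᵥ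
      replaceTwo (coords a) ℓ m (projRow a ⟨ℓ, q'⟩) (projRow a ⟨m, r'⟩) k =
      projMatrix a ⟨ℓ, q⟩ ⟨ℓ, q'⟩ * projMatrix a ⟨m, r⟩ ⟨m, r'⟩ := by
  rw [prod_eq_mul_mul_prod _ h]
  simp only [replaceTwo_left _ h, replaceTwo_right]
  rw [projRow_dotProduct_projRow ha, projRow_dotProduct_projRow ha]
  refine mul_right_eq_self₀.2 (Or.inl (Finset.prod_eq_one fun k hk => ?_))
  simp only [Finset.mem_filter, Finset.mem_univ, true_and] at hk
  rw [replaceTwo_of_ne _ hk.1 hk.2, replaceTwo_of_ne _ hk.1 hk.2, dotProduct_coords_self ha]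

/-- This is the covariance of two entries of the compressed noise. It vanishes unless the two blocks
agree up to transposition, and at most one of the two summands is nonzero, so a single formula
covers all cases. -/
theorem prod_dotProduct_replaceTwo {a : Vectors n} (ha : ∀ k, ‖a k‖ = 1)
    {s t u v : Σ ℓ : Fin d, Fin (n ℓ)} (hst : s.1 ≠ t.1) (huv : u.1 ≠ v.1) :
    ∏ k, replaceTwo (coords a) s.1 t.1 (projRow a s) (projRow a t) k ⬝ᵥ
      replaceTwo (coords a) u.1 v.1 (projRow a u) (projRow a v) k =
      projMatrix a s u * projMatrix a t v + projMatrix a s v * projMatrix a t u := by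
  by_cases h1 : s.1 = u.1
  · have h2 : s.1 ≠ v.1 := h1 ▸ huv
    rw [projMatrix_of_ne a h2, zero_mul, add_zero]
    by_cases h3 : t.1 = v.1
    · obtain ⟨ℓ, q⟩ := s
      obtain ⟨m, r⟩ := t
      obtain ⟨ℓ', q'⟩ := u
      obtain ⟨m', r'⟩ := v
      dsimp only at h1 h3 hst
      subst h1; subst h3
      exact prod_dotProduct_replaceTwo_same ha hst q q' r r'
    · rw [projMatrix_of_ne a h3, mul_zero, replaceTwo_comm _ hst]
      exact prod_dotProduct_replaceTwo_eq_zero ha hst.symm (h1 ▸ hst.symm) h3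
  · rw [projMatrix_of_ne a h1, zero_mul, zero_add]
    by_cases h2 : s.1 = v.1
    · by_cases h3 : t.1 = u.1
      · obtain ⟨ℓ, q⟩ := s
        obtain ⟨m, r⟩ := t
        obtain ⟨m', r'⟩ := u
        obtain ⟨ℓ', q'⟩ := v
        dsimp only at h2 h3 hst
        subst h2; subst h3
        dsimp only
        rw [replaceTwo_comm _ hst.symm]
        exact prod_dotProduct_replaceTwo_same ha hst q q' r r'
      · rw [projMatrix_of_ne a h3, mul_zero, replaceTwo_comm _ hst]
        exact prod_dotProduct_replaceTwo_eq_zero ha hst.symm h3 (h2 ▸ hst.symm)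
    · rw [projMatrix_of_ne a h2, zero_mul]
      exact prod_dotProduct_replaceTwo_eq_zero ha hst h1 h2

theorem contractAll_replaceTwo (X : Tensor n) (a : (k : Fin d) → Fin (n k) → ℝ) {ℓ m : Fin d}
    (h : ℓ ≠ m) (f : Fin (n ℓ) → ℝ) (g : Fin (n m) → ℝ) :
    contractAll X (replaceTwo a ℓ m f g) = ∑ p, X p * (f (p ℓ) * g (p m) *
      ∏ k ∈ Finset.univ.filter (fun k => k ≠ ℓ ∧ k ≠ m), a k (p k)) := by
  refine Finset.sum_congr rfl fun p _ => ?_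
  rw [prod_replaceTwo (fun k v => v (p k)) _ h]

/-- The contraction is bilinear in the modes `ℓ` and `m`. Each of the three terms on the right has
at least one of these modes contracted against `a`, which makes its matrix of entries of low rank.
-/
theorem contractAll_replaceTwo_sub_smul (X : Tensor n) (a : (k : Fin d) → Fin (n k) → ℝ)
    {ℓ m : Fin d} (h : ℓ ≠ m) (f : Fin (n ℓ) → ℝ) (g : Fin (n m) → ℝ) (b c : ℝ) :
    contractAll X (replaceTwo a ℓ m f g) -
      contractAll X (replaceTwo a ℓ m (f - b • a ℓ) (g - c • a m)) =
    c * contractAll X (Function.update a ℓ f) + b * contractAll X (Function.update a m g) -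
      b * c * contractAll X a := by
  have e1 : Function.update a ℓ f = replaceTwo a ℓ m f (a m) := by
    rw [replaceTwo, Function.update_comm h, Function.update_eq_self]
  have e2 : Function.update a m g = replaceTwo a ℓ m (a ℓ) g := by
    rw [replaceTwo, Function.update_eq_self]
  have e3 : contractAll X a = contractAll X (replaceTwo a ℓ m (a ℓ) (a m)) := by
    rw [replaceTwo, Function.update_eq_self, Function.update_eq_self]
  rw [e1, e2, e3]
  simp only [contractAll_replaceTwo X a h, Pi.sub_apply, Pi.smul_apply, smul_eq_mul,
    Finset.mul_sum]
  rw [← Finset.sum_sub_distrib, ← Finset.sum_add_distrib, ← Finset.sum_sub_distrib]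
  exact Finset.sum_congr rfl fun p _ => by ring

/-- The compression of the block matrix is a perturbation of rank at most `2 * d`. -/
theorem exists_blockMatrix_sub_projBlockMatrix (X : Tensor n) (a : Vectors n) :
    ∃ u v : Fin d ⊕ Fin d → (Σ ℓ : Fin d, Fin (n ℓ)) → ℝ,
      ∀ s t, blockMatrix X a s t - projBlockMatrix X a s t = ∑ j, u j s * v j t := by
  let w : (Σ ℓ : Fin d, Fin (n ℓ)) → ℝ := fun s =>
    contractAll X (Function.update (coords a) s.1 (Pi.single s.2 1))
  let κ := contractAll X (coords a)
  let b : (Σ ℓ : Fin d, Fin (n ℓ)) → ℝ := fun s => coords a s.1 s.2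
  -- Off the diagonal blocks the difference is `b s * (w t - κ * b t) + w s * b t`. Splitting the
  -- first product by the block of `s` and the second by the block of `t` allows indicators to
  -- remove the diagonal blocks at the cost of `d` terms each.
  refine ⟨Sum.elim (fun ℓ s => if s.1 = ℓ then b s else 0) (fun m s => if s.1 = m then 0 else w s),
    Sum.elim (fun ℓ t => if t.1 = ℓ then 0 else w t - κ * b t)
      (fun m t => if t.1 = m then b t else 0), fun s t => ?_⟩
  rw [Fintype.sum_sum_type]
  simp only [Sum.elim_inl, Sum.elim_inr, ite_mul, mul_ite, zero_mul, mul_zero]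
  have h1 : ∑ ℓ : Fin d, (if t.1 = ℓ then 0 else if s.1 = ℓ then b s * (w t - κ * b t) else 0) =
      if s.1 = t.1 then 0 else b s * (w t - κ * b t) := by
    rw [Finset.sum_eq_single s.1]
    · simp [eq_comm]
    · intro ℓ _ h; simp [Ne.symm h]
    · simp
  have h2 : ∑ m : Fin d, (if t.1 = m then (if s.1 = m then 0 else w s * b t) else 0) =
      if s.1 = t.1 then 0 else w s * b t := by
    rw [Finset.sum_eq_single t.1]
    · simp
    · intro ℓ _ h; simp [Ne.symm h]
    · simp
  rw [h1, h2]
  by_cases h : s.1 = t.1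
  · simp [h, blockMatrix, projBlockMatrix]
  · rw [blockMatrix_apply_of_ne X a h, projBlockMatrix, if_neg h, if_neg h, if_neg h, projRow,
      projRow, contractAll_replaceTwo_sub_smul X _ h]
    simp only [w, κ, b]
    ring

/-- For a rank-one tensor the block `(ℓ, m)` is a multiple of `y_ℓ` times the transpose of `y_m`.
All blocks in one row share the left vector, so one term per row of blocks suffices, with its
diagonal block left out. -/
theorem exists_blockMatrix_outer (y a : Vectors n) (c : ℝ) :
    ∃ u v : Fin d → (Σ ℓ : Fin d, Fin (n ℓ)) → ℝ,
      ∀ s t, blockMatrix (c • outer y) a s t = ∑ j, u j s * v j t := by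
  let κ : Fin d → Fin d → ℝ := fun ℓ m =>
    ∏ k ∈ Finset.univ.filter (fun k => k ≠ ℓ ∧ k ≠ m), coords y k ⬝ᵥ coords a k
  refine ⟨fun ℓ s => if s.1 = ℓ then coords y s.1 s.2 else 0,
    fun ℓ t => if t.1 = ℓ then 0 else c * (coords y t.1 t.2 * κ ℓ t.1), fun s t => ?_⟩
  simp only [ite_mul, mul_ite, zero_mul, mul_zero]
  rw [Finset.sum_eq_single s.1 (by intro ℓ _ h; simp [Ne.symm h]) (by simp)]
  by_cases h : s.1 = t.1
  · simp [h, blockMatrix]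
  · rw [blockMatrix_apply_of_ne _ a h, if_neg (Ne.symm h), if_pos rfl, contractAll_smul]
    have : contractAll (outer y) (replaceTwo (coords a) s.1 t.1 (Pi.single s.2 1)
        (Pi.single t.2 1)) = ∏ k, coords y k ⬝ᵥ (replaceTwo (coords a) s.1 t.1 (Pi.single s.2 1)
        (Pi.single t.2 1)) k := by
      rw [← sum_prod_mul_prod]; rfl
    rw [this, prod_replaceTwo (fun k v => coords y k ⬝ᵥ v) _ h]
    simp only [dotProduct_single, mul_one, κ]
    ring

/-- The spikes and the deflation terms form a perturbation of rank at most `2 * r * d`. -/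
theorem exists_blockMatrix_deflated_sub {r : ℕ} (β : Fin r → ℝ) (x : Fin r → Vectors n)
    (W : Tensor n) (lam : Fin r → ℝ) (u : Fin r → Vectors n) (i : Fin r) (a : Vectors n) :
    ∃ f g : (Fin r × Fin d) ⊕ (Fin r × Fin d) → (Σ ℓ : Fin d, Fin (n ℓ)) → ℝ,
      ∀ s t, blockMatrix (deflated (spiked β x W) lam u i) a s t -
        blockMatrix ((Real.sqrt (totalDim n))⁻¹ • W) a s t = ∑ j, f j s * g j t := by
  choose f₁ g₁ h₁ using fun j => exists_blockMatrix_outer (x j) a (β j)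
  -- A zero coefficient for `j ≥ i` lets the deflation sum run over all `j`, so the index set of the
  -- decomposition does not depend on `i`.
  choose f₂ g₂ h₂ using fun j => exists_blockMatrix_outer (u j) a (if j < i then -lam j else 0)
  refine ⟨Sum.elim (fun p => f₁ p.1 p.2) (fun p => f₂ p.1 p.2),
    Sum.elim (fun p => g₁ p.1 p.2) (fun p => g₂ p.1 p.2), fun s t => ?_⟩
  have e : deflated (spiked β x W) lam u i = (∑ j, β j • outer (x j) +
      ∑ j, (if j < i then -lam j else 0) • outer (u j)) + (Real.sqrt (totalDim n))⁻¹ • W := by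
    rw [deflated, spiked]
    have : ∑ j, (if j < i then -lam j else 0) • outer (u j) =
        -∑ j ∈ Finset.univ.filter (fun j => j < i), lam j • outer (u j) := by
      rw [Finset.sum_filter, ← Finset.sum_neg_distrib]
      exact Finset.sum_congr rfl fun j _ => by split_ifs <;> simp
    rw [this]
    abel
  have hlin : ∀ X, blockMatrix X a = blockMatrixLinear a X := fun X => rfl
  rw [← Matrix.sub_apply, e, hlin, hlin, ← map_sub, add_sub_cancel_right, map_add, map_sum, map_sum,
    Matrix.add_apply, Matrix.sum_apply, Matrix.sum_apply, Fintype.sum_sum_type,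
    Fintype.sum_prod_type, Fintype.sum_prod_type]
  simp only [← hlin, h₁, h₂, Sum.elim_inl, Sum.elim_inr]

theorem abs_prod_sub_prod_le {κ : Type*} (S : Finset κ) (f g : κ → ℝ) (hf : ∀ k, |f k| ≤ 1)
    (hg : ∀ k, |g k| ≤ 1) : |∏ k ∈ S, f k - ∏ k ∈ S, g k| ≤ ∑ k ∈ S, |f k - g k| := by
  classical
  induction S using Finset.induction_on with
  | empty => simp
  | insert k S hk ih =>
    rw [Finset.prod_insert hk, Finset.prod_insert hk, Finset.sum_insert hk]
    have e : f k * ∏ k ∈ S, f k - g k * ∏ k ∈ S, g k =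
        (f k - g k) * ∏ k ∈ S, f k + g k * (∏ k ∈ S, f k - ∏ k ∈ S, g k) := by ring
    rw [e]
    refine (abs_add_le _ _).trans (add_le_add ?_ ?_)
    · rw [abs_mul]
      refine mul_le_of_le_one_right (abs_nonneg _) ?_
      rw [Finset.abs_prod]
      exact Finset.prod_le_one (fun _ _ => abs_nonneg _) fun k _ => hf k
    · rw [abs_mul]
      exact (mul_le_of_le_one_left (abs_nonneg _) (hg k)).trans ih

/-- Unit vectors have coordinates at most one in absolute value, so the factors of each product can
be exchanged one at a time. The bound is crude, but it serves only for nets whose mesh is a high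
negative power of `N`. -/
theorem abs_blockMatrix_sub_le (X : Tensor n) {a b : Vectors n} (ha : ∀ k, ‖a k‖ = 1)
    (hb : ∀ k, ‖b k‖ = 1) {ε : ℝ} (hε : ∀ k j, |coords a k j - coords b k j| ≤ ε)
    (s t : Σ ℓ : Fin d, Fin (n ℓ)) (hε0 : 0 ≤ ε) :
    |blockMatrix X a s t - blockMatrix X b s t| ≤ d * ε * ∑ p, |X p| := by
  by_cases h : s.1 = t.1
  · simp only [blockMatrix, h, if_true, sub_self, abs_zero]
    positivity
  · rw [blockMatrix, blockMatrix, if_neg h, if_neg h, contractTwo, contractTwo,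
      ← Finset.sum_sub_distrib, Finset.mul_sum]
    refine (Finset.abs_sum_le_sum_abs _ _).trans (Finset.sum_le_sum fun p _ => ?_)
    split_ifs
    · rw [← mul_sub, abs_mul, mul_comm]
      refine mul_le_mul_of_nonneg_right ?_ (abs_nonneg _)
      refine (abs_prod_sub_prod_le _ _ _ (fun k => abs_coords_le_one ha k (p k))
        (fun k => abs_coords_le_one hb k (p k))).trans ?_
      calc _ ≤ ∑ k : Fin d, ε :=
            (Finset.sum_le_sum fun k _ => hε k (p k)).trans
              (Finset.sum_le_sum_of_subset_of_nonneg (Finset.filter_subset _ _) fun _ _ _ => hε0)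
        _ = _ := by simp
    · rw [sub_self, abs_zero]; positivity

end Contractions

/-! ### The noise matrix: Lipschitz dependence on the noise and covariance of the entries. -/

section MeanEquation

open scoped Matrix.Norms.L2Operator

variable {d : ℕ} {n : Fin d → ℕ}

/-- The space of tensors with its Euclidean structure. -/
abbrev TensorSpace {d : ℕ} (n : Fin d → ℕ) : Type :=
  EuclideanSpace ℝ ((ℓ : Fin d) → Fin (n ℓ))

/-- The index set of the rows of the block matrix. -/
abbrev BlockIndex {d : ℕ} (n : Fin d → ℕ) : Type := Σ ℓ : Fin d, Fin (n ℓ)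

theorem card_blockIndex (n : Fin d → ℕ) : Fintype.card (BlockIndex n) = totalDim n := by
  simp [totalDim]

/-- The normalized block matrix of a noise tensor. -/
noncomputable def noiseMatrix (a : Vectors n) :
    TensorSpace n →ₗ[ℝ] Matrix (BlockIndex n) (BlockIndex n) ℝ :=
  ((Real.sqrt (totalDim n))⁻¹ • blockMatrixLinear a).comp
    (WithLp.linearEquiv 2 ℝ (((ℓ : Fin d) → Fin (n ℓ)) → ℝ)).toLinearMap

/-- The normalized compressed block matrix of a noise tensor. -/
noncomputable def projNoiseMatrix (a : Vectors n) :
    TensorSpace n →ₗ[ℝ] Matrix (BlockIndex n) (BlockIndex n) ℝ :=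
  ((Real.sqrt (totalDim n))⁻¹ • projBlockMatrixLinear a).comp
    (WithLp.linearEquiv 2 ℝ (((ℓ : Fin d) → Fin (n ℓ)) → ℝ)).toLinearMap

theorem noiseMatrix_eq (a : Vectors n) (x : TensorSpace n) :
    noiseMatrix a x = blockMatrix ((Real.sqrt (totalDim n))⁻¹ • x.ofLp) a := by
  have : blockMatrix ((Real.sqrt (totalDim n))⁻¹ • x.ofLp) a =
    blockMatrixLinear a ((Real.sqrt (totalDim n))⁻¹ • x.ofLp) := rfl
  rw [this, map_smul]
  rfl

theorem projNoiseMatrix_eq (a : Vectors n) (x : TensorSpace n) :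
    projNoiseMatrix a x = projBlockMatrix ((Real.sqrt (totalDim n))⁻¹ • x.ofLp) a := by
  have : projBlockMatrix ((Real.sqrt (totalDim n))⁻¹ • x.ofLp) a =
    projBlockMatrixLinear a ((Real.sqrt (totalDim n))⁻¹ • x.ofLp) := rfl
  rw [this, map_smul]
  rfl

theorem noiseMatrix_isHermitian (a : Vectors n) (x : TensorSpace n) :
    (noiseMatrix a x).IsHermitian := by
  rw [noiseMatrix_eq]; exact blockMatrix_isHermitian _ _

theorem projNoiseMatrix_isHermitian (a : Vectors n) (x : TensorSpace n) :
    (projNoiseMatrix a x).IsHermitian := by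
  rw [projNoiseMatrix_eq]; exact projBlockMatrix_isHermitian _ _

/-- The trace of the resolvent of the noise matrix against a diagonal weight. -/
noncomputable def noiseTrace (w : BlockIndex n → ℂ) (z : ℂ) (a : Vectors n) (x : TensorSpace n) :
    ℂ :=
  (Matrix.diagonal w * resolventMatrix (noiseMatrix a x) z).trace

/-- The trace of the resolvent of the compressed noise matrix against a diagonal weight. -/
noncomputable def projNoiseTrace (w : BlockIndex n → ℂ) (z : ℂ) (a : Vectors n)
    (x : TensorSpace n) : ℂ :=
  (Matrix.diagonal w * resolventMatrix (projNoiseMatrix a x) z).trace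

/-- The indicator of the `ℓ`-th block. -/
def blockWeight (ℓ : Fin d) : BlockIndex n → ℂ := fun s => if s.1 = ℓ then 1 else 0

/-- The indicator of the complement of the `ℓ`-th block. -/
def offWeight (ℓ : Fin d) : BlockIndex n → ℂ := fun s => if s.1 = ℓ then 0 else 1

theorem norm_blockWeight_le (ℓ : Fin d) (s : BlockIndex n) : ‖blockWeight ℓ s‖ ≤ 1 := by
  unfold blockWeight; split_ifs <;> simp

theorem norm_offWeight_le (ℓ : Fin d) (s : BlockIndex n) : ‖offWeight ℓ s‖ ≤ 1 := by
  unfold offWeight; split_ifs <;> simp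

theorem norm_noiseTrace_le {w : BlockIndex n → ℂ} (hw : ∀ s, ‖w s‖ ≤ 1) {z : ℂ} (hz : z.im ≠ 0)
    (a : Vectors n) (x : TensorSpace n) : ‖noiseTrace w z a x‖ ≤ totalDim n * |z.im|⁻¹ := by
  have := norm_trace_diagonal_resolvent_le (noiseMatrix_isHermitian a x) hz hw
  rwa [card_blockIndex] at this

theorem norm_projNoiseTrace_le {w : BlockIndex n → ℂ} (hw : ∀ s, ‖w s‖ ≤ 1) {z : ℂ}
    (hz : z.im ≠ 0) (a : Vectors n) (x : TensorSpace n) :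
    ‖projNoiseTrace w z a x‖ ≤ totalDim n * |z.im|⁻¹ := by
  have := norm_trace_diagonal_resolvent_le (projNoiseMatrix_isHermitian a x) hz hw
  rwa [card_blockIndex] at this

/-- The compression has rank at most `2 * d`, and each unit of rank costs `2 / |Im z|`. -/
theorem norm_noiseTrace_sub_projNoiseTrace_le {w : BlockIndex n → ℂ} (hw : ∀ s, ‖w s‖ ≤ 1) {z : ℂ}
    (hz : z.im ≠ 0) (a : Vectors n) (x : TensorSpace n) :
    ‖noiseTrace w z a x - projNoiseTrace w z a x‖ ≤ 4 * d * |z.im|⁻¹ := by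
  obtain ⟨u, v, huv⟩ := exists_blockMatrix_sub_projBlockMatrix
    ((Real.sqrt (totalDim n))⁻¹ • x.ofLp) a
  have := norm_trace_diagonal_resolvent_sub_le_card (noiseMatrix_isHermitian a x)
    (projNoiseMatrix_isHermitian a x) u v (by
      intro s t; rw [noiseMatrix_eq, projNoiseMatrix_eq]; exact huv s t) hz hw
  refine this.trans (le_of_eq ?_)
  simp only [Fintype.card_sum, Fintype.card_fin]
  push_cast; ring

/-- The scaling by `N ^ (-1/2)` cancels the square root of the dimension in the trace perturbation
bound. A quantity of order `N` thus has a Lipschitz constant of order one, which is what beats the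
cardinality of the net later. -/
theorem norm_noiseTrace_sub_le (hN : 0 < totalDim n) {w : BlockIndex n → ℂ}
    (hw : ∀ s, ‖w s‖ ≤ 1) {z : ℂ} (hz : z.im ≠ 0)
    {a : Vectors n} (ha : ∀ k, ‖a k‖ = 1) (x y : TensorSpace n) :
    ‖noiseTrace w z a x - noiseTrace w z a y‖ ≤ d * |z.im|⁻¹ ^ 2 * ‖x - y‖ := by
  have hN' : (0 : ℝ) < totalDim n := by exact_mod_cast hN
  have h := norm_trace_diagonal_resolvent_sub_le (noiseMatrix_isHermitian a x)
    (noiseMatrix_isHermitian a y) hz hw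
  rw [card_blockIndex] at h
  refine h.trans ?_
  have h1 : ∑ i, ∑ j, (noiseMatrix a x i j - noiseMatrix a y i j) ^ 2 ≤
      d ^ 2 * ((totalDim n : ℝ)⁻¹ * ‖x - y‖ ^ 2) := by
    have e : ∀ i j, noiseMatrix a x i j - noiseMatrix a y i j =
        blockMatrix ((Real.sqrt (totalDim n))⁻¹ • (x - y).ofLp) a i j := by
      intro i j
      rw [← Matrix.sub_apply, ← map_sub, noiseMatrix_eq]
    simp only [e]
    refine (sum_blockMatrix_sq_le _ ha).trans (le_of_eq ?_)
    congr 1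
    rw [EuclideanSpace.norm_sq_eq, Finset.mul_sum]
    refine Finset.sum_congr rfl fun p _ => ?_
    rw [Pi.smul_apply, smul_eq_mul, mul_pow, inv_pow, Real.sq_sqrt hN'.le, Real.norm_eq_abs, sq_abs]
  calc _ ≤ √(totalDim n) * |z.im|⁻¹ ^ 2 * √(d ^ 2 * ((totalDim n : ℝ)⁻¹ * ‖x - y‖ ^ 2)) := by
        gcongr
    _ = _ := by
        rw [Real.sqrt_mul (by positivity), Real.sqrt_mul (by positivity), Real.sqrt_sq (by positivity),
          Real.sqrt_sq (norm_nonneg _), Real.sqrt_inv]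
        have : √(totalDim n : ℝ) ≠ 0 := (Real.sqrt_pos.2 hN').ne'
        field_simp

/-- The Lipschitz constant of the traces of the resolvent as functions of the noise. -/
noncomputable def traceLipschitz (d : ℕ) (z : ℂ) : NNReal :=
  ⟨d * |z.im|⁻¹ ^ 2, by positivity⟩

theorem contDiff_noiseTrace (w : BlockIndex n → ℂ) {z : ℂ} (hz : z.im ≠ 0) (a : Vectors n) :
    ContDiff ℝ 1 (noiseTrace w z a) := by
  have h := contDiff_resolventMatrix (fun x => noiseMatrix_isHermitian a x) hz
  let τ : Matrix (BlockIndex n) (BlockIndex n) ℂ →L[ℝ] ℂ := LinearMap.toContinuousLinearMap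
    ((Matrix.traceLinearMap (BlockIndex n) ℝ ℂ).comp (LinearMap.mulLeft ℝ (Matrix.diagonal w)))
  exact τ.contDiff.comp h

theorem continuous_projNoiseTrace (w : BlockIndex n → ℂ) {z : ℂ} (hz : z.im ≠ 0) (a : Vectors n) :
    Continuous (projNoiseTrace w z a) := by
  have h := contDiff_resolventMatrix (fun x => projNoiseMatrix_isHermitian a x) hz
  let τ : Matrix (BlockIndex n) (BlockIndex n) ℂ →L[ℝ] ℂ := LinearMap.toContinuousLinearMap
    ((Matrix.traceLinearMap (BlockIndex n) ℝ ℂ).comp (LinearMap.mulLeft ℝ (Matrix.diagonal w)))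
  exact τ.continuous.comp h.continuous

theorem lipschitzWith_re_noiseTrace (hN : 0 < totalDim n) {w : BlockIndex n → ℂ}
    (hw : ∀ s, ‖w s‖ ≤ 1) {z : ℂ} (hz : z.im ≠ 0) {a : Vectors n} (ha : ∀ k, ‖a k‖ = 1) :
    LipschitzWith (traceLipschitz d z) (fun x => (noiseTrace w z a x).re) := by
  refine LipschitzWith.of_dist_le_mul fun x y => ?_
  rw [Real.dist_eq, dist_eq_norm, ← Complex.sub_re]
  exact (Complex.abs_re_le_norm _).trans (norm_noiseTrace_sub_le hN hw hz ha x y)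

theorem lipschitzWith_im_noiseTrace (hN : 0 < totalDim n) {w : BlockIndex n → ℂ}
    (hw : ∀ s, ‖w s‖ ≤ 1) {z : ℂ} (hz : z.im ≠ 0) {a : Vectors n} (ha : ∀ k, ‖a k‖ = 1) :
    LipschitzWith (traceLipschitz d z) (fun x => (noiseTrace w z a x).im) := by
  refine LipschitzWith.of_dist_le_mul fun x y => ?_
  rw [Real.dist_eq, dist_eq_norm, ← Complex.sub_im]
  exact (Complex.abs_im_le_norm _).trans (norm_noiseTrace_sub_le hN hw hz ha x y)

theorem integrable_noiseTrace {w : BlockIndex n → ℂ} (hw : ∀ s, ‖w s‖ ≤ 1) {z : ℂ}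
    (hz : z.im ≠ 0) (a : Vectors n) :
    Integrable (noiseTrace w z a) (stdGaussian (TensorSpace n)) :=
  Integrable.of_bound (contDiff_noiseTrace w hz a).continuous.aestronglyMeasurable _
    (ae_of_all _ (norm_noiseTrace_le hw hz a))

theorem integrable_projNoiseTrace {w : BlockIndex n → ℂ} (hw : ∀ s, ‖w s‖ ≤ 1) {z : ℂ}
    (hz : z.im ≠ 0) (a : Vectors n) :
    Integrable (projNoiseTrace w z a) (stdGaussian (TensorSpace n)) :=
  Integrable.of_bound (continuous_projNoiseTrace w hz a).aestronglyMeasurable _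
    (ae_of_all _ (norm_projNoiseTrace_le hw hz a))

theorem re_integral_noiseTrace {w : BlockIndex n → ℂ} (hw : ∀ s, ‖w s‖ ≤ 1) {z : ℂ}
    (hz : z.im ≠ 0) (a : Vectors n) :
    ∫ x, (noiseTrace w z a x).re ∂(stdGaussian (TensorSpace n)) =
      (∫ x, noiseTrace w z a x ∂(stdGaussian (TensorSpace n))).re :=
  integral_re (𝕜 := ℂ) (integrable_noiseTrace hw hz a)

theorem im_integral_noiseTrace {w : BlockIndex n → ℂ} (hw : ∀ s, ‖w s‖ ≤ 1) {z : ℂ}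
    (hz : z.im ≠ 0) (a : Vectors n) :
    ∫ x, (noiseTrace w z a x).im ∂(stdGaussian (TensorSpace n)) =
      (∫ x, noiseTrace w z a x ∂(stdGaussian (TensorSpace n))).im :=
  integral_im (𝕜 := ℂ) (integrable_noiseTrace hw hz a)

theorem differentiable_re_noiseTrace (w : BlockIndex n → ℂ) {z : ℂ} (hz : z.im ≠ 0)
    (a : Vectors n) : Differentiable ℝ (fun x => (noiseTrace w z a x).re) :=
  Complex.reCLM.differentiable.comp ((contDiff_noiseTrace w hz a).differentiable one_ne_zero)

theorem differentiable_im_noiseTrace (w : BlockIndex n → ℂ) {z : ℂ} (hz : z.im ≠ 0)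
    (a : Vectors n) : Differentiable ℝ (fun x => (noiseTrace w z a x).im) :=
  Complex.imCLM.differentiable.comp ((contDiff_noiseTrace w hz a).differentiable one_ne_zero)

theorem traceLipschitz_pos (hd : 0 < d) {z : ℂ} (hz : z.im ≠ 0) : 0 < traceLipschitz d z := by
  have h0 : 0 < |z.im| := abs_pos.2 hz
  have : (0 : ℝ) < d := by exact_mod_cast hd
  exact (show (0 : ℝ) < d * |z.im|⁻¹ ^ 2 by positivity)

theorem integral_norm_noiseTrace_sub_le (hd : 0 < d) (hN : 0 < totalDim n) {w : BlockIndex n → ℂ}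
    (hw : ∀ s, ‖w s‖ ≤ 1) {z : ℂ} (hz : z.im ≠ 0) {a : Vectors n} (ha : ∀ k, ‖a k‖ = 1) :
    ∫ x, ‖noiseTrace w z a x - ∫ y, noiseTrace w z a y ∂(stdGaussian (TensorSpace n))‖
      ∂(stdGaussian (TensorSpace n)) ≤ 4 * Real.exp (Real.pi ^ 2 / 8) * traceLipschitz d z := by
  set m := ∫ y, noiseTrace w z a y ∂(stdGaussian (TensorSpace n)) with hm
  have h1 := integral_abs_sub_integral_le (traceLipschitz_pos hd hz)
    (lipschitzWith_re_noiseTrace hN hw hz ha) (differentiable_re_noiseTrace w hz a)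
    (B := totalDim n * |z.im|⁻¹) fun x => (Complex.abs_re_le_norm _).trans
      (norm_noiseTrace_le hw hz a x)
  have h2 := integral_abs_sub_integral_le (traceLipschitz_pos hd hz)
    (lipschitzWith_im_noiseTrace hN hw hz ha) (differentiable_im_noiseTrace w hz a)
    (B := totalDim n * |z.im|⁻¹) fun x => (Complex.abs_im_le_norm _).trans
      (norm_noiseTrace_le hw hz a x)
  rw [re_integral_noiseTrace hw hz, ← hm] at h1
  rw [im_integral_noiseTrace hw hz, ← hm] at h2
  have hi := (integrable_noiseTrace hw hz a).sub (integrable_const m)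
  have i1 : Integrable (fun x => |(noiseTrace w z a x).re - m.re|)
    (stdGaussian (TensorSpace n)) := hi.re.abs
  have i2 : Integrable (fun x => |(noiseTrace w z a x).im - m.im|)
    (stdGaussian (TensorSpace n)) := hi.im.abs
  have h3 := integral_mono hi.norm (i1.add i2) fun x => by
    have := Complex.norm_le_abs_re_add_abs_im (noiseTrace w z a x - m)
    simpa using this
  have h4 : ∫ x, ((fun x => |(noiseTrace w z a x).re - m.re|) +
      fun x => |(noiseTrace w z a x).im - m.im|) x ∂(stdGaussian (TensorSpace n)) =
      _ := integral_add i1 i2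
  rw [h4] at h3
  simp only [Pi.sub_apply] at h3
  linarith

theorem integral_inner_mul_inner_stdGaussian {E : Type*} [NormedAddCommGroup E]
    [InnerProductSpace ℝ E] [FiniteDimensional ℝ E] [MeasurableSpace E] [BorelSpace E] (u v : E) :
    ∫ x, inner ℝ u x * inner ℝ v x ∂(stdGaussian E) = inner ℝ u v := by
  have h := congrArg (fun B => B u v) (covarianceBilin_stdGaussian (E := E))
  change covarianceBilin (stdGaussian E) u v = inner ℝ u v at h
  rw [covarianceBilin_apply (IsGaussian.memLp_two_id)] at h
  rw [← h]
  have : ∫ x, x ∂(stdGaussian E) = 0 := integral_id_stdGaussian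
  simp [this]

theorem contractAll_eq_inner (x : TensorSpace n) (v : (k : Fin d) → Fin (n k) → ℝ) :
    contractAll x.ofLp v = inner ℝ (WithLp.toLp 2 fun p => ∏ k, v k (p k) : TensorSpace n) x := by
  simp [contractAll, PiLp.inner_apply]

theorem integral_contractAll_mul (v w : (k : Fin d) → Fin (n k) → ℝ) :
    ∫ x : TensorSpace n, contractAll x.ofLp v * contractAll x.ofLp w
      ∂(stdGaussian (TensorSpace n)) = ∏ k, v k ⬝ᵥ w k := by
  simp only [contractAll_eq_inner]
  rw [integral_inner_mul_inner_stdGaussian, ← sum_prod_mul_prod]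
  simp [PiLp.inner_apply, mul_comm]

theorem integral_projNoiseMatrix_mul {a : Vectors n} (ha : ∀ k, ‖a k‖ = 1)
    (s t u v : BlockIndex n) :
    ∫ y, projNoiseMatrix a y s t * projNoiseMatrix a y u v ∂(stdGaussian (TensorSpace n)) =
      (totalDim n : ℝ)⁻¹ * if s.1 = t.1 then 0 else
        projMatrix a s u * projMatrix a t v + projMatrix a s v * projMatrix a t u := by
  simp only [projNoiseMatrix_eq]
  by_cases h : s.1 = t.1
  · simp [projBlockMatrix, h]
  by_cases h' : u.1 = v.1
  · have h0 : projMatrix a s u * projMatrix a t v + projMatrix a s v * projMatrix a t u = 0 := by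
      by_cases h1 : s.1 = u.1
      · have h2 : t.1 ≠ v.1 := fun e => h (by rw [h1, h', e])
        have h3 : t.1 ≠ u.1 := fun e => h (by rw [h1, e])
        rw [projMatrix_of_ne a h2, projMatrix_of_ne a h3]; ring
      · have h2 : s.1 ≠ v.1 := fun e => h1 (by rw [e, h'])
        rw [projMatrix_of_ne a h1, projMatrix_of_ne a h2]; ring
    simp [projBlockMatrix, h', h0]
  · rw [if_neg h, ← prod_dotProduct_replaceTwo ha h h', ← integral_contractAll_mul,
      ← integral_const_mul]
    congr 1
    ext y
    rw [projBlockMatrix, projBlockMatrix, if_neg h, if_neg h', contractAll_smul, contractAll_smul]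
    have : (Real.sqrt (totalDim n))⁻¹ * (Real.sqrt (totalDim n))⁻¹ = (totalDim n : ℝ)⁻¹ := by
      rw [← mul_inv, Real.mul_self_sqrt (Nat.cast_nonneg _)]
    rw [← this]; ring

theorem integrable_projNoiseMatrix_mul (a : Vectors n) (s t u v : BlockIndex n) :
    Integrable (fun y => projNoiseMatrix a y s t * projNoiseMatrix a y u v)
      (stdGaussian (TensorSpace n)) := by
  let L : BlockIndex n → BlockIndex n → TensorSpace n →L[ℝ] ℝ := fun s t =>
    LinearMap.toContinuousLinearMap ((Matrix.entryLinearMap ℝ ℝ s t).comp (projNoiseMatrix a))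
  have hL : ∀ s t, MemLp (fun y => projNoiseMatrix a y s t) 2 (stdGaussian (TensorSpace n)) :=
    fun s t => IsGaussian.memLp_dual (stdGaussian (TensorSpace n)) (L s t) 2 (by simp)
  exact (hL s t).integrable_mul (hL u v)

theorem trace_diagonal_mul_four (w : BlockIndex n → ℂ) (B R : Matrix (BlockIndex n) (BlockIndex n) ℂ) :
    (Matrix.diagonal w * (B * (R * B * R))).trace =
      ∑ s, ∑ t, ∑ v, ∑ u, w s * R t u * R v s * (B s t * B u v) := by
  rw [Matrix.trace]
  refine Finset.sum_congr rfl fun s _ => ?_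
  rw [Matrix.diag_apply, Matrix.diagonal_mul, Matrix.mul_apply, Finset.mul_sum]
  refine Finset.sum_congr rfl fun t _ => ?_
  rw [Matrix.mul_apply, Finset.mul_sum, Finset.mul_sum]
  refine Finset.sum_congr rfl fun v _ => ?_
  rw [Matrix.mul_apply, Finset.sum_mul, Finset.mul_sum, Finset.mul_sum]
  exact Finset.sum_congr rfl fun u _ => by ring

/-- The block diagonal projection, with complex entries. -/
noncomputable def projMatrixC (a : Vectors n) : Matrix (BlockIndex n) (BlockIndex n) ℂ :=
  (projMatrix a).map (fun t : ℝ => (t : ℂ))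

/-- Inserting the covariance of the entries contracts the two copies of `R` in two ways. One gives
products of opposite entries of `P R`, which are negligible; the other gives products of its
diagonal entries, which form the main term. -/
theorem integral_trace_diagonal_mul_four {a : Vectors n} (ha : ∀ k, ‖a k‖ = 1)
    (w : BlockIndex n → ℂ) {R : Matrix (BlockIndex n) (BlockIndex n) ℂ} (hR : R.transpose = R) :
    ∫ y, (Matrix.diagonal w * (complexFamily (projNoiseMatrix a) y *
      (R * complexFamily (projNoiseMatrix a) y * R))).trace ∂(stdGaussian (TensorSpace n)) =
    (totalDim n : ℂ)⁻¹ * ∑ s, ∑ t, if s.1 = t.1 then 0 else w s *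
      ((projMatrixC a * R) s t * (projMatrixC a * R) t s +
        (projMatrixC a * R) s s * (projMatrixC a * R) t t) := by
  have hR' : ∀ i j, R i j = R j i := fun i j => by
    conv_lhs => rw [← hR]
    rfl
  have e : ∀ y s t u v, complexFamily (projNoiseMatrix a) y s t *
      complexFamily (projNoiseMatrix a) y u v =
      ((projNoiseMatrix a y s t * projNoiseMatrix a y u v : ℝ) : ℂ) := fun y s t u v => by
    rw [complexFamily_apply]; simp
  simp only [trace_diagonal_mul_four, e]
  have hi : ∀ s t v u, Integrable (fun y => w s * R t u * R v s *
      ((projNoiseMatrix a y s t * projNoiseMatrix a y u v : ℝ) : ℂ))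
      (stdGaussian (TensorSpace n)) := fun s t v u =>
    ((integrable_projNoiseMatrix_mul a s t u v).ofReal).const_mul _
  rw [integral_finsetSum _ fun s _ => integrable_finsetSum _ fun t _ =>
    integrable_finsetSum _ fun v _ => integrable_finsetSum _ fun u _ => hi s t v u, Finset.mul_sum]
  refine Finset.sum_congr rfl fun s _ => ?_
  rw [integral_finsetSum _ fun t _ =>
    integrable_finsetSum _ fun v _ => integrable_finsetSum _ fun u _ => hi s t v u, Finset.mul_sum]
  refine Finset.sum_congr rfl fun t _ => ?_
  rw [integral_finsetSum _ fun v _ => integrable_finsetSum _ fun u _ => hi s t v u]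
  have h2 : ∀ v, ∫ y, ∑ u, w s * R t u * R v s *
      ((projNoiseMatrix a y s t * projNoiseMatrix a y u v : ℝ) : ℂ)
      ∂(stdGaussian (TensorSpace n)) = ∑ u, w s * R t u * R v s *
      (((totalDim n : ℝ)⁻¹ * if s.1 = t.1 then 0 else
        projMatrix a s u * projMatrix a t v + projMatrix a s v * projMatrix a t u : ℝ) : ℂ) := by
    intro v
    rw [integral_finsetSum _ fun u _ => hi s t v u]
    refine Finset.sum_congr rfl fun u _ => ?_
    rw [integral_const_mul, integral_complex_ofReal, integral_projNoiseMatrix_mul ha]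
  simp only [h2]
  by_cases h : s.1 = t.1
  · simp [h]
  · simp only [h, if_false]
    have hA : (projMatrixC a * R) s t * (projMatrixC a * R) t s =
        ∑ v, ∑ u, (projMatrixC a t v * R v s) * (projMatrixC a s u * R u t) := by
      rw [mul_comm, Matrix.mul_apply, Matrix.mul_apply, Finset.sum_mul_sum]
    have hB : (projMatrixC a * R) s s * (projMatrixC a * R) t t =
        ∑ v, ∑ u, (projMatrixC a s v * R v s) * (projMatrixC a t u * R u t) := by
      rw [Matrix.mul_apply, Matrix.mul_apply, Finset.sum_mul_sum]
    rw [hA, hB, ← Finset.sum_add_distrib, Finset.mul_sum, Finset.mul_sum]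
    refine Finset.sum_congr rfl fun v _ => ?_
    rw [← Finset.sum_add_distrib, Finset.mul_sum, Finset.mul_sum]
    refine Finset.sum_congr rfl fun u _ => ?_
    -- Symmetry of `R`, without conjugation, matches the order of indices required by the matrix
    -- product.
    rw [hR' t u]
    simp only [projMatrixC, Matrix.map_apply]
    push_cast
    ring

end MeanEquation

/-! ### The approximate equation for the expected block traces. -/

section MeanEquation

open scoped Matrix.Norms.L2Operator

variable {d : ℕ} {n : Fin d → ℕ}

/-- The block diagonal projection onto the lines spanned by the `a k`, with complex entries. -/
noncomputable def lineMatrixC (a : Vectors n) : Matrix (BlockIndex n) (BlockIndex n) ℂ :=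
  fun s t => if s.1 = t.1 then (coords a s.1 s.2 : ℂ) * (coords a t.1 t.2 : ℂ) else 0

theorem projMatrixC_eq (a : Vectors n) : projMatrixC a = 1 - lineMatrixC a := by
  ext s t
  simp only [projMatrixC, projMatrix, lineMatrixC, Matrix.map_apply, Matrix.sub_apply,
    Matrix.one_apply]
  split_ifs <;> push_cast <;> rfl

theorem lineMatrixC_mul_self {a : Vectors n} (ha : ∀ k, ‖a k‖ = 1) :
    lineMatrixC a * lineMatrixC a = lineMatrixC a := by
  ext s t
  rw [Matrix.mul_apply, Fintype.sum_sigma, Finset.sum_eq_single s.1]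
  · have h1 := dotProduct_coords_self ha s.1
    simp only [lineMatrixC, if_true]
    by_cases h : s.1 = t.1
    · simp only [if_pos h]
      have h2 : ∑ q, (coords a s.1 q : ℂ) * (coords a s.1 q : ℂ) = 1 := by
        rw [dotProduct] at h1; exact_mod_cast h1
      have h3 : ∀ q, (coords a s.1 s.2 : ℂ) * (coords a s.1 q : ℂ) *
          ((coords a s.1 q : ℂ) * (coords a t.1 t.2 : ℂ)) =
          ((coords a s.1 q : ℂ) * (coords a s.1 q : ℂ)) *
          ((coords a s.1 s.2 : ℂ) * (coords a t.1 t.2 : ℂ)) := fun q => by ring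
      rw [Finset.sum_congr rfl fun q _ => h3 q, ← Finset.sum_mul, h2, one_mul]
    · simp [h]
  · intro m _ hm
    simp [lineMatrixC, Ne.symm hm]
  · simp

/-- For a Hermitian idempotent the C*-identity reads `‖L‖ = ‖L‖ ^ 2`. -/
theorem norm_lineMatrixC_le {a : Vectors n} (ha : ∀ k, ‖a k‖ = 1) : ‖lineMatrixC a‖ ≤ 1 := by
  have hH : (lineMatrixC a).conjTranspose = lineMatrixC a := by
    ext s t
    simp only [Matrix.conjTranspose_apply, lineMatrixC, eq_comm (a := t.1)]
    split_ifs <;> simp [mul_comm]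
  have h := Matrix.l2_opNorm_conjTranspose_mul_self (lineMatrixC a)
  rw [hH, lineMatrixC_mul_self ha] at h
  by_contra hc
  nlinarith

theorem norm_projMatrixC_le {a : Vectors n} (ha : ∀ k, ‖a k‖ = 1) : ‖projMatrixC a‖ ≤ 2 := by
  rw [projMatrixC_eq]
  rcases isEmpty_or_nonempty (BlockIndex n) with he | he
  · have : (1 - lineMatrixC a : Matrix (BlockIndex n) (BlockIndex n) ℂ) = 0 := by
      ext s; exact he.elim s
    rw [this]; simp
  · refine (norm_sub_le _ _).trans ?_
    have h1 : ‖(1 : Matrix (BlockIndex n) (BlockIndex n) ℂ)‖ ≤ 1 := by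
      rw [← Matrix.diagonal_one]
      exact norm_diagonal_le_one (w := fun _ => 1) fun _ => by simp
    linarith [norm_lineMatrixC_le ha]

theorem rank_lineMatrixC_le (a : Vectors n) : (lineMatrixC a).rank ≤ d := by
  have e : lineMatrixC a =
      (Matrix.of fun s ℓ => if s.1 = ℓ then (coords a s.1 s.2 : ℂ) else 0 :
        Matrix (BlockIndex n) (Fin d) ℂ) *
        (Matrix.of fun ℓ t => if t.1 = ℓ then (coords a t.1 t.2 : ℂ) else 0 :
          Matrix (Fin d) (BlockIndex n) ℂ) := by
    ext s t
    simp [Matrix.mul_apply, lineMatrixC, eq_comm]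
  rw [e]
  exact (Matrix.rank_mul_le_left _ _).trans
    ((Matrix.rank_le_card_width _).trans (by simp))

theorem norm_trace_sub_trace_proj_le {a : Vectors n} (ha : ∀ k, ‖a k‖ = 1)
    {w : BlockIndex n → ℂ} (hw : ∀ s, ‖w s‖ ≤ 1) (R : Matrix (BlockIndex n) (BlockIndex n) ℂ) :
    ‖(Matrix.diagonal w * R).trace - (Matrix.diagonal w * (projMatrixC a * R)).trace‖ ≤
      d * ‖R‖ := by
  have e : (Matrix.diagonal w * R).trace - (Matrix.diagonal w * (projMatrixC a * R)).trace =
      (Matrix.diagonal w * (lineMatrixC a * R)).trace := by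
    rw [← Matrix.trace_sub, ← mul_sub, projMatrixC_eq]
    congr 2
    rw [sub_mul, one_mul, sub_sub_cancel]
  rw [e]
  refine (norm_trace_le_rank_mul _).trans ?_
  refine mul_le_mul ?_ ?_ (norm_nonneg _) (Nat.cast_nonneg _)
  · rw [Nat.cast_le]
    exact (Matrix.rank_mul_le_right _ _).trans
      ((Matrix.rank_mul_le_left _ _).trans (rank_lineMatrixC_le a))
  · refine (norm_mul_le _ _).trans
      ((mul_le_of_le_one_left (norm_nonneg _) (norm_diagonal_le_one hw)).trans ?_)
    exact (norm_mul_le _ _).trans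
      (mul_le_of_le_one_left (norm_nonneg _) (norm_lineMatrixC_le ha))

/-- The right-hand side of the Gaussian integration by parts, up to normalization. -/
noncomputable def pairTerm (a : Vectors n) (ℓ : Fin d)
    (R : Matrix (BlockIndex n) (BlockIndex n) ℂ) : ℂ :=
  ∑ s, ∑ t, if s.1 = t.1 then 0 else blockWeight ℓ s *
      ((projMatrixC a * R) s t * (projMatrixC a * R) t s +
        (projMatrixC a * R) s s * (projMatrixC a * R) t t)

/-- The restriction to pairs in different blocks turns the diagonal products into the trace over the
block `ℓ` times the trace over its complement. This is the source of `g_ℓ (g - g_ℓ)` in the limit.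
-/
theorem pairTerm_eq (a : Vectors n) (ℓ : Fin d) (R : Matrix (BlockIndex n) (BlockIndex n) ℂ) :
    pairTerm a ℓ R = (∑ s, ∑ t, if s.1 = t.1 then 0 else blockWeight ℓ s *
      ((projMatrixC a * R) s t * (projMatrixC a * R) t s)) +
      (Matrix.diagonal (blockWeight ℓ) * (projMatrixC a * R)).trace *
      (Matrix.diagonal (offWeight ℓ) * (projMatrixC a * R)).trace := by
  rw [Matrix.trace, Matrix.trace, Finset.sum_mul_sum, pairTerm, ← Finset.sum_add_distrib]
  refine Finset.sum_congr rfl fun s _ => ?_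
  rw [← Finset.sum_add_distrib]
  refine Finset.sum_congr rfl fun t _ => ?_
  simp only [Matrix.diag_apply, Matrix.diagonal_mul]
  by_cases hs : s.1 = ℓ
  · by_cases h : s.1 = t.1
    · simp [← h, offWeight, hs]
    · have h' : ¬ t.1 = ℓ := fun e => h (by rw [hs, e])
      rw [if_neg h, if_neg h, offWeight, if_neg h', blockWeight, if_pos hs]
      ring
  · simp [blockWeight, hs]

/-- By the arithmetic-geometric mean inequality the sum is at most the squared Hilbert-Schmidt norm
of `Q`. This is of order `N`, whereas the main term is of order `N ^ 2`. -/
theorem norm_sum_mul_swap_le (ℓ : Fin d) (Q : Matrix (BlockIndex n) (BlockIndex n) ℂ) :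
    ‖∑ s : BlockIndex n, ∑ t : BlockIndex n, if s.1 = t.1 then 0 else blockWeight ℓ s *
      (Q s t * Q t s)‖ ≤ totalDim n * ‖Q‖ ^ 2 := by
  have h1 : ‖∑ s : BlockIndex n, ∑ t : BlockIndex n, if s.1 = t.1 then 0 else blockWeight ℓ s *
      (Q s t * Q t s)‖ ≤ ∑ s, ∑ t, (‖Q s t‖ ^ 2 / 2 + ‖Q t s‖ ^ 2 / 2) := by
    refine (norm_sum_le _ _).trans (Finset.sum_le_sum fun s _ =>
      (norm_sum_le _ _).trans (Finset.sum_le_sum fun t _ => ?_))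
    split_ifs
    · rw [norm_zero]; positivity
    · rw [norm_mul, norm_mul]
      refine (mul_le_of_le_one_left (by positivity) (norm_blockWeight_le ℓ s)).trans ?_
      nlinarith [sq_nonneg (‖Q s t‖ - ‖Q t s‖)]
  refine h1.trans (le_trans (le_of_eq ?_) ((sum_norm_sq_le_l2OpNorm Q).trans
    (le_of_eq (by rw [card_blockIndex]))))
  simp only [Finset.sum_add_distrib]
  rw [Finset.sum_comm (f := fun s t => ‖Q t s‖ ^ 2 / 2), ← Finset.sum_add_distrib]
  refine Finset.sum_congr rfl fun s _ => ?_
  rw [← Finset.sum_add_distrib]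
  exact Finset.sum_congr rfl fun t _ => by ring

/-- The constant `4` comes from the opposite entries, as `‖P R‖ ≤ 2 / |Im z|`. The constant `3 d ^
2` comes from replacing `P R` by `R` in both traces, where each replacement has rank at most `d`. -/
theorem norm_pairTerm_sub_le (hd : 0 < d) (hN : 0 < totalDim n) {a : Vectors n}
    (ha : ∀ k, ‖a k‖ = 1) (ℓ : Fin d) {z : ℂ} (hz : z.im ≠ 0) (x : TensorSpace n) :
    ‖projNoiseTrace (blockWeight ℓ) z a x * projNoiseTrace (offWeight ℓ) z a x -
      pairTerm a ℓ (resolventMatrix (projNoiseMatrix a x) z)‖ ≤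
      totalDim n * ((4 + 3 * d ^ 2) * |z.im|⁻¹ ^ 2) := by
  set R := resolventMatrix (projNoiseMatrix a x) z with hRdef
  set b := |z.im|⁻¹ with hb
  have hb0 : 0 ≤ b := by positivity
  have hR : ‖R‖ ≤ b := norm_resolventMatrix_le (projNoiseMatrix_isHermitian a x) hz
  have hd1 : (1 : ℝ) ≤ d := by exact_mod_cast hd
  have hN1 : (1 : ℝ) ≤ totalDim n := by exact_mod_cast hN
  set N : ℝ := (totalDim n : ℝ) with hNdef
  have hQ : ‖projMatrixC a * R‖ ≤ 2 * b := (norm_mul_le _ _).trans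
    (mul_le_mul (norm_projMatrixC_le ha) hR (norm_nonneg _) (by norm_num))
  have h1 := norm_trace_sub_trace_proj_le ha (norm_blockWeight_le ℓ) R
  have h2 := norm_trace_sub_trace_proj_le ha (norm_offWeight_le ℓ) R
  have h3 := norm_projNoiseTrace_le (norm_blockWeight_le ℓ) hz a x
  have h4 := norm_projNoiseTrace_le (norm_offWeight_le ℓ) hz a x
  have e1 : (Matrix.diagonal (blockWeight ℓ) * R).trace = projNoiseTrace (blockWeight ℓ) z a x := rfl
  have e2 : (Matrix.diagonal (offWeight ℓ) * R).trace = projNoiseTrace (offWeight ℓ) z a x := rfl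
  rw [e1] at h1
  rw [e2] at h2
  rw [pairTerm_eq]
  set S := ∑ s : BlockIndex n, ∑ t : BlockIndex n, if s.1 = t.1 then 0 else blockWeight ℓ s *
      ((projMatrixC a * R) s t * (projMatrixC a * R) t s)
  have hS : ‖S‖ ≤ N * (2 * b) ^ 2 := (norm_sum_mul_swap_le ℓ _).trans (by gcongr)
  set q := (Matrix.diagonal (blockWeight ℓ) * (projMatrixC a * R)).trace
  set q' := (Matrix.diagonal (offWeight ℓ) * (projMatrixC a * R)).trace
  set T := projNoiseTrace (blockWeight ℓ) z a x
  set T' := projNoiseTrace (offWeight ℓ) z a x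
  have h1' : ‖T - q‖ ≤ d * b := h1.trans (by gcongr)
  have h2' : ‖T' - q'‖ ≤ d * b := h2.trans (by gcongr)
  have e : T * T' - (S + q * q') = (T - q) * T' + (T - (T - q)) * (T' - q') - S := by ring
  rw [e]
  have h5 : ‖T - (T - q)‖ ≤ N * b + d * b := (norm_sub_le _ _).trans (add_le_add h3 h1')
  calc _ ≤ ‖(T - q) * T'‖ + ‖(T - (T - q)) * (T' - q')‖ + ‖S‖ :=
        (norm_sub_le _ _).trans (add_le_add_left (norm_add_le _ _) _)
    _ ≤ (d * b) * (N * b) + (N * b + d * b) * (d * b) + N * (2 * b) ^ 2 := by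
        rw [norm_mul, norm_mul]
        gcongr
    _ ≤ _ := by
        have hb2 : 0 ≤ b ^ 2 := sq_nonneg b
        have i1 : d * N * b ^ 2 ≤ d ^ 2 * N * b ^ 2 := by
          have : (d : ℝ) ≤ d ^ 2 := by nlinarith
          gcongr
        have i2 : (d : ℝ) ^ 2 * b ^ 2 ≤ N * (d ^ 2 * b ^ 2) :=
          le_mul_of_one_le_left (by positivity) hN1
        nlinarith

theorem continuous_pairTerm (a : Vectors n) (ℓ : Fin d) {z : ℂ} (hz : z.im ≠ 0) :
    Continuous fun x => pairTerm a ℓ (resolventMatrix (projNoiseMatrix a x) z) := by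
  have h := (contDiff_resolventMatrix (fun x => projNoiseMatrix_isHermitian a x) hz).continuous
  have hQ : Continuous fun x => projMatrixC a * resolventMatrix (projNoiseMatrix a x) z :=
    continuous_const.mul h
  have he : ∀ s t, Continuous fun x =>
      (projMatrixC a * resolventMatrix (projNoiseMatrix a x) z) s t := fun s t =>
    hQ.matrix_elem s t
  unfold pairTerm
  refine continuous_finsetSum _ fun s _ => continuous_finsetSum _ fun t _ => ?_
  split_ifs
  · exact continuous_const
  · exact continuous_const.mul (((he s t).mul (he t s)).add ((he s s).mul (he t t)))

theorem trace_diagonal_blockWeight (ℓ : Fin d) :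
    (Matrix.diagonal (blockWeight (n := n) ℓ)).trace = n ℓ := by
  rw [Matrix.trace_diagonal, Fintype.sum_sigma, Finset.sum_eq_single ℓ]
  · simp [blockWeight]
  · intro m _ hm; simp [blockWeight, hm]
  · simp

/-- The trace of `A R = 1 + z R` over the block `ℓ` gives the left side, and Gaussian integration by
parts gives the right side. -/
theorem integral_projNoiseTrace_eq {a : Vectors n} (ha : ∀ k, ‖a k‖ = 1) (ℓ : Fin d) {z : ℂ}
    (hz : z.im ≠ 0) :
    n ℓ + z * ∫ x, projNoiseTrace (blockWeight ℓ) z a x ∂(stdGaussian (TensorSpace n)) =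
      -((totalDim n : ℂ)⁻¹ * ∫ x, pairTerm a ℓ (resolventMatrix (projNoiseMatrix a x) z)
        ∂(stdGaussian (TensorSpace n))) := by
  have h := integral_trace_mul_resolvent (fun x => projNoiseMatrix_isHermitian a x) hz
    (Matrix.diagonal (blockWeight ℓ))
  have h1 : ∀ x, (Matrix.diagonal (blockWeight ℓ) * (complexFamily (projNoiseMatrix a) x *
      resolventMatrix (projNoiseMatrix a x) z)).trace =
      n ℓ + z * projNoiseTrace (blockWeight ℓ) z a x := by
    intro x
    have h2 := mul_resolventMatrix (projNoiseMatrix_isHermitian a x) hz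
    rw [sub_mul, smul_mul_assoc, one_mul, sub_eq_iff_eq_add] at h2
    rw [complexFamily_apply, h2, mul_add, mul_one, Matrix.trace_add, trace_diagonal_blockWeight,
      mul_smul_comm, Matrix.trace_smul, smul_eq_mul]
    rfl
  simp only [h1] at h
  rw [integral_add (integrable_const _)
    ((integrable_projNoiseTrace (norm_blockWeight_le ℓ) hz a).const_mul _),
    integral_const_mul, integral_const, probReal_univ, one_smul] at h
  rw [h, ← integral_const_mul]
  congr 2
  ext x
  exact integral_trace_diagonal_mul_four ha (blockWeight ℓ)
    (transpose_resolventMatrix (projNoiseMatrix_isHermitian a x) z)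

/-- The error constant in the equation for the expected block traces. -/
noncomputable def meanErrorConst (d : ℕ) (z : ℂ) : ℝ :=
  ‖z‖ * (4 * d * |z.im|⁻¹) + |z.im|⁻¹ * (4 * Real.exp (Real.pi ^ 2 / 8) * traceLipschitz d z) +
    (8 * d + 4 + 3 * d ^ 2) * |z.im|⁻¹ ^ 2

/-- The expected block traces satisfy the limiting equation up to a bounded error. -/
theorem norm_meanEquation_le (hd : 0 < d) (hN : 0 < totalDim n) {a : Vectors n}
    (ha : ∀ k, ‖a k‖ = 1) (ℓ : Fin d) {z : ℂ} (hz : z.im ≠ 0) :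
    ‖n ℓ + z * ∫ x, noiseTrace (blockWeight ℓ) z a x ∂(stdGaussian (TensorSpace n)) +
      (totalDim n : ℂ)⁻¹ * ((∫ x, noiseTrace (blockWeight ℓ) z a x ∂(stdGaussian (TensorSpace n))) *
        ∫ x, noiseTrace (offWeight ℓ) z a x ∂(stdGaussian (TensorSpace n)))‖ ≤
      meanErrorConst d z := by
  set γ := stdGaussian (TensorSpace n)
  set b := |z.im|⁻¹ with hb
  have hb0 : 0 ≤ b := by positivity
  have hN0 : (0 : ℝ) < totalDim n := by exact_mod_cast hN
  set T := noiseTrace (n := n) (blockWeight ℓ) z a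
  set T' := noiseTrace (n := n) (offWeight ℓ) z a
  set P := projNoiseTrace (n := n) (blockWeight ℓ) z a
  set P' := projNoiseTrace (n := n) (offWeight ℓ) z a
  let X : TensorSpace n → ℂ := fun x => pairTerm a ℓ (resolventMatrix (projNoiseMatrix a x) z)
  have iT : Integrable T γ := integrable_noiseTrace (norm_blockWeight_le ℓ) hz a
  have iT' : Integrable T' γ := integrable_noiseTrace (norm_offWeight_le ℓ) hz a
  have iP : Integrable P γ := integrable_projNoiseTrace (norm_blockWeight_le ℓ) hz a
  have bT := norm_noiseTrace_le (norm_blockWeight_le ℓ) hz a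
  have bT' := norm_noiseTrace_le (norm_offWeight_le ℓ) hz a
  have bP := norm_projNoiseTrace_le (norm_blockWeight_le ℓ) hz a
  have cT : Continuous T := (contDiff_noiseTrace _ hz a).continuous
  have cT' : Continuous T' := (contDiff_noiseTrace _ hz a).continuous
  have iTT : Integrable (fun x => T x * T' x) γ := by
    refine Integrable.of_bound (cT.mul cT').aestronglyMeasurable
      ((totalDim n * b) * (totalDim n * b)) (ae_of_all _ fun x => ?_)
    rw [norm_mul]
    exact mul_le_mul (bT x) (bT' x) (norm_nonneg _) (by positivity)
  have hXd : ∀ x, ‖T x * T' x - X x‖ ≤ totalDim n * ((8 * d + 4 + 3 * d ^ 2) * b ^ 2) := by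
    intro x
    have h1 := norm_pairTerm_sub_le hd hN ha ℓ hz x
    have h2 := norm_noiseTrace_sub_projNoiseTrace_le (norm_blockWeight_le ℓ) hz a x
    have h3 := norm_noiseTrace_sub_projNoiseTrace_le (norm_offWeight_le ℓ) hz a x
    have e : T x * T' x - X x = (T x - P x) * T' x + P x * (T' x - P' x) +
      (P x * P' x - X x) := by ring
    rw [e]
    calc _ ≤ ‖(T x - P x) * T' x‖ + ‖P x * (T' x - P' x)‖ + ‖P x * P' x - X x‖ := norm_add₃_le
      _ ≤ (4 * d * b) * (totalDim n * b) + (totalDim n * b) * (4 * d * b) +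
          totalDim n * ((4 + 3 * d ^ 2) * b ^ 2) := by
          rw [norm_mul, norm_mul]
          gcongr
          exacts [bT' x, bP x]
      _ = _ := by ring
  -- Integrability of `X` follows from that of the product of traces, since their difference is
  -- continuous and bounded.
  have iX : Integrable X γ := by
    have hc : Continuous X := continuous_pairTerm a ℓ hz
    have i1 : Integrable (fun x => T x * T' x - X x) γ :=
      Integrable.of_bound ((cT.mul cT').sub hc).aestronglyMeasurable _ (ae_of_all _ hXd)
    have i2 := iTT.sub i1
    refine i2.congr (ae_of_all _ fun x => ?_)
    simp
  have hmain := integral_projNoiseTrace_eq ha ℓ hz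
  -- The exact identity for the compressed noise leaves three errors: the compression in the linear
  -- term, the covariance of the two traces, and the negligible part of the pair term.
  have e : (n ℓ : ℂ) + z * ∫ x, T x ∂γ + (totalDim n : ℂ)⁻¹ * ((∫ x, T x ∂γ) * ∫ x, T' x ∂γ) =
      z * ∫ x, (T x - P x) ∂γ -
      (totalDim n : ℂ)⁻¹ * ∫ x, (T x - ∫ y, T y ∂γ) * T' x ∂γ +
      (totalDim n : ℂ)⁻¹ * ∫ x, (T x * T' x - X x) ∂γ := by
    have e1 : ∫ x, (T x - ∫ y, T y ∂γ) * T' x ∂γ =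
        ∫ x, T x * T' x ∂γ - (∫ x, T x ∂γ) * ∫ x, T' x ∂γ := by
      simp only [sub_mul]
      rw [integral_sub iTT (iT'.const_mul _), integral_const_mul]
    rw [e1, integral_sub iT iP, integral_sub iTT iX]
    linear_combination hmain
  rw [e]
  have b1 : ‖∫ x, (T x - P x) ∂γ‖ ≤ 4 * d * b := by
    have := norm_integral_le_of_norm_le_const (μ := γ) (ae_of_all _ fun x =>
      norm_noiseTrace_sub_projNoiseTrace_le (norm_blockWeight_le ℓ) hz a x)
    simpa using this
  have b2 : ‖∫ x, (T x * T' x - X x) ∂γ‖ ≤ totalDim n * ((8 * d + 4 + 3 * d ^ 2) * b ^ 2) := by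
    have := norm_integral_le_of_norm_le_const (μ := γ) (ae_of_all _ hXd)
    simpa using this
  -- One trace fluctuates by `O(1)` in mean and the other is at most of order `N`, so their
  -- covariance is `O(N)`. This suffices, since it is divided by `N`.
  have b3 : ‖∫ x, (T x - ∫ y, T y ∂γ) * T' x ∂γ‖ ≤
      (4 * Real.exp (Real.pi ^ 2 / 8) * traceLipschitz d z) * (totalDim n * b) := by
    refine (norm_integral_le_integral_norm _).trans ?_
    have h1 := integral_norm_noiseTrace_sub_le hd hN (norm_blockWeight_le ℓ) hz ha
    refine le_trans ?_ (mul_le_mul_of_nonneg_right h1 (by positivity : 0 ≤ totalDim n * b))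
    rw [← integral_mul_const]
    have i0 : Integrable (fun x => T x - ∫ y, T y ∂γ) γ := iT.sub (integrable_const _)
    refine integral_mono_of_nonneg (ae_of_all _ fun x => norm_nonneg _) (i0.norm.mul_const _)
      (ae_of_all _ fun x => ?_)
    simp only [norm_mul]
    exact mul_le_mul_of_nonneg_left (bT' x) (norm_nonneg _)
  calc _ ≤ ‖z * ∫ x, (T x - P x) ∂γ‖ + ‖(totalDim n : ℂ)⁻¹ * ∫ x, (T x - ∫ y, T y ∂γ) * T' x ∂γ‖ +
        ‖(totalDim n : ℂ)⁻¹ * ∫ x, (T x * T' x - X x) ∂γ‖ :=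
        (norm_add_le _ _).trans (add_le_add_left (norm_sub_le _ _) _)
    _ ≤ ‖z‖ * (4 * d * b) + (totalDim n : ℝ)⁻¹ *
        ((4 * Real.exp (Real.pi ^ 2 / 8) * traceLipschitz d z) * (totalDim n * b)) +
        (totalDim n : ℝ)⁻¹ * (totalDim n * ((8 * d + 4 + 3 * d ^ 2) * b ^ 2)) := by
        rw [norm_mul, norm_mul, norm_mul, norm_inv, Complex.norm_natCast]
        gcongr
    _ = _ := by
        rw [meanErrorConst, ← hb]
        have hN1 : (totalDim n : ℝ)⁻¹ * totalDim n = 1 := inv_mul_cancel₀ hN0.ne'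
        linear_combination ((4 * Real.exp (Real.pi ^ 2 / 8) * traceLipschitz d z) * b +
          (8 * d + 4 + 3 * d ^ 2) * b ^ 2) * hN1

end MeanEquation

/-! ### Uniform concentration over all families of unit vectors. -/

section Uniform

variable {d : ℕ} {n : Fin d → ℕ}

/-- Round `M` times every coordinate to an integer in `[-M, M]`, and keep one family of unit vectors
from each occupied cell. Families in the same cell differ by less than `1 / M` in every coordinate,
and the points of the net are themselves unit vectors. -/
theorem exists_net_unit_vectors (n : Fin d → ℕ) {M : ℕ} (hM : 0 < M) :
    ∃ R : Finset (Vectors n), (∀ b ∈ R, ∀ k, ‖b k‖ = 1) ∧ R.card ≤ (2 * M + 1) ^ totalDim n ∧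
      ∀ a : Vectors n, (∀ k, ‖a k‖ = 1) → ∃ b ∈ R, ∀ k j,
        |coords a k j - coords b k j| ≤ (M : ℝ)⁻¹ := by
  classical
  have hM' : (0 : ℝ) < M := by exact_mod_cast hM
  let key : Vectors n → BlockIndex n → ℤ := fun a s => ⌊(M : ℝ) * coords a s.1 s.2⌋
  let G : Finset (BlockIndex n → ℤ) := Fintype.piFinset fun _ => Finset.Icc (-(M : ℤ)) M
  have hkey : ∀ a : Vectors n, (∀ k, ‖a k‖ = 1) → key a ∈ G := by
    intro a ha
    rw [Fintype.mem_piFinset]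
    intro s
    have h := abs_le.1 (abs_coords_le_one ha s.1 s.2)
    rw [Finset.mem_Icc]
    constructor
    · rw [Int.le_floor]; push_cast; nlinarith
    · have : (⌊(M : ℝ) * coords a s.1 s.2⌋ : ℝ) ≤ M := (Int.floor_le _).trans (by nlinarith)
      exact_mod_cast this
  -- The default value is never used, because the net only takes representatives of occupied cells.
  let rep : (BlockIndex n → ℤ) → Vectors n := fun g =>
    if h : ∃ a : Vectors n, (∀ k, ‖a k‖ = 1) ∧ key a = g then h.choose else 0
  refine ⟨(G.filter fun g => ∃ a : Vectors n, (∀ k, ‖a k‖ = 1) ∧ key a = g).image rep, ?_, ?_, ?_⟩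
  · intro b hb
    obtain ⟨g, hg, rfl⟩ := Finset.mem_image.1 hb
    have h := (Finset.mem_filter.1 hg).2
    simp only [rep, dif_pos h]
    exact h.choose_spec.1
  · refine Finset.card_image_le.trans ((Finset.card_filter_le _ _).trans (le_of_eq ?_))
    simp only [G]
    rw [Fintype.card_piFinset, Finset.prod_const, Finset.card_univ, Int.card_Icc, card_blockIndex]
    congr 1
    omega
  · intro a ha
    have h : ∃ a' : Vectors n, (∀ k, ‖a' k‖ = 1) ∧ key a' = key a := ⟨a, ha, rfl⟩
    refine ⟨rep (key a), Finset.mem_image.2 ⟨key a, Finset.mem_filter.2 ⟨hkey a ha, h⟩, rfl⟩, ?_⟩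
    simp only [rep, dif_pos h]
    intro k j
    have h1 := congrFun h.choose_spec.2 ⟨k, j⟩
    have h2 := Int.abs_sub_lt_one_of_floor_eq_floor h1
    dsimp only at h2
    rw [← mul_sub, abs_mul, abs_of_pos hM', abs_sub_comm] at h2
    rw [← one_div, le_div_iff₀ hM', mul_comm]
    exact h2.le

/-- There are `N ^ 2` entries, each changing by at most `N ^ (-1/2)` times `d ε ∑ |x p|`, so the
Hilbert-Schmidt distance gains a factor `√N`. The trace perturbation bound contributes another `√N`.
-/
theorem norm_noiseTrace_sub_le_of_close {w : BlockIndex n → ℂ}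
    (hw : ∀ s, ‖w s‖ ≤ 1) {z : ℂ} (hz : z.im ≠ 0) {a b : Vectors n} (ha : ∀ k, ‖a k‖ = 1)
    (hb : ∀ k, ‖b k‖ = 1) {ε : ℝ} (hε0 : 0 ≤ ε) (hε : ∀ k j, |coords a k j - coords b k j| ≤ ε)
    (x : TensorSpace n) :
    ‖noiseTrace w z a x - noiseTrace w z b x‖ ≤
      totalDim n * (d * |z.im|⁻¹ ^ 2 * ε * ∑ p, |x p|) := by
  rcases Nat.eq_zero_or_pos (totalDim n) with h0 | hN
  · have h1 := norm_noiseTrace_le hw hz a x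
    have h2 := norm_noiseTrace_le hw hz b x
    rw [h0, Nat.cast_zero, zero_mul] at h1 h2 ⊢
    exact (norm_sub_le _ _).trans (by linarith)
  have hN' : (0 : ℝ) < totalDim n := by exact_mod_cast hN
  have h := norm_trace_diagonal_resolvent_sub_le (noiseMatrix_isHermitian a x)
    (noiseMatrix_isHermitian b x) hz hw
  refine h.trans ?_
  set S := ∑ p, |x p| with hS
  have hS0 : 0 ≤ S := Finset.sum_nonneg fun _ _ => abs_nonneg _
  have h1 : ∀ i j, (noiseMatrix a x i j - noiseMatrix b x i j) ^ 2 ≤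
      (totalDim n : ℝ)⁻¹ * (d * ε * S) ^ 2 := by
    intro i j
    rw [← sq_abs, noiseMatrix_eq, noiseMatrix_eq]
    have h2 := abs_blockMatrix_sub_le ((Real.sqrt (totalDim n))⁻¹ • x.ofLp) ha hb hε i j hε0
    have h3 : ∑ p, |((Real.sqrt (totalDim n))⁻¹ • x.ofLp) p| = (Real.sqrt (totalDim n))⁻¹ * S := by
      rw [hS, Finset.mul_sum]
      refine Finset.sum_congr rfl fun p _ => ?_
      rw [Pi.smul_apply, smul_eq_mul, abs_mul, abs_of_nonneg (by positivity)]
    rw [h3] at h2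
    refine (pow_le_pow_left₀ (abs_nonneg _) h2 2).trans (le_of_eq ?_)
    have h4 : (Real.sqrt (totalDim n))⁻¹ ^ 2 = (totalDim n : ℝ)⁻¹ := by
      rw [inv_pow, Real.sq_sqrt hN'.le]
    rw [← h4]; ring
  have h2 : ∑ i, ∑ j, (noiseMatrix a x i j - noiseMatrix b x i j) ^ 2 ≤
      totalDim n * (d * ε * S) ^ 2 := by
    calc _ ≤ ∑ _i : BlockIndex n, ∑ _j : BlockIndex n, (totalDim n : ℝ)⁻¹ * (d * ε * S) ^ 2 :=
          Finset.sum_le_sum fun i _ => Finset.sum_le_sum fun j _ => h1 i j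
      _ = _ := by
          simp only [Finset.sum_const, Finset.card_univ, nsmul_eq_mul, card_blockIndex]
          field_simp
  rw [card_blockIndex]
  calc _ ≤ √(totalDim n) * |z.im|⁻¹ ^ 2 * √(totalDim n * (d * ε * S) ^ 2) := by gcongr
    _ = _ := by
        rw [Real.sqrt_mul hN'.le, Real.sqrt_sq (by positivity)]
        have := Real.mul_self_sqrt hN'.le
        linear_combination (|z.im|⁻¹ ^ 2 * (d * ε * S)) * this

theorem integrable_abs_coord (p : (ℓ : Fin d) → Fin (n ℓ)) :
    Integrable (fun x : TensorSpace n => |x p|) (stdGaussian (TensorSpace n)) := by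
  have := IsGaussian.memLp_dual (stdGaussian (TensorSpace n))
    (EuclideanSpace.proj p : TensorSpace n →L[ℝ] ℝ) 1 (by simp)
  exact (memLp_one_iff_integrable.1 this).abs

/-- Each coordinate has second moment one, so its absolute value has mean at most one, and there are
at most `N ^ d` coordinates. -/
theorem integral_sum_abs_le :
    ∫ x : TensorSpace n, ∑ p, |x p| ∂(stdGaussian (TensorSpace n)) ≤ (totalDim n : ℝ) ^ d := by
  rw [integral_finsetSum _ fun p _ => integrable_abs_coord p]
  have h : ∀ p : (ℓ : Fin d) → Fin (n ℓ),
      ∫ x : TensorSpace n, |x p| ∂(stdGaussian (TensorSpace n)) ≤ 1 := by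
    intro p
    have h2 := integral_inner_mul_inner_stdGaussian
      (EuclideanSpace.single p 1 : TensorSpace n) (EuclideanSpace.single p 1)
    simp only [EuclideanSpace.inner_single_left, map_one, one_mul, PiLp.single_apply,
      if_true] at h2
    have hi2 : Integrable (fun x : TensorSpace n => x p * x p) (stdGaussian (TensorSpace n)) := by
      have := IsGaussian.memLp_dual (stdGaussian (TensorSpace n))
        (EuclideanSpace.proj p : TensorSpace n →L[ℝ] ℝ) 2 (by simp)
      exact this.integrable_mul this
    have h3 : ∫ x : TensorSpace n, |x p| ∂(stdGaussian (TensorSpace n)) ≤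
        ∫ x : TensorSpace n, (1 / 2 + 1 / 2 * (x p * x p)) ∂(stdGaussian (TensorSpace n)) := by
      refine integral_mono (integrable_abs_coord p)
        ((integrable_const _).add (hi2.const_mul _)) fun x => ?_
      dsimp only
      nlinarith [sq_nonneg (|x p| - 1), sq_abs (x p)]
    rw [integral_add (integrable_const _) (hi2.const_mul _), integral_const_mul, h2] at h3
    simp at h3
    linarith
  calc _ ≤ ∑ _p : ((ℓ : Fin d) → Fin (n ℓ)), (1 : ℝ) := Finset.sum_le_sum fun p _ => h p
    _ = ((∏ ℓ, n ℓ : ℕ) : ℝ) := by simp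
    _ ≤ _ := by
        rw [← Nat.cast_pow, Nat.cast_le]
        calc ∏ ℓ, n ℓ ≤ ∏ _ℓ : Fin d, totalDim n :=
              Finset.prod_le_prod' fun ℓ _ =>
                Finset.single_le_sum (f := n) (fun _ _ => Nat.zero_le _) (Finset.mem_univ ℓ)
          _ = _ := by simp

/-- The event that some block trace of some noise matrix is far from its expectation. -/
def deviationSet (n : Fin d → ℕ) (z : ℂ) (t : ℝ) : Set (TensorSpace n) :=
  {x | ∃ a : Vectors n, (∀ k, ‖a k‖ = 1) ∧ ∃ m : Fin d, totalDim n * t <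
    ‖noiseTrace (blockWeight m) z a x -
      ∫ y, noiseTrace (blockWeight m) z a y ∂(stdGaussian (TensorSpace n))‖}

theorem measureReal_norm_noiseTrace_sub_ge_le (hd : 0 < d) (hN : 0 < totalDim n)
    {w : BlockIndex n → ℂ} (hw : ∀ s, ‖w s‖ ≤ 1) {z : ℂ} (hz : z.im ≠ 0) {a : Vectors n}
    (ha : ∀ k, ‖a k‖ = 1) {t : ℝ} (ht : 0 ≤ t) :
    (stdGaussian (TensorSpace n)).real {x | 2 * t ≤ ‖noiseTrace w z a x -
      ∫ y, noiseTrace w z a y ∂(stdGaussian (TensorSpace n))‖} ≤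
      4 * Real.exp (-(t ^ 2 / (5 * traceLipschitz d z ^ 2))) := by
  have h1 := measureReal_abs_sub_integral_ge_le (traceLipschitz_pos hd hz)
    (lipschitzWith_re_noiseTrace hN hw hz ha) (differentiable_re_noiseTrace w hz a)
    (B := totalDim n * |z.im|⁻¹) (fun x => (Complex.abs_re_le_norm _).trans
      (norm_noiseTrace_le hw hz a x)) ht
  have h2 := measureReal_abs_sub_integral_ge_le (traceLipschitz_pos hd hz)
    (lipschitzWith_im_noiseTrace hN hw hz ha) (differentiable_im_noiseTrace w hz a)
    (B := totalDim n * |z.im|⁻¹) (fun x => (Complex.abs_im_le_norm _).trans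
      (norm_noiseTrace_le hw hz a x)) ht
  rw [re_integral_noiseTrace hw hz] at h1
  rw [im_integral_noiseTrace hw hz] at h2
  set m := ∫ y, noiseTrace w z a y ∂(stdGaussian (TensorSpace n))
  refine (measureReal_mono (s₂ := {x | t ≤ |(noiseTrace w z a x).re - m.re|} ∪
    {x | t ≤ |(noiseTrace w z a x).im - m.im|}) ?_).trans
    ((measureReal_union_le _ _).trans (by linarith))
  intro x hx
  simp only [Set.mem_ofPred_eq, Set.mem_union] at hx ⊢
  by_contra hc
  push Not at hc
  have := Complex.norm_le_abs_re_add_abs_im (noiseTrace w z a x - m)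
  simp only [Complex.sub_re, Complex.sub_im] at this
  linarith [hc.1, hc.2]

/-- Unless `∑ |x p|` is huge, which Markov's inequality controls, a deviation above `N t` at some
`a` forces one of at least `N t / 2` at the nearest point of the net. The trace and its mean each
move by at most `N t / 4`. The second term of the bound is the union bound over the net and the `d`
blocks. -/
theorem measureReal_deviationSet_le (hd : 0 < d) (hN : 0 < totalDim n) {z : ℂ} (hz : z.im ≠ 0)
    {t : ℝ} (ht : 0 < t) {M : ℕ} (hM : 0 < M)
    (hMt : d * |z.im|⁻¹ ^ 2 * (M : ℝ)⁻¹ * (totalDim n : ℝ) ^ d ≤ t / 4) :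
    (stdGaussian (TensorSpace n)).real (deviationSet n z t) ≤
      (totalDim n : ℝ) ^ d * (4 * d * |z.im|⁻¹ ^ 2) / (t * M) +
      (2 * M + 1 : ℝ) ^ totalDim n * (d * (4 *
        Real.exp (-((totalDim n * t / 4) ^ 2 / (5 * traceLipschitz d z ^ 2))))) := by
  set γ := stdGaussian (TensorSpace n) with hγ
  set N : ℝ := (totalDim n : ℝ) with hNdef
  have hN0 : 0 < N := by rw [hNdef]; exact_mod_cast hN
  have hd0 : (0 : ℝ) < d := by exact_mod_cast hd
  have hM0 : (0 : ℝ) < M := by exact_mod_cast hM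
  have hη : 0 < |z.im|⁻¹ := inv_pos.2 (abs_pos.2 hz)
  set L : ℝ := d * |z.im|⁻¹ ^ 2 * (M : ℝ)⁻¹ with hL
  have hL0 : 0 < L := by positivity
  obtain ⟨R, hR1, hR2, hR3⟩ := exists_net_unit_vectors n hM
  let S : TensorSpace n → ℝ := fun x => ∑ p, |x p|
  have hSi : Integrable S γ := integrable_finsetSum _ fun p _ => integrable_abs_coord p
  have hS0 : ∀ x, 0 ≤ S x := fun x => Finset.sum_nonneg fun _ _ => abs_nonneg _
  let Z : Vectors n → Fin d → Set (TensorSpace n) := fun b m =>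
    {x | 2 * (N * t / 4) ≤ ‖noiseTrace (blockWeight m) z b x -
      ∫ y, noiseTrace (blockWeight m) z b y ∂γ‖}
  have hsub : deviationSet n z t ⊆ {x | t / (4 * L) ≤ S x} ∪ ⋃ b ∈ R, ⋃ m : Fin d, Z b m := by
    intro x hx
    obtain ⟨a, ha, m, hm⟩ := hx
    by_contra hc
    simp only [Set.mem_union, Set.mem_ofPred_eq, Set.mem_iUnion, not_or, not_exists, not_le] at hc
    obtain ⟨hc1, hc2⟩ := hc
    obtain ⟨b, hbR, hb⟩ := hR3 a ha
    have hc3 : ‖noiseTrace (blockWeight m) z b x -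
      ∫ y, noiseTrace (blockWeight m) z b y ∂γ‖ < 2 * (N * t / 4) := by
      have := hc2 b hbR m
      simpa [Z] using this
    have hclose := norm_noiseTrace_sub_le_of_close (norm_blockWeight_le m) hz ha (hR1 b hbR)
      (by positivity) hb
    have h1 : ‖noiseTrace (blockWeight m) z a x - noiseTrace (blockWeight m) z b x‖ ≤ N * (t / 4) := by
      refine (hclose x).trans ?_
      gcongr
      have : L * S x ≤ L * (t / (4 * L)) := by gcongr
      refine this.trans (le_of_eq ?_)
      field_simp
    have h2 : ‖∫ y, noiseTrace (blockWeight m) z a y ∂γ - ∫ y, noiseTrace (blockWeight m) z b y ∂γ‖ ≤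
        N * (t / 4) := by
      rw [← integral_sub (integrable_noiseTrace (norm_blockWeight_le m) hz a)
        (integrable_noiseTrace (norm_blockWeight_le m) hz b)]
      refine (norm_integral_le_of_norm_le ((hSi.const_mul L).const_mul N)
        (ae_of_all _ hclose)).trans ?_
      rw [integral_const_mul, integral_const_mul]
      have := integral_sum_abs_le (n := n)
      have h5 : L * ∫ x, S x ∂γ ≤ L * N ^ d := by gcongr
      have h6 : L * N ^ d ≤ t / 4 := hMt
      gcongr
      linarith
    have h3 : noiseTrace (blockWeight m) z a x - ∫ y, noiseTrace (blockWeight m) z a y ∂γ =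
        (noiseTrace (blockWeight m) z a x - noiseTrace (blockWeight m) z b x) +
        (noiseTrace (blockWeight m) z b x - ∫ y, noiseTrace (blockWeight m) z b y ∂γ) -
        (∫ y, noiseTrace (blockWeight m) z a y ∂γ - ∫ y, noiseTrace (blockWeight m) z b y ∂γ) := by
      ring
    have h4 := (norm_sub_le (noiseTrace (blockWeight m) z a x - noiseTrace (blockWeight m) z b x +
        (noiseTrace (blockWeight m) z b x - ∫ y, noiseTrace (blockWeight m) z b y ∂γ))
        (∫ y, noiseTrace (blockWeight m) z a y ∂γ - ∫ y, noiseTrace (blockWeight m) z b y ∂γ)).trans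
        (add_le_add_left (norm_add_le _ _) _)
    rw [← h3] at h4
    linarith
  have hmk : γ.real {x | t / (4 * L) ≤ S x} ≤ N ^ d * (4 * d * |z.im|⁻¹ ^ 2) / (t * M) := by
    have h1 := mul_meas_ge_le_integral_of_nonneg (ae_of_all _ hS0) hSi (t / (4 * L))
    have h2 : t / (4 * L) * γ.real {x | t / (4 * L) ≤ S x} ≤ N ^ d := h1.trans integral_sum_abs_le
    have h3 : 0 < t / (4 * L) := by positivity
    calc γ.real {x | t / (4 * L) ≤ S x} =
          (t / (4 * L) * γ.real {x | t / (4 * L) ≤ S x}) / (t / (4 * L)) := by field_simp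
      _ ≤ N ^ d / (t / (4 * L)) := by gcongr
      _ = _ := by rw [hL]; field_simp
  have hZ : ∀ b ∈ R, γ.real (⋃ m : Fin d, Z b m) ≤ d * (4 *
        Real.exp (-((N * t / 4) ^ 2 / (5 * traceLipschitz d z ^ 2)))) := by
    intro b hb
    refine (measureReal_iUnion_fintype_le _).trans ?_
    calc _ ≤ ∑ _m : Fin d, (4 *
        Real.exp (-((N * t / 4) ^ 2 / (5 * traceLipschitz d z ^ 2)))) :=
          Finset.sum_le_sum fun m _ => measureReal_norm_noiseTrace_sub_ge_le hd hN
            (norm_blockWeight_le m) hz (hR1 b hb) (by positivity)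
      _ = _ := by simp
  refine (measureReal_mono hsub).trans ((measureReal_union_le _ _).trans (add_le_add hmk ?_))
  refine (measureReal_biUnion_finset_le _ _).trans ((Finset.sum_le_sum hZ).trans ?_)
  rw [Finset.sum_const, nsmul_eq_mul]
  refine mul_le_mul_of_nonneg_right ?_ (by positivity)
  exact_mod_cast hR2

/-- The bound for the probability of a deviation for some size with total dimension `N`. -/
noncomputable def deviationBound (d : ℕ) (z : ℂ) (t : ℝ) (N : ℕ) : ℝ :=
  (N + 1 : ℝ) ^ d * ((N : ℝ) ^ d * (4 * d * |z.im|⁻¹ ^ 2) / (t * ((N + 1) ^ (2 * d + 2) : ℕ)) +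
      (2 * ((N + 1) ^ (2 * d + 2) : ℕ) + 1 : ℝ) ^ N * (d * (4 *
        Real.exp (-((N * t / 4) ^ 2 / (5 * traceLipschitz d z ^ 2))))))

/-- The number of net points is `exp (O(N log N))`, which the Gaussian factor `exp (-κ N ^ 2)`
absorbs. -/
theorem summable_pow_mul_exp_neg_sq (d : ℕ) {κ : ℝ} (hκ : 0 < κ) :
    Summable fun N : ℕ => (N + 1 : ℝ) ^ d * ((2 * ((N + 1) ^ (2 * d + 2) : ℕ) + 1 : ℝ) ^ N *
      Real.exp (-(κ * N ^ 2))) := by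
  -- The constant makes the entropy `(3 d + 4) N log (N + 1)` at most half of `κ N ^ 2`.
  have hlog : ∀ᶠ N : ℕ in atTop, Real.log (N + 1) ≤ κ / (2 * (3 * d + 4)) * N := by
    have h1 : Tendsto (fun N : ℕ => (N : ℝ) + 1) atTop atTop :=
      tendsto_atTop_add_const_right _ _ tendsto_natCast_atTop_atTop
    have h2 := (Real.isLittleO_log_id_atTop.comp_tendsto h1).def
      (by positivity : 0 < κ / (2 * (3 * d + 4)) / 2)
    filter_upwards [h2, eventually_ge_atTop 1] with N hN hN1
    simp only [Function.comp, id, Real.norm_eq_abs] at hN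
    have hN1' : (1 : ℝ) ≤ N := by exact_mod_cast hN1
    rw [abs_of_nonneg (by positivity : (0 : ℝ) ≤ N + 1)] at hN
    refine (le_abs_self _).trans (hN.trans ?_)
    have hc : 0 < κ / (2 * (3 * d + 4)) := by positivity
    nlinarith
  have hg : Summable fun N : ℕ => Real.exp (-(κ / 2) * N) := by
    have := (summable_geometric_of_lt_one (Real.exp_pos (-(κ / 2))).le
      (Real.exp_lt_one_iff.2 (by linarith)))
    refine this.congr fun N => ?_
    rw [← Real.exp_nat_mul, mul_comm]
  refine Summable.of_norm_bounded_eventually_nat hg ?_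
  filter_upwards [hlog, eventually_ge_atTop 1] with N hN hN1
  have hN1' : (1 : ℝ) ≤ N := by exact_mod_cast hN1
  rw [Real.norm_eq_abs, abs_of_nonneg (by positivity)]
  have hb : (2 * ((N + 1) ^ (2 * d + 2) : ℕ) + 1 : ℝ) ≤ (N + 1 : ℝ) ^ (2 * d + 4) := by
    push_cast
    have h1 : (1 : ℝ) ≤ (N + 1 : ℝ) ^ (2 * d + 2) := one_le_pow₀ (by linarith)
    have h2 : (N + 1 : ℝ) ^ (2 * d + 4) = (N + 1 : ℝ) ^ 2 * (N + 1 : ℝ) ^ (2 * d + 2) := by ring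
    rw [h2]
    have h3 : (4 : ℝ) ≤ (N + 1) ^ 2 := by nlinarith
    nlinarith
  have e1 : (N + 1 : ℝ) ^ d * ((N + 1 : ℝ) ^ (2 * d + 4)) ^ N =
      Real.exp ((d + (2 * d + 4) * N) * Real.log (N + 1)) := by
    rw [← pow_mul, ← pow_add, ← Real.exp_log (by positivity : (0 : ℝ) < (N + 1 : ℝ) ^ (d + (2 * d + 4) * N)),
      Real.log_pow]
    push_cast; rfl
  calc _ ≤ (N + 1 : ℝ) ^ d * (((N + 1 : ℝ) ^ (2 * d + 4)) ^ N * Real.exp (-(κ * N ^ 2))) := by gcongr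
    _ = Real.exp ((d + (2 * d + 4) * N) * Real.log (N + 1) + -(κ * N ^ 2)) := by
        rw [← mul_assoc, e1, Real.exp_add]
    _ ≤ _ := by
        refine Real.exp_le_exp.2 ?_
        have h1 : (d + (2 * d + 4) * N : ℝ) ≤ (3 * d + 4) * N := by
          have : (d : ℝ) ≤ d * N := le_mul_of_one_le_right (Nat.cast_nonneg _) hN1'
          linarith
        have hl0 : 0 ≤ Real.log (N + 1) := Real.log_nonneg (by linarith)
        have h2 : (d + (2 * d + 4) * N : ℝ) * Real.log (N + 1) ≤
            ((3 * d + 4) * N) * (κ / (2 * (3 * d + 4)) * N) := by gcongr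
        have h3 : ((3 * d + 4) * N : ℝ) * (κ / (2 * (3 * d + 4)) * N) = κ / 2 * N ^ 2 := by
          field_simp
        have h4 : κ / 2 * (N : ℝ) ≤ κ / 2 * N ^ 2 := by
          have : (N : ℝ) ≤ N ^ 2 := by nlinarith
          gcongr
        linarith

/-- The inverse mesh `(N + 1) ^ (2 d + 2)` compensates the at most `(N + 1) ^ d` sizes and the `N ^
d` from Markov's inequality, and still leaves the summable factor `(N + 1) ^ (-2)`. -/
theorem summable_deviationBound (hd : 0 < d) {z : ℂ} (hz : z.im ≠ 0) {t : ℝ} (ht : 0 < t) :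
    Summable (deviationBound d z t) := by
  have hK : (0 : ℝ) < traceLipschitz d z := traceLipschitz_pos hd hz
  set κ : ℝ := t ^ 2 / (16 * (5 * traceLipschitz d z ^ 2)) with hκ
  have hκ0 : 0 < κ := by positivity
  have h1 := (summable_pow_mul_exp_neg_sq d hκ0).mul_left (d * 4 : ℝ)
  have h2 : Summable fun N : ℕ => (4 * d * |z.im|⁻¹ ^ 2 / t) * (1 / (N + 1 : ℝ) ^ 2) := by
    refine Summable.mul_left _ ?_
    have := (summable_nat_add_iff 1).2 (Real.summable_one_div_nat_pow.2 (by norm_num : 1 < 2))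
    exact this.congr fun N => by push_cast; rfl
  refine Summable.of_nonneg_of_le (fun N => ?_) (fun N => ?_) (h2.add h1)
  · unfold deviationBound; positivity
  · unfold deviationBound
    have e : Real.exp (-((N * t / 4) ^ 2 / (5 * traceLipschitz d z ^ 2))) =
        Real.exp (-(κ * N ^ 2)) := by
      congr 2
      rw [hκ]; field_simp; norm_num
    rw [e, mul_add]
    refine add_le_add ?_ (le_of_eq (by ring))
    have h3 : (N : ℝ) ^ d ≤ (N + 1 : ℝ) ^ d := by gcongr; linarith
    calc (N + 1 : ℝ) ^ d * ((N : ℝ) ^ d * (4 * d * |z.im|⁻¹ ^ 2) / (t * ((N + 1) ^ (2 * d + 2) : ℕ)))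
        ≤ (N + 1 : ℝ) ^ d * ((N + 1 : ℝ) ^ d * (4 * d * |z.im|⁻¹ ^ 2) /
          (t * ((N + 1) ^ (2 * d + 2) : ℕ))) := by gcongr
      _ = _ := by
          push_cast
          have : (N + 1 : ℝ) ≠ 0 := by positivity
          rw [show 2 * d + 2 = d + d + 2 by ring, pow_add, pow_add]
          field_simp

theorem map_toLp_eq_stdGaussian {Ω : Type*} [MeasurableSpace Ω] {P : Measure Ω}
    [IsProbabilityMeasure P] {W : Ω → Tensor n} (hW : IsGaussianNoise P W) :
    AEMeasurable (fun ω => (WithLp.toLp 2 (W ω) : TensorSpace n)) P ∧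
    P.map (fun ω => (WithLp.toLp 2 (W ω) : TensorSpace n)) = stdGaussian (TensorSpace n) := by
  have h1 : ∀ p, AEMeasurable (fun ω => W ω p) P := fun p => (hW.1 p).aemeasurable
  have h2 := (iIndepFun_iff_map_fun_eq_pi_map h1).1 hW.2
  have h3 : ∀ p, P.map (fun ω => W ω p) = gaussianReal 0 1 := fun p => (hW.1 p).map_eq
  simp only [h3] at h2
  have hm : AEMeasurable W P := aemeasurable_pi_iff.2 h1
  have hl : Measurable (WithLp.toLp 2 : Tensor n → TensorSpace n) := WithLp.measurable_toLp 2 _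
  refine ⟨hl.comp_aemeasurable hm, ?_⟩
  rw [← map_pi_eq_stdGaussian, ← h2, AEMeasurable.map_map_of_aemeasurable hl.aemeasurable hm]
  rfl

/-- Almost surely, all block traces of all noise matrices are eventually close to their
expectations. -/
theorem ae_eventually_notMem_deviationSet (hd : 0 < d) {Ω : Type*} [MeasurableSpace Ω]
    (P : Measure Ω) [IsProbabilityMeasure P] (n : ℕ → Fin d → ℕ)
    (hn : Tendsto (fun k => totalDim (n k)) atTop atTop)
    (W : (s : Fin d → ℕ) → Ω → Tensor s) (hW : ∀ k, IsGaussianNoise P (W (n k)))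
    {z : ℂ} (hz : z.im ≠ 0) {t : ℝ} (ht : 0 < t) :
    ∀ᵐ ω ∂P, ∀ᶠ k in atTop,
      (WithLp.toLp 2 (W (n k) ω) : TensorSpace (n k)) ∉ deviationSet (n k) z t := by
  classical
  -- All sizes with total dimension `N` are treated in one event. The sequence may repeat a size or
  -- a total dimension, and only a union bound is available since the joint law is arbitrary.
  let sizes : ℕ → Finset (Fin d → ℕ) := fun N =>
    (Fintype.piFinset fun _ => Finset.range (N + 1)).filter fun s =>
      totalDim s = N ∧ IsGaussianNoise P (W s)
  let good : ℕ → Prop := fun N => 0 < N ∧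
    d * |z.im|⁻¹ ^ 2 * (((N + 1) ^ (2 * d + 2) : ℕ) : ℝ)⁻¹ * (N : ℝ) ^ d ≤ t / 4
  let bad : ℕ → Set Ω := fun N => {ω | good N ∧ ∃ s ∈ sizes N,
    (WithLp.toLp 2 (W s ω) : TensorSpace s) ∈ deviationSet s z t}
  have hbad : ∀ N, P (bad N) ≤ ENNReal.ofReal (deviationBound d z t N) := by
    intro N
    by_cases hg : good N
    · have h1 : bad N ⊆ ⋃ s ∈ sizes N, {ω | (WithLp.toLp 2 (W s ω) : TensorSpace s) ∈
          deviationSet s z t} := by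
        rintro ω ⟨-, s, hs, h⟩
        exact Set.mem_biUnion hs h
      have h2 : ∀ s ∈ sizes N, P.real {ω | (WithLp.toLp 2 (W s ω) : TensorSpace s) ∈
          deviationSet s z t} ≤ (N : ℝ) ^ d * (4 * d * |z.im|⁻¹ ^ 2) /
            (t * ((N + 1) ^ (2 * d + 2) : ℕ)) +
          (2 * ((N + 1) ^ (2 * d + 2) : ℕ) + 1 : ℝ) ^ N * (d * (4 *
          Real.exp (-((N * t / 4) ^ 2 / (5 * traceLipschitz d z ^ 2))))) := by
        intro s hs
        obtain ⟨hsN, hsG⟩ := (Finset.mem_filter.1 hs).2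
        obtain ⟨hm, hmap⟩ := map_toLp_eq_stdGaussian hsG
        -- The deviation set is an uncountable union that is not shown to be measurable, so only
        -- this inequality between outer measures is used.
        have h3 := Measure.le_map_apply hm (deviationSet s z t)
        rw [hmap] at h3
        have h4 := measureReal_deviationSet_le (n := s) hd (by rw [hsN]; exact hg.1) hz ht
          (M := (N + 1) ^ (2 * d + 2)) (by positivity) (by rw [hsN]; exact hg.2)
        rw [hsN] at h4
        exact (ENNReal.toReal_mono (measure_ne_top _ _) h3).trans h4
      have h3 : P.real (bad N) ≤ deviationBound d z t N := by
        refine (measureReal_mono h1 (measure_ne_top _ _)).trans ((measureReal_biUnion_finset_le _ _).trans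
          ((Finset.sum_le_sum h2).trans ?_))
        rw [Finset.sum_const, nsmul_eq_mul, deviationBound]
        refine mul_le_mul_of_nonneg_right ?_ (by positivity)
        have : (sizes N).card ≤ (N + 1) ^ d := by
          refine (Finset.card_filter_le _ _).trans (le_of_eq ?_)
          simp
        exact_mod_cast this
      rw [← ENNReal.ofReal_toReal (measure_ne_top P (bad N))]
      exact ENNReal.ofReal_le_ofReal h3
    · have : bad N = ∅ := Set.eq_empty_iff_forall_notMem.2 fun ω h => hg h.1
      rw [this]; simp
  have hsum : ∑' N, P (bad N) ≠ ⊤ :=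
    ((summable_deviationBound hd hz ht).tsum_ofReal_ne_top).lt_top.trans_le'
      (ENNReal.tsum_le_tsum hbad) |>.ne
  have hgood : ∀ᶠ N in atTop, good N := by
    refine (eventually_gt_atTop 0).and ?_
    have h1 : Tendsto (fun N : ℕ => (d * |z.im|⁻¹ ^ 2) * (1 / ((N : ℝ) + 1))) atTop (𝓝 0) := by
      have := (tendsto_one_div_add_atTop_nhds_zero_nat (𝕜 := ℝ)).const_mul (d * |z.im|⁻¹ ^ 2)
      rw [mul_zero] at this
      exact this
    filter_upwards [h1.eventually_lt_const (by positivity : 0 < t / 4)] with N hN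
    refine le_trans ?_ hN.le
    rw [mul_assoc]
    refine mul_le_mul_of_nonneg_left ?_ (by positivity)
    push_cast
    have h2 : (N : ℝ) ^ d ≤ (N + 1 : ℝ) ^ (2 * d + 1) :=
      (pow_le_pow_left₀ (Nat.cast_nonneg _) (by linarith) d).trans
        (pow_le_pow_right₀ (by linarith [Nat.cast_nonneg (α := ℝ) N]) (by omega))
    rw [inv_mul_eq_div, div_le_div_iff₀ (by positivity) (by positivity)]
    calc (N : ℝ) ^ d * (N + 1) ≤ (N + 1 : ℝ) ^ (2 * d + 1) * (N + 1) := by gcongr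
      _ = _ := by ring
  -- Borel-Cantelli over the total dimension; the result is pulled back along `k` because the total
  -- dimension tends to infinity.
  filter_upwards [ae_finite_setOfPred_mem hsum] with ω hω
  have h1 : ∀ᶠ N in atTop, ω ∉ bad N := by
    obtain ⟨B, hB⟩ := hω.bddAbove
    filter_upwards [eventually_gt_atTop B] with N hN h
    exact absurd (hB h) (by omega)
  filter_upwards [hn.eventually (h1.and hgood)] with k hk h
  refine hk.1 ⟨hk.2, n k, ?_, h⟩
  refine Finset.mem_filter.2 ⟨?_, rfl, hW k⟩
  rw [Fintype.mem_piFinset]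
  intro ℓ
  rw [Finset.mem_range, Nat.lt_succ_iff]
  exact Finset.single_le_sum (f := n k) (fun _ _ => Nat.zero_le _) (Finset.mem_univ ℓ)

end Uniform

/-! ### Asymptotic equations for the block traces of the perturbed matrices. -/

section BlockTrace

variable {d : ℕ} {n : Fin d → ℕ}

/-- The normalized trace of a diagonal block of the resolvent. -/
noncomputable def blockTrace (M : Matrix (BlockIndex n) (BlockIndex n) ℝ) (z : ℂ) (ℓ : Fin d) : ℂ :=
  (totalDim n : ℂ)⁻¹ * (Matrix.diagonal (blockWeight ℓ) * resolventMatrix M z).trace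

theorem sum_blockTrace (M : Matrix (BlockIndex n) (BlockIndex n) ℝ) (z : ℂ) :
    ∑ ℓ, blockTrace M z ℓ = normalizedResolventTrace M z := by
  simp only [blockTrace, normalizedResolventTrace]
  rw [← Finset.mul_sum, ← Matrix.trace_sum, ← Finset.sum_mul, card_blockIndex]
  have : ∑ ℓ : Fin d, Matrix.diagonal (blockWeight (n := n) ℓ) = 1 := by
    ext s t
    rw [Matrix.sum_apply]
    by_cases h : s = t
    · subst h; simp [blockWeight]
    · simp [h]
  rw [this, one_mul]

theorem norm_blockTrace_le {M : Matrix (BlockIndex n) (BlockIndex n) ℝ} (hM : M.IsHermitian)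
    {z : ℂ} (hz : z.im ≠ 0) (ℓ : Fin d) : ‖blockTrace M z ℓ‖ ≤ |z.im|⁻¹ := by
  have h := norm_trace_diagonal_resolvent_le hM hz (norm_blockWeight_le ℓ)
  rw [card_blockIndex] at h
  rw [blockTrace, norm_mul, norm_inv, Complex.norm_natCast]
  rcases Nat.eq_zero_or_pos (totalDim n) with h0 | hN
  · simp [h0]
  · have hN' : (0 : ℝ) < totalDim n := by exact_mod_cast hN
    rwa [inv_mul_le_iff₀ hN']

theorem offWeight_add_blockWeight (ℓ : Fin d) :
    offWeight (n := n) ℓ + blockWeight ℓ = ∑ m, blockWeight m := by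
  ext s
  simp only [Pi.add_apply, Finset.sum_apply, offWeight, blockWeight]
  rw [Finset.sum_ite_eq, if_pos (Finset.mem_univ _)]
  split_ifs <;> simp

theorem noiseTrace_add (v w : BlockIndex n → ℂ) (z : ℂ) (a : Vectors n) (x : TensorSpace n) :
    noiseTrace (v + w) z a x = noiseTrace v z a x + noiseTrace w z a x := by
  simp only [noiseTrace]
  rw [← Matrix.trace_add, ← add_mul, Matrix.diagonal_add]
  rfl

theorem noiseTrace_sum {J : Type*} (S : Finset J) (w : J → BlockIndex n → ℂ) (z : ℂ)
    (a : Vectors n) (x : TensorSpace n) :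
    noiseTrace (∑ j ∈ S, w j) z a x = ∑ j ∈ S, noiseTrace (w j) z a x := by
  classical
  induction S using Finset.induction_on with
  | empty => simp [noiseTrace]
  | insert j S hj ih => rw [Finset.sum_insert hj, Finset.sum_insert hj, noiseTrace_add, ih]

theorem integral_noiseTrace_offWeight {z : ℂ} (hz : z.im ≠ 0) (a : Vectors n) (ℓ : Fin d) :
    ∫ x, noiseTrace (offWeight ℓ) z a x ∂(stdGaussian (TensorSpace n)) =
      ∑ m, (∫ x, noiseTrace (blockWeight m) z a x ∂(stdGaussian (TensorSpace n))) -
        ∫ x, noiseTrace (blockWeight ℓ) z a x ∂(stdGaussian (TensorSpace n)) := by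
  rw [← integral_finsetSum _ fun m _ => integrable_noiseTrace (norm_blockWeight_le m) hz a,
    eq_sub_iff_add_eq, ← integral_add (integrable_noiseTrace (norm_offWeight_le ℓ) hz a)
      (integrable_noiseTrace (norm_blockWeight_le ℓ) hz a)]
  congr 1
  ext x
  rw [← noiseTrace_add, offWeight_add_blockWeight, noiseTrace_sum]

/-- If the noise tensors avoid the deviation sets, then the block traces of bounded rank
perturbations of the noise matrices satisfy the limiting equations. -/
theorem tendsto_blockTrace_equation (hd : 0 < d) {n : ℕ → Fin d → ℕ} {c : Fin d → ℝ}
    (hn : Tendsto (fun k => totalDim (n k)) atTop atTop)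
    (hc : ∀ ℓ, Tendsto (fun k => (n k ℓ : ℝ) / (totalDim (n k) : ℝ)) atTop (𝓝 (c ℓ)))
    {z : ℂ} (hz : z.im ≠ 0) {a : (k : ℕ) → Vectors (n k)} (ha : ∀ᶠ k in atTop, ∀ ℓ, ‖a k ℓ‖ = 1)
    {w : (k : ℕ) → TensorSpace (n k)}
    (hw : ∀ t > 0, ∀ᶠ k in atTop, w k ∉ deviationSet (n k) z t)
    {M : (k : ℕ) → Matrix (BlockIndex (n k)) (BlockIndex (n k)) ℝ} (hM : ∀ k, (M k).IsHermitian)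
    {J : Type*} [Fintype J] (hMw : ∀ k, ∃ f g : J → BlockIndex (n k) → ℝ, ∀ s t,
      M k s t - noiseMatrix (a k) (w k) s t = ∑ j, f j s * g j t) (ℓ : Fin d) :
    Tendsto (fun k => c ℓ + z * blockTrace (M k) z ℓ +
      blockTrace (M k) z ℓ * (∑ m, blockTrace (M k) z m - blockTrace (M k) z ℓ)) atTop (𝓝 0) := by
  let e : ℕ → Fin d → ℂ := fun k m => (totalDim (n k) : ℂ)⁻¹ *
    ∫ x, noiseTrace (blockWeight m) z (a k) x ∂(stdGaussian (TensorSpace (n k)))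
  have hN : ∀ᶠ k in atTop, 0 < totalDim (n k) := hn.eventually_gt_atTop 0
  have hNinv : Tendsto (fun k => ((totalDim (n k) : ℝ))⁻¹) atTop (𝓝 0) :=
    tendsto_inv_atTop_zero.comp (tendsto_natCast_atTop_atTop.comp hn)
  -- The perturbation costs a bounded amount before division by `N`. Outside the deviation set, the
  -- noise trace at the given `a k` is within `N * (ε / 2)` of its mean, even if `a k` depends on
  -- the noise.
  have hclose : ∀ m, Tendsto (fun k => blockTrace (M k) z m - e k m) atTop (𝓝 0) := by
    intro m
    rw [tendsto_zero_iff_norm_tendsto_zero, Metric.tendsto_nhds]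
    intro ε hε
    have h1 : Tendsto (fun k => ((totalDim (n k) : ℝ))⁻¹ * (Fintype.card J * (2 * |z.im|⁻¹))) atTop
        (𝓝 0) := by
      have := hNinv.mul_const (Fintype.card J * (2 * |z.im|⁻¹) : ℝ)
      rwa [zero_mul] at this
    filter_upwards [hN, ha, hw (ε / 2) (half_pos hε), h1.eventually_lt_const (half_pos hε)]
      with k hNk hak hwk hk
    have hN' : (0 : ℝ) < totalDim (n k) := by exact_mod_cast hNk
    rw [Real.dist_eq, sub_zero, abs_norm]
    obtain ⟨f, g, hfg⟩ := hMw k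
    have h2 := norm_trace_diagonal_resolvent_sub_le_card (hM k) (noiseMatrix_isHermitian (a k) (w k))
      f g hfg hz (norm_blockWeight_le m)
    have h3 : ‖noiseTrace (blockWeight m) z (a k) (w k) -
        ∫ x, noiseTrace (blockWeight m) z (a k) x ∂(stdGaussian (TensorSpace (n k)))‖ ≤
        totalDim (n k) * (ε / 2) := by
      by_contra hcon
      exact hwk ⟨a k, hak, m, not_le.1 hcon⟩
    have h4 : blockTrace (M k) z m - e k m = (totalDim (n k) : ℂ)⁻¹ *
        (((Matrix.diagonal (blockWeight m) * resolventMatrix (M k) z).trace -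
          (Matrix.diagonal (blockWeight m) * resolventMatrix (noiseMatrix (a k) (w k)) z).trace) +
        (noiseTrace (blockWeight m) z (a k) (w k) -
        ∫ x, noiseTrace (blockWeight m) z (a k) x ∂(stdGaussian (TensorSpace (n k))))) := by
      simp only [blockTrace, e, noiseTrace]; ring
    rw [h4, norm_mul, norm_inv, Complex.norm_natCast]
    calc _ ≤ (totalDim (n k) : ℝ)⁻¹ * (Fintype.card J * (2 * |z.im|⁻¹) +
          totalDim (n k) * (ε / 2)) := by
          gcongr
          exact (norm_add_le _ _).trans (add_le_add h2 h3)
      _ = (totalDim (n k) : ℝ)⁻¹ * (Fintype.card J * (2 * |z.im|⁻¹)) + ε / 2 := by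
          field_simp
      _ < ε := by linarith
  have hmean : Tendsto (fun k => ((n k ℓ : ℝ) / (totalDim (n k) : ℝ) : ℝ) + z * e k ℓ +
      e k ℓ * (∑ m, e k m - e k ℓ)) atTop (𝓝 0) := by
    have h1 : Tendsto (fun k => ((totalDim (n k) : ℝ))⁻¹ * meanErrorConst d z) atTop (𝓝 0) := by
      have := hNinv.mul_const (meanErrorConst d z)
      rwa [zero_mul] at this
    refine squeeze_zero_norm' ?_ h1
    filter_upwards [hN, ha] with k hNk hak
    have h2 := norm_meanEquation_le hd hNk hak ℓ hz
    rw [integral_noiseTrace_offWeight hz] at h2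
    have hN' : (0 : ℝ) < totalDim (n k) := by exact_mod_cast hNk
    have h3 : (((n k ℓ : ℝ) / (totalDim (n k) : ℝ) : ℝ) : ℂ) + z * e k ℓ +
      e k ℓ * (∑ m, e k m - e k ℓ) = (totalDim (n k) : ℂ)⁻¹ * (n k ℓ +
        z * ∫ x, noiseTrace (blockWeight ℓ) z (a k) x ∂(stdGaussian (TensorSpace (n k))) +
        (totalDim (n k) : ℂ)⁻¹ *
        ((∫ x, noiseTrace (blockWeight ℓ) z (a k) x ∂(stdGaussian (TensorSpace (n k)))) *
        (∑ m, (∫ x, noiseTrace (blockWeight m) z (a k) x ∂(stdGaussian (TensorSpace (n k)))) -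
        ∫ x, noiseTrace (blockWeight ℓ) z (a k) x ∂(stdGaussian (TensorSpace (n k)))))) := by
      simp only [e]
      rw [← Finset.mul_sum]
      push_cast
      ring
    rw [h3, norm_mul, norm_inv, Complex.norm_natCast]
    gcongr
  have hcC : Tendsto (fun k => (c ℓ : ℂ) - ((n k ℓ : ℝ) / (totalDim (n k) : ℝ) : ℝ)) atTop (𝓝 0) := by
    have := ((Complex.continuous_ofReal.tendsto (c ℓ)).comp (hc ℓ)).const_sub (c ℓ : ℂ)
    rwa [sub_self] at this
  have hS : Tendsto (fun k => ∑ m, (blockTrace (M k) z m - e k m)) atTop (𝓝 0) := by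
    have := tendsto_finsetSum Finset.univ fun m _ => hclose m
    rwa [Finset.sum_const_zero] at this
  have hSl := hS.sub (hclose ℓ)
  rw [sub_zero] at hSl
  have hb : ∀ᶠ k in atTop, ‖blockTrace (M k) z ℓ‖ ≤ |z.im|⁻¹ :=
    Eventually.of_forall fun k => norm_blockTrace_le (hM k) hz ℓ
  -- The equation is transferred from the means `e` to the block traces `b` through `b (B - b) - e
  -- (E - e) = b ((B - E) - (b - e)) + (b - e) (E - e)`, where `B` and `E` are the sums over the
  -- blocks.
  have h1 : Tendsto (fun k => blockTrace (M k) z ℓ *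
      (∑ m, (blockTrace (M k) z m - e k m) - (blockTrace (M k) z ℓ - e k ℓ))) atTop (𝓝 0) :=
    isBoundedUnder_le_mul_tendsto_zero ⟨_, eventually_map.2 hb⟩ hSl
  have hb2 : ∀ᶠ k in atTop, ‖∑ m, e k m - e k ℓ‖ ≤ d * |z.im|⁻¹ + |z.im|⁻¹ + 1 := by
    filter_upwards [(tendsto_zero_iff_norm_tendsto_zero.1 hSl).eventually_lt_const one_pos] with k hk
    have h2 : ∑ m, e k m - e k ℓ = (∑ m, blockTrace (M k) z m - blockTrace (M k) z ℓ) -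
      (∑ m, (blockTrace (M k) z m - e k m) - (blockTrace (M k) z ℓ - e k ℓ)) := by
      rw [Finset.sum_sub_distrib]; ring
    rw [h2]
    refine (norm_sub_le _ _).trans (add_le_add ((norm_sub_le _ _).trans
      (add_le_add ?_ (norm_blockTrace_le (hM k) hz ℓ))) hk.le)
    refine (norm_sum_le _ _).trans ((Finset.sum_le_sum fun m _ =>
      norm_blockTrace_le (hM k) hz m).trans (le_of_eq ?_))
    simp
  have h2 : Tendsto (fun k => (blockTrace (M k) z ℓ - e k ℓ) * (∑ m, e k m - e k ℓ)) atTop (𝓝 0) := by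
    have := isBoundedUnder_le_mul_tendsto_zero (f := fun k => ∑ m, e k m - e k ℓ)
      ⟨_, eventually_map.2 hb2⟩ (hclose ℓ)
    simpa only [mul_comm] using this
  have h3 := (((hmean.add hcC).add ((hclose ℓ).const_mul z)).add h1).add h2
  simp only [mul_zero, add_zero] at h3
  refine h3.congr fun k => ?_
  rw [Finset.sum_sub_distrib]
  ring

end BlockTrace

/-! ### Stieltjes transforms and their injectivity on a horizontal line. -/

section StieltjesTransform

theorem continuous_inv_ofReal_sub {z : ℂ} (hz : z.im ≠ 0) :
    Continuous fun t : ℝ => ((t : ℂ) - z)⁻¹ := by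
  refine Continuous.inv₀ (by fun_prop) fun t h => hz ?_
  rw [← sub_eq_zero.1 h, Complex.ofReal_im]

theorem norm_inv_ofReal_sub_le {z : ℂ} (hz : z.im ≠ 0) (t : ℝ) :
    ‖((t : ℂ) - z)⁻¹‖ ≤ |z.im|⁻¹ := by
  rw [norm_inv]
  refine inv_anti₀ (abs_pos.2 hz) ?_
  have := Complex.abs_im_le_norm ((t : ℂ) - z)
  simpa using this

theorem integrable_inv_ofReal_sub (μ : Measure ℝ) [IsFiniteMeasure μ] {z : ℂ} (hz : z.im ≠ 0) :
    Integrable (fun t : ℝ => ((t : ℂ) - z)⁻¹) μ :=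
  Integrable.of_bound (continuous_inv_ofReal_sub hz).aestronglyMeasurable _
    (ae_of_all _ (norm_inv_ofReal_sub_le hz))

theorem norm_stieltjes_le (μ : Measure ℝ) [IsProbabilityMeasure μ] {z : ℂ} (hz : z.im ≠ 0) :
    ‖stieltjes μ z‖ ≤ |z.im|⁻¹ := by
  refine (norm_integral_le_of_norm_le_const (ae_of_all _ (norm_inv_ofReal_sub_le hz))).trans ?_
  simp

theorem im_stieltjes_pos (μ : Measure ℝ) [IsProbabilityMeasure μ] {z : ℂ} (hz : 0 < z.im) :
    0 < (stieltjes μ z).im := by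
  have hi := integrable_inv_ofReal_sub μ hz.ne'
  have h := integral_im hi
  have hpos : ∀ t : ℝ, 0 < RCLike.im (((t : ℂ) - z)⁻¹) := by
    intro t
    have hne : (t : ℂ) - z ≠ 0 := fun h0 => hz.ne' (by rw [← sub_eq_zero.1 h0, Complex.ofReal_im])
    simp only [RCLike.im_to_complex, Complex.inv_im, Complex.sub_im, Complex.ofReal_im, zero_sub,
      neg_neg]
    exact div_pos hz (Complex.normSq_pos.2 hne)
  have h2 : 0 < ∫ t : ℝ, RCLike.im (((t : ℂ) - z)⁻¹) ∂μ := by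
    rw [integral_pos_iff_support_of_nonneg (fun t => (hpos t).le) hi.im]
    have : Function.support (fun t : ℝ => RCLike.im (((t : ℂ) - z)⁻¹)) = Set.univ :=
      Set.eq_univ_of_forall fun t => (hpos t).ne'
    rw [this, measure_univ]
    exact one_pos
  rw [h] at h2
  exact h2

theorem integrable_exp_neg_mul_abs {y : ℝ} (hy : 0 < y) (u : ℝ) :
    Integrable (fun s : ℝ => Complex.exp (s * u * Complex.I) * Real.exp (-y * |s|)) := by
  rw [← integrableOn_univ, ← Set.Iic_union_Ioi (a := (0 : ℝ))]
  refine IntegrableOn.union ?_ ?_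
  · refine (integrableOn_exp_mul_complex_Iic (a := y + u * Complex.I) (by simpa using hy) 0).congr_fun
      (fun s hs => ?_) measurableSet_Iic
    dsimp only
    rw [abs_of_nonpos hs, Complex.ofReal_exp, ← Complex.exp_add]
    congr 1; push_cast; ring
  · refine (integrableOn_exp_mul_complex_Ioi (a := -y + u * Complex.I) (by simpa using hy) 0).congr_fun
      (fun s hs => ?_) measurableSet_Ioi
    dsimp only
    rw [abs_of_pos hs, Complex.ofReal_exp, ← Complex.exp_add]
    congr 1; push_cast; ring

/-- The Fourier integral of `exp (-y |s|)` is a multiple of the Poisson kernel. -/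
theorem integral_exp_neg_mul_abs {y : ℝ} (hy : 0 < y) (u : ℝ) :
    ∫ s : ℝ, Complex.exp (s * u * Complex.I) * Real.exp (-y * |s|) =
      -Complex.I * ((u : ℂ) - y * Complex.I)⁻¹ +
        Complex.I * (starRingEnd ℂ) (((u : ℂ) - y * Complex.I)⁻¹) := by
  rw [← integral_add_compl measurableSet_Iic (integrable_exp_neg_mul_abs hy u) (s := Set.Iic 0),
    Set.compl_Iic]
  have h1 : ∫ s in Set.Iic (0 : ℝ), Complex.exp (s * u * Complex.I) * Real.exp (-y * |s|) =
      ∫ s in Set.Iic (0 : ℝ), Complex.exp ((y + u * Complex.I) * s) := by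
    refine setIntegral_congr_fun measurableSet_Iic fun s hs => ?_
    rw [abs_of_nonpos hs, Complex.ofReal_exp, ← Complex.exp_add]
    congr 1; push_cast; ring
  have h2 : ∫ s in Set.Ioi (0 : ℝ), Complex.exp (s * u * Complex.I) * Real.exp (-y * |s|) =
      ∫ s in Set.Ioi (0 : ℝ), Complex.exp ((-y + u * Complex.I) * s) := by
    refine setIntegral_congr_fun measurableSet_Ioi fun s hs => ?_
    rw [abs_of_pos hs, Complex.ofReal_exp, ← Complex.exp_add]
    congr 1; push_cast; ring
  rw [h1, h2, integral_exp_mul_complex_Iic (by simpa using hy),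
    integral_exp_mul_complex_Ioi (by simpa using hy)]
  have n1 : (u : ℂ) - y * Complex.I ≠ 0 := fun h => hy.ne' (by simpa using congrArg Complex.im h)
  have n2 : (u : ℂ) + y * Complex.I ≠ 0 := fun h => hy.ne' (by simpa using congrArg Complex.im h)
  have n3 : (y : ℂ) + u * Complex.I ≠ 0 := fun h => hy.ne' (by simpa using congrArg Complex.re h)
  have n4 : -(y : ℂ) + u * Complex.I ≠ 0 := fun h => hy.ne' (by simpa using congrArg Complex.re h)
  simp only [map_inv₀, map_sub, map_mul, Complex.conj_ofReal, Complex.conj_I, mul_neg, sub_neg_eq_add,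
    Complex.ofReal_zero, mul_zero, Complex.exp_zero]
  field_simp
  ring_nf
  simp only [Complex.I_sq, show Complex.I ^ 4 = 1 by
    rw [show 4 = 2 * 2 by rfl, pow_mul, Complex.I_sq]; norm_num]
  ring

/-- By Fubini, damping the characteristic function by `exp (-y |s|)` and taking its Fourier
transform integrates the Poisson kernel against `μ`. The right side is twice the imaginary part of
the Stieltjes transform at height `y`. -/
theorem integral_charFun_mul_exp (μ : Measure ℝ) [IsProbabilityMeasure μ] {y : ℝ} (hy : 0 < y)
    (x : ℝ) :
    ∫ s : ℝ, Complex.exp (-(s * x) * Complex.I) * (charFun μ s * Real.exp (-y * |s|)) =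
      -Complex.I * stieltjes μ (x + y * Complex.I) +
        Complex.I * (starRingEnd ℂ) (stieltjes μ (x + y * Complex.I)) := by
  have hz : ((x : ℂ) + y * Complex.I).im ≠ 0 := by simpa using hy.ne'
  have hi := integrable_inv_ofReal_sub μ hz
  have h1 : ∀ s : ℝ, Complex.exp (-(s * x) * Complex.I) * (charFun μ s * Real.exp (-y * |s|)) =
      ∫ t : ℝ, Complex.exp (s * (t - x : ℝ) * Complex.I) * Real.exp (-y * |s|) ∂μ := by
    intro s
    rw [charFun_apply_real, integral_mul_const, ← mul_assoc, ← integral_const_mul]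
    congr 2
    ext t
    rw [← Complex.exp_add]
    congr 1; push_cast; ring
  simp only [h1]
  have hK : Integrable (Function.uncurry fun s t : ℝ =>
      Complex.exp (s * (t - x : ℝ) * Complex.I) * Real.exp (-y * |s|)) (volume.prod μ) := by
    have h0 := (integrable_exp_neg_mul_abs hy 0).comp_fst μ
    refine h0.mono (Continuous.aestronglyMeasurable (by unfold Function.uncurry; fun_prop))
      (ae_of_all _ fun p => le_of_eq ?_)
    simp only [Function.uncurry, norm_mul]
    congr 1
    rw [← Complex.ofReal_mul, ← Complex.ofReal_mul, Complex.norm_exp_ofReal_mul_I,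
      Complex.norm_exp_ofReal_mul_I]
  rw [integral_integral_swap hK]
  simp only [integral_exp_neg_mul_abs hy]
  have h2 : ∀ t : ℝ, ((t - x : ℝ) : ℂ) - y * Complex.I = (t : ℂ) - (x + y * Complex.I) := by
    intro t; push_cast; ring
  simp only [h2]
  have hi2 : Integrable (fun t : ℝ => (starRingEnd ℂ) (((t : ℂ) - (x + y * Complex.I))⁻¹)) μ :=
    hi.mono (by fun_prop) (ae_of_all _ fun t => (RCLike.norm_conj _).le)
  rw [integral_add (hi.const_mul _) (hi2.const_mul _), integral_const_mul, integral_const_mul,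
    integral_conj]
  rfl

/-- A probability measure is determined by its Stieltjes transform on a horizontal line. -/
theorem eq_of_stieltjes_eq {μ ν : Measure ℝ} [IsProbabilityMeasure μ] [IsProbabilityMeasure ν]
    {y : ℝ} (hy : 0 < y)
    (h : ∀ x : ℝ, stieltjes μ (x + y * Complex.I) = stieltjes ν (x + y * Complex.I)) : μ = ν := by
  refine Measure.ext_of_charFun ?_
  let f : ℝ → ℂ := fun s => (charFun μ s - charFun ν s) * Real.exp (-y * |s|)
  have hcont : Continuous f := by
    have h1 : Continuous (charFun μ) := continuous_charFun
    have h2 : Continuous (charFun ν) := continuous_charFun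
    fun_prop
  have hint : ∀ (κ : Measure ℝ) [IsProbabilityMeasure κ] (x : ℝ), Integrable
      (fun s : ℝ => Complex.exp (-(s * x) * Complex.I) * (charFun κ s * Real.exp (-y * |s|))) := by
    intro κ _ x
    have h1 : Continuous (charFun κ) := continuous_charFun
    refine (integrable_exp_neg_mul_abs hy 0).mono (Continuous.aestronglyMeasurable (by fun_prop))
      (ae_of_all _ fun s => ?_)
    rw [norm_mul, norm_mul, norm_mul, ← mul_assoc]
    refine mul_le_mul_of_nonneg_right ?_ (norm_nonneg _)
    rw [← Complex.ofReal_mul, ← Complex.ofReal_neg, Complex.norm_exp_ofReal_mul_I,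
      ← Complex.ofReal_mul, Complex.norm_exp_ofReal_mul_I, one_mul]
    exact norm_charFun_le_one (μ := κ) s
  have hfint : Integrable f := by
    refine ((hint μ 0).sub (hint ν 0)).congr (ae_of_all _ fun s => ?_)
    simp [f, sub_mul]
  -- The Fourier transform at `w` only sees the two Stieltjes transforms at `2 π w + i y`, where
  -- they agree. Fourier inversion then gives `f = 0`, and the damping factor never vanishes.
  have hF : ∀ w, FourierTransform.fourier f w = 0 := by
    intro w
    rw [Real.fourier_real_eq_integral_exp_smul]
    have e : ∀ v : ℝ, Complex.exp (↑(-2 * Real.pi * v * w) * Complex.I) • f v =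
        Complex.exp (-(v * (2 * Real.pi * w : ℝ)) * Complex.I) * (charFun μ v * Real.exp (-y * |v|)) -
        Complex.exp (-(v * (2 * Real.pi * w : ℝ)) * Complex.I) * (charFun ν v * Real.exp (-y * |v|)) := by
      intro v
      have : ((-2 * Real.pi * v * w : ℝ) : ℂ) = -(v * (2 * Real.pi * w : ℝ)) := by push_cast; ring
      rw [this, smul_eq_mul, ← mul_sub, ← sub_mul]
    simp only [e]
    rw [integral_sub (hint μ _) (hint ν _), integral_charFun_mul_exp μ hy,
      integral_charFun_mul_exp ν hy, h, sub_self]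
  have hF0 : FourierTransform.fourier f = 0 := funext hF
  have hinv := hcont.fourierInv_fourier_eq hfint (by rw [hF0]; exact integrable_zero _ _ _)
  have hf0 : f = 0 := by
    rw [← hinv, hF0]
    ext s
    rw [Real.fourierInv_eq]
    simp
  ext s
  have h3 := congrFun hf0 s
  simp only [f, Pi.zero_apply, mul_eq_zero] at h3
  rcases h3 with h3 | h3
  · exact sub_eq_zero.1 h3
  · exact absurd h3 (by exact_mod_cast (Real.exp_pos _).ne')

end StieltjesTransform

/-! ### The limiting equations: uniqueness, weak limits and extension from a dense set. -/

section LimitMeasure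

variable {d : ℕ} {c : Fin d → ℝ}

theorem isClosed_supportC (μ : Measure ℝ) : IsClosed (supportC μ) :=
  (Complex.isometry_ofReal.isClosedEmbedding.isClosed_iff_image_isClosed).1 Measure.isClosed_support

theorem notMem_supportC_of_im_ne_zero (μ : Measure ℝ) {z : ℂ} (hz : z.im ≠ 0) : z ∉ supportC μ := by
  rintro ⟨t, -, rfl⟩
  exact hz (Complex.ofReal_im t)

/-- Among two complex numbers with large sum and small product, one is small. -/
theorem norm_mul_three_le_or {x p : ℂ} {b : ℝ} (hb : x ^ 2 - p * x - b = 0) (hb0 : 0 ≤ b)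
    (hp : 3 ≤ ‖p‖) : ‖x‖ * 3 ≤ 2 * b ∨ ‖p - x‖ * 3 ≤ 2 * b := by
  have h1 : ‖x‖ * ‖p - x‖ = b := by
    rw [← norm_mul, show x * (p - x) = -(b : ℂ) by linear_combination -hb, norm_neg,
      Complex.norm_real, Real.norm_of_nonneg hb0]
  have h2 : ‖p‖ ≤ ‖x‖ + ‖p - x‖ := by
    simpa using norm_add_le x (p - x)
  rcases le_total (3 / 2) ‖p - x‖ with h | h
  · left; nlinarith [norm_nonneg x]
  · right; nlinarith [norm_nonneg (p - x)]

/-- Each quadratic has one root of size at most `2 c_m / 3`, the other being that close to `p`. If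
the large root were taken at some indices, the sum `g` would be within `2 / 3` of a positive
multiple of `p`, which is impossible for `‖g‖ ≤ 1` and `‖p‖ ≥ 3`. -/
theorem norm_root_mul_three_le (hc0 : ∀ ℓ, 0 ≤ c ℓ) (hc1 : ∑ ℓ, c ℓ = 1) {g p : ℂ} {x : Fin d → ℂ}
    (hg : ‖g‖ ≤ 1) (hp : 3 ≤ ‖p‖) (hx : g = ∑ ℓ, x ℓ) (hq : ∀ ℓ, x ℓ ^ 2 - p * x ℓ - c ℓ = 0)
    (ℓ : Fin d) : ‖x ℓ‖ * 3 ≤ 2 * c ℓ := by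
  classical
  by_contra hcon
  let B : Finset (Fin d) := Finset.univ.filter fun m => ¬ ‖x m‖ * 3 ≤ 2 * c m
  have hB : ℓ ∈ B := Finset.mem_filter.2 ⟨Finset.mem_univ _, hcon⟩
  have h1 : ∑ m, ((if m ∈ B then p else 0) - x m) = B.card * p - g := by
    rw [Finset.sum_sub_distrib, ← hx, Finset.sum_ite_mem, Finset.univ_inter, Finset.sum_const,
      nsmul_eq_mul]
  have h2 : ‖∑ m, ((if m ∈ B then p else 0) - x m)‖ * 3 ≤ 2 := by
    have : ‖∑ m, ((if m ∈ B then p else 0) - x m)‖ ≤ ∑ m, 2 * c m / 3 := by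
      refine norm_sum_le_of_le _ fun m _ => ?_
      rw [le_div_iff₀ (by norm_num)]
      by_cases hm : m ∈ B
      · rw [if_pos hm]
        exact (norm_mul_three_le_or (hq m) (hc0 m) hp).resolve_left (Finset.mem_filter.1 hm).2
      · rw [if_neg hm, zero_sub, norm_neg]
        by_contra h
        exact hm (Finset.mem_filter.2 ⟨Finset.mem_univ _, h⟩)
    rw [← Finset.sum_div, ← Finset.mul_sum, hc1] at this
    linarith
  have h3 : (1 : ℝ) ≤ B.card := by exact_mod_cast Finset.card_pos.2 ⟨ℓ, hB⟩
  have h4 : ‖(B.card : ℂ) * p‖ ≤ ‖(B.card : ℂ) * p - g‖ + ‖g‖ := by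
    simpa using norm_add_le ((B.card : ℂ) * p - g) g
  rw [h1] at h2
  rw [norm_mul, Complex.norm_natCast] at h4
  nlinarith

/-- Far from the real axis the equations have only one bounded solution. -/
theorem eq_of_quadratic_equations (hc0 : ∀ ℓ, 0 ≤ c ℓ) (hc1 : ∑ ℓ, c ℓ = 1) {g g' z : ℂ}
    {x x' : Fin d → ℂ} (hz : 4 ≤ ‖z‖) (hg : ‖g‖ ≤ 1) (hg' : ‖g'‖ ≤ 1)
    (hx : g = ∑ ℓ, x ℓ) (hx' : g' = ∑ ℓ, x' ℓ)
    (hq : ∀ ℓ, x ℓ ^ 2 - (g + z) * x ℓ - c ℓ = 0)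
    (hq' : ∀ ℓ, x' ℓ ^ 2 - (g' + z) * x' ℓ - c ℓ = 0) : g = g' := by
  have hp : ∀ {u : ℂ}, ‖u‖ ≤ 1 → 3 ≤ ‖u + z‖ := by
    intro u hu
    have := norm_sub_le (u + z) u
    rw [add_sub_cancel_left] at this
    linarith
  have h1 := norm_root_mul_three_le hc0 hc1 hg (hp hg) hx hq
  have h2 := norm_root_mul_three_le hc0 hc1 hg' (hp hg') hx' hq'
  have hcle : ∀ ℓ, c ℓ ≤ 1 := fun ℓ => hc1 ▸
    Finset.single_le_sum (f := c) (fun m _ => hc0 m) (Finset.mem_univ ℓ)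
  have h3 : ∀ ℓ, ‖x ℓ - x' ℓ‖ ≤ ‖g - g'‖ * (2 * c ℓ / 5) := by
    intro ℓ
    -- Subtracting the two quadratics gives a contraction: the factor on the left has norm at least
    -- `3 - 4 / 3 = 5 / 3`, and `x' ℓ` is at most `2 c_ℓ / 3`. After summation over `ℓ` the
    -- contraction factor is `2 / 5`.
    have e : (x ℓ - x' ℓ) * (g + z - x ℓ - x' ℓ) = -(g - g') * x' ℓ := by
      linear_combination -(hq ℓ) + hq' ℓ
    have e2 : ‖x ℓ - x' ℓ‖ * ‖g + z - x ℓ - x' ℓ‖ = ‖g - g'‖ * ‖x' ℓ‖ := by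
      rw [← norm_mul, e, norm_mul, norm_neg]
    have e3 : 5 / 3 ≤ ‖g + z - x ℓ - x' ℓ‖ := by
      have i1 := norm_sub_norm_le (g + z) (x ℓ)
      have i2 := norm_sub_norm_le (g + z - x ℓ) (x' ℓ)
      linarith [hp hg, h1 ℓ, h2 ℓ, hcle ℓ]
    have e4 : ‖x ℓ - x' ℓ‖ * (5 / 3) ≤ ‖g - g'‖ * (2 * c ℓ / 3) := by
      calc _ ≤ ‖x ℓ - x' ℓ‖ * ‖g + z - x ℓ - x' ℓ‖ := by gcongr
        _ = _ := e2
        _ ≤ _ := by gcongr; linarith [h2 ℓ]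
    linarith
  have h4 : ‖g - g'‖ ≤ ‖g - g'‖ * (2 / 5) := by
    calc ‖g - g'‖ = ‖∑ ℓ, (x ℓ - x' ℓ)‖ := by rw [Finset.sum_sub_distrib, ← hx, ← hx']
      _ ≤ ∑ ℓ, ‖g - g'‖ * (2 * c ℓ / 5) := norm_sum_le_of_le _ fun ℓ _ => h3 ℓ
      _ = _ := by rw [← Finset.mul_sum, ← Finset.sum_div, ← Finset.mul_sum, hc1, mul_one]
  exact sub_eq_zero.1 (norm_eq_zero.1 (le_antisymm (by linarith) (norm_nonneg _)))

/-- On the line `Im z = 4` every Stieltjes transform has norm at most `1 / 4`, so the equations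
leave only one value for it. The values on this line determine the measure. -/
theorem eq_of_isLimitMeasure (hc0 : ∀ ℓ, 0 ≤ c ℓ) (hc1 : ∑ ℓ, c ℓ = 1) {μ ν : ProbabilityMeasure ℝ}
    (hμ : IsLimitMeasure c μ) (hν : IsLimitMeasure c ν) : μ = ν := by
  obtain ⟨-, x, hx⟩ := hμ
  obtain ⟨-, x', hx'⟩ := hν
  have heq : (μ : Measure ℝ) = ν → μ = ν := fun h => Subtype.ext h
  refine heq (eq_of_stieltjes_eq (by norm_num : (0 : ℝ) < 4) fun t => ?_)
  set z : ℂ := (t : ℂ) + (4 : ℝ) * Complex.I with hz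
  have him : z.im = 4 := by simp [hz]
  have him0 : z.im ≠ 0 := by rw [him]; norm_num
  have hb : |z.im|⁻¹ ≤ 1 := by rw [him]; norm_num
  have hz4 : 4 ≤ ‖z‖ := by
    have := Complex.abs_im_le_norm z
    rw [him] at this
    exact (le_abs_self _).trans this
  have h1 := hx z (notMem_supportC_of_im_ne_zero _ him0)
  have h2 := hx' z (notMem_supportC_of_im_ne_zero _ him0)
  exact eq_of_quadratic_equations hc0 hc1 hz4 ((norm_stieltjes_le _ him0).trans hb)
    ((norm_stieltjes_le _ him0).trans hb) h1.1 h2.1 h1.2 h2.2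

/-- A bounded continuous function of `t` that equals `(t - z)⁻¹` when `δ ≤ ‖t - z‖`. -/
noncomputable def truncatedResolvent (z : ℂ) (δ : ℝ) (hδ : 0 < δ) : BoundedContinuousFunction ℝ ℂ :=
  BoundedContinuousFunction.ofNormedAddCommGroup
    (fun t : ℝ => (starRingEnd ℂ) ((t : ℂ) - z) * ((max (‖(t : ℂ) - z‖ ^ 2) (δ ^ 2) : ℝ) : ℂ)⁻¹)
    (by
      refine Continuous.mul (by fun_prop) (Continuous.inv₀ (by fun_prop) fun t => ?_)
      have : 0 < max (‖(t : ℂ) - z‖ ^ 2) (δ ^ 2) := lt_max_of_lt_right (by positivity)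
      exact_mod_cast this.ne')
    δ⁻¹
    (by
      intro t
      have h : 0 < max (‖(t : ℂ) - z‖ ^ 2) (δ ^ 2) := lt_max_of_lt_right (by positivity)
      rw [norm_mul, RCLike.norm_conj, norm_inv, Complex.norm_real, Real.norm_of_nonneg h.le,
        ← div_eq_mul_inv, div_le_iff₀ h, inv_mul_eq_div, le_div_iff₀ hδ]
      rcases le_total δ ‖(t : ℂ) - z‖ with h1 | h1
      · exact (by nlinarith : _ ≤ ‖(t : ℂ) - z‖ ^ 2).trans (le_max_left _ _)
      · exact (by nlinarith : _ ≤ δ ^ 2).trans (le_max_right _ _))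

theorem truncatedResolvent_apply {z : ℂ} {δ : ℝ} (hδ : 0 < δ) {t : ℝ} (ht : δ ≤ ‖(t : ℂ) - z‖) :
    truncatedResolvent z δ hδ t = ((t : ℂ) - z)⁻¹ := by
  have h0 : (t : ℂ) - z ≠ 0 := norm_pos_iff.1 (hδ.trans_le ht)
  change (starRingEnd ℂ) ((t : ℂ) - z) * ((max (‖(t : ℂ) - z‖ ^ 2) (δ ^ 2) : ℝ) : ℂ)⁻¹ = _
  rw [max_eq_left (pow_le_pow_left₀ hδ.le ht 2), Complex.inv_def ((t : ℂ) - z),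
    Complex.normSq_eq_norm_sq, Complex.ofReal_inv]

/-- The kernel is unbounded near `z` when `z` is real, but measures that put no mass within `δ` of
`z` do not see its truncation, which is an admissible test function. -/
theorem tendsto_stieltjes {ι : Type*} {F : Filter ι} {ν : ι → ProbabilityMeasure ℝ}
    {μ : ProbabilityMeasure ℝ} (h : Tendsto ν F (𝓝 μ)) {z : ℂ} {δ : ℝ} (hδ : 0 < δ)
    (hν : ∀ᶠ k in F, ∀ᵐ t ∂(ν k : Measure ℝ), δ ≤ ‖((t : ℝ) : ℂ) - z‖)
    (hμ : ∀ᵐ t ∂(μ : Measure ℝ), δ ≤ ‖((t : ℝ) : ℂ) - z‖) :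
    Tendsto (fun k => stieltjes (ν k) z) F (𝓝 (stieltjes μ z)) := by
  have h1 := (ProbabilityMeasure.tendsto_iff_forall_integral_rclike_tendsto ℂ).1 h
    (truncatedResolvent z δ hδ)
  have e : ∀ κ : ProbabilityMeasure ℝ, (∀ᵐ t ∂(κ : Measure ℝ), δ ≤ ‖((t : ℝ) : ℂ) - z‖) →
      ∫ t, truncatedResolvent z δ hδ t ∂(κ : Measure ℝ) = stieltjes κ z := fun κ hκ =>
    integral_congr_ae (hκ.mono fun t ht => truncatedResolvent_apply hδ ht)
  rw [e μ hμ] at h1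
  exact h1.congr' (hν.mono fun k hk => e _ hk)

theorem tendsto_stieltjes_of_im_ne_zero {ι : Type*} {F : Filter ι} {ν : ι → ProbabilityMeasure ℝ}
    {μ : ProbabilityMeasure ℝ} (h : Tendsto ν F (𝓝 μ)) {z : ℂ} (hz : z.im ≠ 0) :
    Tendsto (fun k => stieltjes (ν k) z) F (𝓝 (stieltjes μ z)) := by
  have h1 : ∀ t : ℝ, |z.im| ≤ ‖(t : ℂ) - z‖ := fun t => by
    simpa using Complex.abs_im_le_norm ((t : ℂ) - z)
  exact tendsto_stieltjes h (abs_pos.2 hz) (Eventually.of_forall fun k => ae_of_all _ h1)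
    (ae_of_all _ h1)

theorem continuousAt_stieltjes (μ : Measure ℝ) [IsFiniteMeasure μ] {z : ℂ} (hz : z ∉ supportC μ) :
    ContinuousAt (stieltjes μ) z := by
  have h := (hasDerivAt_resolventTransform (𝕜 := ℝ) (A := ℂ) (μ := μ) z hz).continuousAt
  have e : ∀ w, resolventTransform μ w = stieltjes μ w := fun w => by
    simp [resolventTransform_apply, stieltjes, resolvent, Ring.inverse_eq_inv']
  exact h.congr (Eventually.of_forall e)

theorem exists_ae_le_norm_sub (μ : Measure ℝ) {z : ℂ} (hz : z ∉ supportC μ) :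
    ∃ δ : ℝ, 0 < δ ∧ ∀ᵐ t ∂μ, δ ≤ ‖((t : ℝ) : ℂ) - z‖ := by
  obtain ⟨δ, hδ, hb⟩ := Metric.isOpen_iff.1 (isClosed_supportC μ).isOpen_compl z hz
  refine ⟨δ, hδ, ?_⟩
  filter_upwards [Measure.support_mem_ae (μ := μ)] with t ht
  by_contra hcon
  refine hb (Metric.mem_ball.2 ?_ : (t : ℂ) ∈ Metric.ball z δ) ⟨t, ht, rfl⟩
  rw [dist_eq_norm]
  exact not_le.1 hcon

/-- Limits along an ultrafilter exist for all bounded sequences at once, so no successive extraction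
of subsequences is needed. -/
theorem exists_tendsto_of_eventually_norm_le {ι : Type*} (U : Ultrafilter ι) {f : ι → ℂ} {C : ℝ}
    (h : ∀ᶠ k in (U : Filter ι), ‖f k‖ ≤ C) : ∃ x, Tendsto f U (𝓝 x) := by
  obtain ⟨x, -, hx⟩ := (isCompact_closedBall (0 : ℂ) C).ultrafilter_le_nhds' (U.map f)
    (h.mono fun k hk => by simpa using hk)
  exact ⟨x, hx⟩

theorem norm_le_of_quadratic {x p : ℂ} {b : ℝ} (h : x ^ 2 - p * x - b = 0) :
    ‖x‖ ≤ ‖p‖ + |b| + 1 := by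
  by_contra hcon
  push Not at hcon
  have h1 : ‖x‖ * ‖x‖ ≤ ‖p‖ * ‖x‖ + |b| := by
    rw [← norm_mul, ← norm_mul, ← Real.norm_eq_abs, ← Complex.norm_real,
      show x * x = p * x + b by linear_combination h]
    exact norm_add_le _ _
  nlinarith [norm_nonneg p, abs_nonneg b, norm_nonneg x]

/-- The equations pass from a set of points that accumulates at every nonreal point to the whole
complement of the support. -/
theorem isLimitMeasure_of_dense {D : Set ℂ} (hD : Dense D) (μ : ProbabilityMeasure ℝ)
    (h : ∀ z ∈ D, ∃ x : Fin d → ℂ, stieltjes μ z = ∑ ℓ, x ℓ ∧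
      ∀ ℓ, x ℓ ^ 2 - (stieltjes μ z + z) * x ℓ - c ℓ = 0) : IsLimitMeasure c μ := by
  refine ⟨fun z hz => im_stieltjes_pos _ hz, ?_⟩
  choose! x hx1 hx2 using h
  have key : ∀ z, z ∉ supportC μ → ∃ y : Fin d → ℂ, stieltjes μ z = ∑ ℓ, y ℓ ∧
      ∀ ℓ, y ℓ ^ 2 - (stieltjes μ z + z) * y ℓ - c ℓ = 0 := by
    intro z hz
    have : (𝓝[D] z).NeBot := mem_closure_iff_nhdsWithin_neBot.1 (hD z)
    -- The roots chosen on `D` need not depend continuously on the point. They are bounded, so they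
    -- converge along an ultrafilter, and the limits solve the equations at `z`.
    let U := Ultrafilter.of (𝓝[D] z)
    have hU : (U : Filter ℂ) ≤ 𝓝[D] z := Ultrafilter.of_le _
    have hUD : ∀ᶠ w in (U : Filter ℂ), w ∈ D := hU self_mem_nhdsWithin
    have hUz : Tendsto (fun w : ℂ => w) U (𝓝 z) := hU.trans nhdsWithin_le_nhds
    have hg : Tendsto (stieltjes μ) U (𝓝 (stieltjes μ z)) :=
      (continuousAt_stieltjes μ hz).tendsto.comp hUz
    have hp : Tendsto (fun w => stieltjes μ w + w) U (𝓝 (stieltjes μ z + z)) := hg.add hUz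
    have hlim : ∀ ℓ, ∃ y, Tendsto (fun w => x w ℓ) U (𝓝 y) := by
      intro ℓ
      refine exists_tendsto_of_eventually_norm_le U (C := ‖stieltjes μ z + z‖ + 1 + |c ℓ| + 1) ?_
      filter_upwards [hUD, hp.norm.eventually_lt_const (lt_add_one _)] with w hw hw2
      have := norm_le_of_quadratic (hx2 w hw ℓ)
      linarith
    choose y hy using hlim
    refine ⟨y, ?_, fun ℓ => ?_⟩
    · refine tendsto_nhds_unique hg ((tendsto_finsetSum Finset.univ fun ℓ _ => hy ℓ).congr' ?_)
      filter_upwards [hUD] with w hw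
      exact (hx1 w hw).symm
    · refine tendsto_nhds_unique ((((hy ℓ).pow 2).sub (hp.mul (hy ℓ))).sub_const (c ℓ : ℂ))
        (tendsto_const_nhds.congr' ?_)
      filter_upwards [hUD] with w hw
      exact (hx2 w hw ℓ).symm
  choose! y hy using key
  exact ⟨fun ℓ z => y z ℓ, hy⟩

end LimitMeasure

/-! ### Tightness and convergence of measures that satisfy the equations asymptotically. -/

section Convergence

/-- The real part of `1 + z / (t - z)` at `z = i y` is `t ^ 2 / (t ^ 2 + y ^ 2)`, which is at least
`1 / 2` when `|t| > y`; Markov's inequality does the rest. -/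
theorem measureReal_norm_gt_le (μ : Measure ℝ) [IsProbabilityMeasure μ] {y : ℝ} (hy : 0 < y) :
    μ.real {t | y < ‖t‖} ≤ 2 * ‖1 + (y * Complex.I) * stieltjes μ (y * Complex.I)‖ := by
  set z : ℂ := y * Complex.I with hz
  have hz0 : z.im ≠ 0 := by simpa [hz] using hy.ne'
  have hi : Integrable (fun t : ℝ => 1 + z * ((t : ℂ) - z)⁻¹) μ :=
    (integrable_const _).add ((integrable_inv_ofReal_sub μ hz0).const_mul z)
  have h1 : ∫ t : ℝ, (1 + z * ((t : ℂ) - z)⁻¹) ∂μ = 1 + z * stieltjes μ z := by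
    rw [integral_add (integrable_const _) ((integrable_inv_ofReal_sub μ hz0).const_mul z),
      integral_const_mul]
    simp [stieltjes]
  have hre : ∀ t : ℝ, RCLike.re (1 + z * ((t : ℂ) - z)⁻¹) = t ^ 2 / (t ^ 2 + y ^ 2) := by
    intro t
    have hpos : 0 < t ^ 2 + y ^ 2 := by positivity
    simp only [RCLike.re_to_complex, hz, Complex.add_re, Complex.one_re, Complex.mul_re,
      Complex.inv_re, Complex.inv_im, Complex.ofReal_re, Complex.ofReal_im, Complex.I_re,
      Complex.I_im, Complex.normSq_apply, Complex.sub_re, Complex.sub_im, Complex.mul_im]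
    ring_nf
    field_simp
    ring
  have h2 := integral_re hi
  rw [h1] at h2
  simp only [hre] at h2
  have hi2 : Integrable (fun t : ℝ => t ^ 2 / (t ^ 2 + y ^ 2)) μ := by
    have := hi.re
    simpa only [hre] using this
  have h3 := mul_meas_ge_le_integral_of_nonneg
    (ae_of_all _ fun t : ℝ => (by positivity : 0 ≤ t ^ 2 / (t ^ 2 + y ^ 2))) hi2 (1 / 2)
  have h4 : μ.real {t | y < ‖t‖} ≤ μ.real {t : ℝ | 1 / 2 ≤ t ^ 2 / (t ^ 2 + y ^ 2)} := by
    refine measureReal_mono (s₂ := {t : ℝ | 1 / 2 ≤ t ^ 2 / (t ^ 2 + y ^ 2)}) fun t ht => ?_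
    have ht' : y < |t| := ht
    have : y ^ 2 ≤ t ^ 2 := by rw [← sq_abs t]; exact pow_le_pow_left₀ hy.le ht'.le 2
    change 1 / 2 ≤ t ^ 2 / (t ^ 2 + y ^ 2)
    rw [div_le_div_iff₀ (by norm_num) (by positivity)]
    linarith
  have h5 : ∫ t : ℝ, t ^ 2 / (t ^ 2 + y ^ 2) ∂μ ≤ ‖1 + z * stieltjes μ z‖ := by
    rw [h2]
    exact (le_abs_self _).trans (RCLike.abs_re_le_norm _)
  linarith

variable {d : ℕ} {c : Fin d → ℝ}

/-- Along the ultrafilter the bounded block traces converge, and their sums converge to the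
Stieltjes transform of the weak limit. The asymptotic equation becomes `c_ℓ + z x_ℓ + x_ℓ (g - x_ℓ)
= 0`, which is the quadratic one. -/
theorem isLimitMeasure_of_ultrafilter {ν : ℕ → ProbabilityMeasure ℝ} {m : ℕ → ℂ → Fin d → ℂ}
    {D : Set ℂ} (hDd : Dense D) (hD : ∀ z ∈ D, z.im ≠ 0)
    (hm : ∀ᶠ k in atTop, ∀ z ∈ D, stieltjes (ν k) z = ∑ ℓ, m k z ℓ)
    (hmb : ∀ k, ∀ z ∈ D, ∀ ℓ, ‖m k z ℓ‖ ≤ |z.im|⁻¹)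
    (hme : ∀ z ∈ D, ∀ ℓ, Tendsto (fun k => c ℓ + z * m k z ℓ +
      m k z ℓ * (∑ j, m k z j - m k z ℓ)) atTop (𝓝 0))
    {U : Ultrafilter ℕ} (hU : (U : Filter ℕ) ≤ atTop) {μ : ProbabilityMeasure ℝ}
    (hμ : Tendsto ν U (𝓝 μ)) : IsLimitMeasure c μ := by
  refine isLimitMeasure_of_dense hDd μ fun z hz => ?_
  have hlim : ∀ ℓ, ∃ x, Tendsto (fun k => m k z ℓ) U (𝓝 x) := fun ℓ =>
    exists_tendsto_of_eventually_norm_le U (Eventually.of_forall fun k => hmb k z hz ℓ)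
  choose x hx using hlim
  have hS := tendsto_finsetSum Finset.univ fun ℓ _ => hx ℓ
  have hg : stieltjes μ z = ∑ ℓ, x ℓ := by
    refine tendsto_nhds_unique (tendsto_stieltjes_of_im_ne_zero hμ (hD z hz)) (hS.congr' ?_)
    filter_upwards [hU hm] with k hk
    exact (hk z hz).symm
  refine ⟨x, hg, fun ℓ => ?_⟩
  have h1 := tendsto_nhds_unique ((hme z hz ℓ).mono_left hU)
    ((((hx ℓ).const_mul z).const_add (c ℓ : ℂ)).add ((hx ℓ).mul (hS.sub (hx ℓ))))
  rw [hg]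
  linear_combination h1

/-- Because the `c ℓ` sum to one, adding the equations shows that `1 + z g` is, up to a vanishing
error, `-∑ m_ℓ (g - m_ℓ)`. At `z = i y` this is `O(1 / y)`, and `1 + z g` controls the mass outside
`[-y, y]`. -/
theorem isTightMeasureSet_range_of_equation {ν : ℕ → ProbabilityMeasure ℝ}
    {m : ℕ → ℂ → Fin d → ℂ} (hc1 : ∑ ℓ, c ℓ = 1) {D : Set ℂ}
    (hDI : ∀ y : ℕ, 0 < y → (y : ℂ) * Complex.I ∈ D)
    (hm : ∀ᶠ k in atTop, ∀ z ∈ D, stieltjes (ν k) z = ∑ ℓ, m k z ℓ)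
    (hmb : ∀ k, ∀ z ∈ D, ∀ ℓ, ‖m k z ℓ‖ ≤ |z.im|⁻¹)
    (hme : ∀ z ∈ D, ∀ ℓ, Tendsto (fun k => c ℓ + z * m k z ℓ +
      m k z ℓ * (∑ j, m k z j - m k z ℓ)) atTop (𝓝 0)) :
    IsTightMeasureSet (Set.range fun k => (ν k : Measure ℝ)) := by
  refine isTightMeasureSet_range_of_tendsto_limsup_measure_norm_gt ?_
  rw [ENNReal.tendsto_nhds_zero]
  intro ε hε
  -- The constant is twice the sum of `1` for the vanishing error, eventually below `1 / y`, and `2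
  -- d` for the quadratic terms.
  have h0 : Tendsto (fun y : ℕ => ENNReal.ofReal ((4 * d + 2) * (y : ℝ)⁻¹)) atTop (𝓝 0) := by
    have := (tendsto_inv_atTop_nhds_zero_nat (𝕜 := ℝ)).const_mul (4 * d + 2 : ℝ)
    rw [mul_zero] at this
    simpa using ENNReal.tendsto_ofReal this
  obtain ⟨y, hyε, hy1⟩ := ((h0.eventually_lt_const hε).and (eventually_ge_atTop 1)).exists
  filter_upwards [eventually_ge_atTop (y : ℝ)] with r hr
  refine limsup_le_of_le (by isBoundedDefault) ?_
  set z : ℂ := (y : ℂ) * Complex.I with hz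
  have hy1' : (1 : ℝ) ≤ y := by exact_mod_cast hy1
  have hy0 : (0 : ℝ) < y := by linarith
  have hzD : z ∈ D := hDI y hy1
  have him : z.im = y := by simp [hz]
  have hsum : Tendsto (fun k => ∑ ℓ, (c ℓ + z * m k z ℓ + m k z ℓ * (∑ j, m k z j - m k z ℓ)))
      atTop (𝓝 0) := by
    have := tendsto_finsetSum Finset.univ fun ℓ _ => hme z hzD ℓ
    rwa [Finset.sum_const_zero] at this
  filter_upwards [hm, (tendsto_zero_iff_norm_tendsto_zero.1 hsum).eventually_lt_const
    (inv_pos.2 hy0)] with k hk hk2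
  have hg := hk z hzD
  have hgb : ‖stieltjes (ν k) z‖ ≤ (y : ℝ)⁻¹ := by
    have := norm_stieltjes_le (ν k : Measure ℝ) (z := z) (by rw [him]; exact hy0.ne')
    rwa [him, abs_of_pos hy0] at this
  have hb : ∀ ℓ, ‖m k z ℓ‖ ≤ (y : ℝ)⁻¹ := by
    intro ℓ
    have := hmb k z hzD ℓ
    rwa [him, abs_of_pos hy0] at this
  have e : 1 + z * stieltjes (ν k) z =
      ∑ ℓ, (c ℓ + z * m k z ℓ + m k z ℓ * (∑ j, m k z j - m k z ℓ)) -
      ∑ ℓ, m k z ℓ * (stieltjes (ν k) z - m k z ℓ) := by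
    rw [Finset.sum_add_distrib, Finset.sum_add_distrib, ← Finset.mul_sum, ← Complex.ofReal_sum, hc1,
      ← hg]
    push_cast; ring
  have h2 : ‖∑ ℓ, m k z ℓ * (stieltjes (ν k) z - m k z ℓ)‖ ≤ d * (2 * (y : ℝ)⁻¹) := by
    calc _ ≤ ∑ _ℓ : Fin d, 2 * (y : ℝ)⁻¹ := norm_sum_le_of_le _ fun ℓ _ => by
          rw [norm_mul]
          have h3 : ‖stieltjes (ν k) z - m k z ℓ‖ ≤ 2 * (y : ℝ)⁻¹ :=
            (norm_sub_le _ _).trans (by linarith [hb ℓ])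
          exact (mul_le_of_le_one_left (norm_nonneg _) ((hb ℓ).trans (inv_le_one_of_one_le₀ hy1'))).trans h3
      _ = _ := by simp
  have h3 : (ν k : Measure ℝ).real {t | (y : ℝ) < ‖t‖} ≤ (4 * d + 2) * (y : ℝ)⁻¹ := by
    refine (measureReal_norm_gt_le (ν k : Measure ℝ) hy0).trans ?_
    have e2 : ((y : ℝ) : ℂ) * Complex.I = z := by rw [hz]; push_cast; rfl
    rw [e2, e]
    have := norm_sub_le (∑ ℓ, (c ℓ + z * m k z ℓ + m k z ℓ * (∑ j, m k z j - m k z ℓ)))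
      (∑ ℓ, m k z ℓ * (stieltjes (ν k) z - m k z ℓ))
    nlinarith
  calc (ν k : Measure ℝ) {t | r < ‖t‖} ≤ (ν k : Measure ℝ) {t | (y : ℝ) < ‖t‖} :=
        measure_mono fun t (ht : r < ‖t‖) => hr.trans_lt ht
    _ = ENNReal.ofReal ((ν k : Measure ℝ).real {t | (y : ℝ) < ‖t‖}) :=
        (ENNReal.ofReal_toReal (measure_ne_top _ _)).symm
    _ ≤ ε := (ENNReal.ofReal_le_ofReal h3).trans hyε.le

/-- Measures whose Stieltjes transforms satisfy the equations asymptotically converge to the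
measure described by the equations. -/
theorem exists_isLimitMeasure_and_tendsto (hc0 : ∀ ℓ, 0 ≤ c ℓ) (hc1 : ∑ ℓ, c ℓ = 1)
    {ν : ℕ → ProbabilityMeasure ℝ} {m : ℕ → ℂ → Fin d → ℂ}
    {D : Set ℂ} (hDd : Dense D) (hD : ∀ z ∈ D, z.im ≠ 0)
    (hDI : ∀ y : ℕ, 0 < y → (y : ℂ) * Complex.I ∈ D)
    (hm : ∀ᶠ k in atTop, ∀ z ∈ D, stieltjes (ν k) z = ∑ ℓ, m k z ℓ)
    (hmb : ∀ k, ∀ z ∈ D, ∀ ℓ, ‖m k z ℓ‖ ≤ |z.im|⁻¹)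
    (hme : ∀ z ∈ D, ∀ ℓ, Tendsto (fun k => c ℓ + z * m k z ℓ +
      m k z ℓ * (∑ j, m k z j - m k z ℓ)) atTop (𝓝 0)) :
    ∃ μ, IsLimitMeasure c μ ∧ Tendsto ν atTop (𝓝 μ) := by
  have hK : IsCompact (closure (Set.range ν)) := by
    refine isCompact_closure_of_isTightMeasureSet ?_
    have h := isTightMeasureSet_range_of_equation hc1 hDI hm hmb hme
    refine h.subset ?_
    rintro _ ⟨_, ⟨k, rfl⟩, rfl⟩
    exact ⟨k, rfl⟩
  have hmem : ∀ k, ν k ∈ closure (Set.range ν) := fun k => subset_closure ⟨k, rfl⟩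
  let U := Ultrafilter.of (atTop : Filter ℕ)
  have hU : (U : Filter ℕ) ≤ atTop := Ultrafilter.of_le _
  obtain ⟨μ, -, hμ⟩ := hK.ultrafilter_le_nhds' (U.map ν)
    (Filter.mem_map.2 (Filter.univ_mem' hmem))
  have hlim := isLimitMeasure_of_ultrafilter hDd hD hm hmb hme hU hμ
  -- Compactness supplied the cluster point `μ`; any other one satisfies the same equations and
  -- hence equals it.
  refine ⟨μ, hlim, hK.tendsto_nhds_of_unique_mapClusterPt (Eventually.of_forall hmem) ?_⟩
  intro κ _ hκ
  obtain ⟨V, hV, hVκ⟩ := mapClusterPt_iff_ultrafilter.1 hκ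
  exact eq_of_isLimitMeasure hc0 hc1
    (isLimitMeasure_of_ultrafilter hDd hD hm hmb hme hV hVκ) hlim

end Convergence

/-! ### Empirical spectral measures and their Stieltjes transforms. -/

section EmpiricalSpectralMeasure

variable {ι : Type} [Fintype ι] [DecidableEq ι]

theorem toMeasure_empiricalSpectralMeasure {M : Matrix ι ι ℝ} (hM : M.IsHermitian) :
    (empiricalSpectralMeasure M hM : Measure ℝ) =
      ((Fintype.card ι : NNReal)⁻¹) • ∑ j, Measure.dirac (hM.eigenvalues j) := by
  rw [empiricalSpectralMeasure, FiniteMeasure.toMeasure_smul, FiniteMeasure.toMeasure_sum]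
  rfl

theorem isProbabilityMeasure_empiricalSpectralMeasure [Nonempty ι] {M : Matrix ι ι ℝ}
    (hM : M.IsHermitian) : IsProbabilityMeasure (empiricalSpectralMeasure M hM : Measure ℝ) := by
  constructor
  rw [toMeasure_empiricalSpectralMeasure, Measure.smul_apply, Measure.finsetSum_apply]
  simp only [measure_univ, Finset.sum_const, Finset.card_univ, nsmul_eq_mul, mul_one]
  rw [ENNReal.smul_def, smul_eq_mul, ENNReal.coe_inv (by simp [Fintype.card_ne_zero])]
  exact ENNReal.inv_mul_cancel (by simp) (by simp)

theorem ae_empiricalSpectralMeasure_mem_spectrum {M : Matrix ι ι ℝ} (hM : M.IsHermitian) :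
    ∀ᵐ t ∂(empiricalSpectralMeasure M hM : Measure ℝ), t ∈ spectrum ℝ M := by
  rw [hM.spectrum_real_eq_range_eigenvalues, ae_iff, toMeasure_empiricalSpectralMeasure,
    Measure.smul_apply, Measure.finsetSum_apply]
  have hS : MeasurableSet {t : ℝ | t ∉ Set.range hM.eigenvalues} :=
    (Set.finite_range _).measurableSet.compl
  rw [Finset.sum_eq_zero, smul_zero]
  intro j _
  rw [Measure.dirac_apply' _ hS]
  simp

/-- The assumption only excludes the eigenvalues, so the diagonalization also covers real `z` off
the spectrum, as needed for the last convergence statement of the theorem. -/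
theorem resolventMatrix_eq_mul_diagonal {M : Matrix ι ι ℝ} (hM : M.IsHermitian) {z : ℂ}
    (hz : ∀ j, (hM.eigenvalues j : ℂ) ≠ z) :
    resolventMatrix M z = (hM.eigenvectorUnitary : Matrix ι ι ℝ).map (fun t : ℝ => (t : ℂ)) *
      Matrix.diagonal (fun j => ((hM.eigenvalues j : ℂ) - z)⁻¹) *
      (star (hM.eigenvectorUnitary : Matrix ι ι ℝ)).map (fun t : ℝ => (t : ℂ)) := by
  set U : Matrix ι ι ℝ := (hM.eigenvectorUnitary : Matrix ι ι ℝ) with hU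
  set φ : ℝ →+* ℂ := Complex.ofRealHom
  have hmap : ∀ A B : Matrix ι ι ℝ, (A * B).map (fun t : ℝ => (t : ℂ)) =
      A.map (fun t : ℝ => (t : ℂ)) * B.map (fun t : ℝ => (t : ℂ)) := fun A B => Matrix.map_mul (f := φ)
  have hone : (1 : Matrix ι ι ℝ).map (fun t : ℝ => (t : ℂ)) = 1 :=
    Matrix.map_one _ Complex.ofReal_zero Complex.ofReal_one
  have h1 : U * star U = 1 := Unitary.mul_star_self_of_mem hM.eigenvectorUnitary.2
  have h2 : star U * U = 1 := Unitary.star_mul_self_of_mem hM.eigenvectorUnitary.2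
  have h1' := hmap U (star U)
  rw [h1, hone] at h1'
  have h2' := hmap (star U) U
  rw [h2, hone] at h2'
  have hs : M = U * Matrix.diagonal hM.eigenvalues * star U := by
    have := hM.spectral_theorem
    rw [Unitary.conjStarAlgAut_apply] at this
    exact this
  have hs' : M.map (fun t : ℝ => (t : ℂ)) = U.map (fun t : ℝ => (t : ℂ)) *
      Matrix.diagonal (fun j => (hM.eigenvalues j : ℂ)) * (star U).map (fun t : ℝ => (t : ℂ)) := by
    conv_lhs => rw [hs]
    rw [hmap, hmap, Matrix.diagonal_map Complex.ofReal_zero]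
  set V := U.map (fun t : ℝ => (t : ℂ))
  set V' := (star U).map (fun t : ℝ => (t : ℂ))
  rw [resolventMatrix]
  refine Matrix.inv_eq_right_inv ?_
  have h3 : M.map (fun t : ℝ => (t : ℂ)) - z • (1 : Matrix ι ι ℂ) =
      V * Matrix.diagonal (fun j => (hM.eigenvalues j : ℂ) - z) * V' := by
    have h4 : Matrix.diagonal (fun j => (hM.eigenvalues j : ℂ) - z) =
        Matrix.diagonal (fun j => (hM.eigenvalues j : ℂ)) - z • (1 : Matrix ι ι ℂ) := by
      rw [← Matrix.diagonal_one, ← Matrix.diagonal_smul, Matrix.diagonal_sub]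
      congr 1; ext j; simp
    rw [h4, mul_sub, sub_mul, ← hs', Matrix.mul_smul, Matrix.smul_mul, mul_one, ← h1']
  rw [h3]
  calc V * Matrix.diagonal (fun j => (hM.eigenvalues j : ℂ) - z) * V' *
        (V * Matrix.diagonal (fun j => ((hM.eigenvalues j : ℂ) - z)⁻¹) * V') =
      V * (Matrix.diagonal (fun j => (hM.eigenvalues j : ℂ) - z) * (V' * V) *
        Matrix.diagonal (fun j => ((hM.eigenvalues j : ℂ) - z)⁻¹)) * V' := by
        simp only [mul_assoc]
    _ = 1 := by
        rw [← h2', mul_one, Matrix.diagonal_mul_diagonal]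
        simp only [mul_inv_cancel₀ (sub_ne_zero.2 (hz _))]
        rw [Matrix.diagonal_one, mul_one, ← h1']

theorem stieltjes_empiricalSpectralMeasure {M : Matrix ι ι ℝ} (hM : M.IsHermitian) {z : ℂ}
    (hz : ∀ j, (hM.eigenvalues j : ℂ) ≠ z) :
    stieltjes (empiricalSpectralMeasure M hM : Measure ℝ) z = normalizedResolventTrace M z := by
  have h1 : (star (hM.eigenvectorUnitary : Matrix ι ι ℝ)).map (fun t : ℝ => (t : ℂ)) *
      (hM.eigenvectorUnitary : Matrix ι ι ℝ).map (fun t : ℝ => (t : ℂ)) = 1 := by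
    have h2 : star (hM.eigenvectorUnitary : Matrix ι ι ℝ) * hM.eigenvectorUnitary = 1 :=
      Unitary.star_mul_self_of_mem hM.eigenvectorUnitary.2
    have h3 := Matrix.map_mul (f := Complex.ofRealHom)
      (L := star (hM.eigenvectorUnitary : Matrix ι ι ℝ)) (M := (hM.eigenvectorUnitary : Matrix ι ι ℝ))
    rw [h2] at h3
    exact h3.symm.trans (Matrix.map_one _ Complex.ofReal_zero Complex.ofReal_one)
  rw [normalizedResolventTrace, resolventMatrix_eq_mul_diagonal hM hz, mul_assoc,
    Matrix.trace_mul_comm, mul_assoc, h1, mul_one, Matrix.trace_diagonal, stieltjes,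
    toMeasure_empiricalSpectralMeasure, integral_smul_nnreal_measure,
    integral_finsetSum_measure fun j _ => integrable_dirac (by simp)]
  simp only [integral_dirac]
  rw [NNReal.smul_def, Complex.real_smul]
  push_cast
  rfl

end EmpiricalSpectralMeasure

/-! ### The spectral limit for the perturbed noise matrices. -/

section SpectralLimit

/-- A countable dense set of nonreal numbers that contains the positive integer multiples of
`Complex.I`. -/
theorem exists_countable_dense_im_ne_zero : ∃ D : Set ℂ, D.Countable ∧ Dense D ∧
    (∀ z ∈ D, z.im ≠ 0) ∧ ∀ y : ℕ, 0 < y → (y : ℂ) * Complex.I ∈ D := by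
  obtain ⟨S, hSc, hSd⟩ := TopologicalSpace.exists_countable_dense ℂ
  have hopen : IsOpen {z : ℂ | z.im ≠ 0} := isOpen_ne_fun Complex.continuous_im continuous_const
  have hdense : Dense {z : ℂ | z.im ≠ 0} :=
    (dense_compl_singleton (0 : ℝ)).preimage Complex.isOpenMap_im
  refine ⟨S ∩ {z : ℂ | z.im ≠ 0} ∪ Set.range fun y : ℕ => ((y + 1 : ℕ) : ℂ) * Complex.I,
    (hSc.mono Set.inter_subset_left).union (Set.countable_range _),
    (hSd.inter_of_isOpen_right hdense hopen).mono Set.subset_union_left, ?_, fun y hy => ?_⟩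
  · rintro z (hz | ⟨y, rfl⟩)
    · exact hz.2
    · simp only [Complex.mul_im, Complex.natCast_re, Complex.natCast_im, Complex.I_im, Complex.I_re]
      have : ((y + 1 : ℕ) : ℝ) ≠ 0 := by exact_mod_cast Nat.succ_ne_zero y
      simpa using this
  · refine Or.inr ⟨y - 1, ?_⟩
    dsimp only
    rw [Nat.sub_add_cancel hy]

theorem sum_eq_one_of_tendsto {d : ℕ} {n : ℕ → Fin d → ℕ} {c : Fin d → ℝ}
    (hn : Tendsto (fun k => totalDim (n k)) atTop atTop)
    (hc : ∀ ℓ, Tendsto (fun k => (n k ℓ : ℝ) / (totalDim (n k) : ℝ)) atTop (𝓝 (c ℓ))) :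
    ∑ ℓ, c ℓ = 1 := by
  refine tendsto_nhds_unique (tendsto_finsetSum Finset.univ fun ℓ _ => hc ℓ)
    (tendsto_const_nhds.congr' ?_)
  filter_upwards [hn.eventually_gt_atTop 0] with k hk
  have : (totalDim (n k) : ℝ) ≠ 0 := by exact_mod_cast hk.ne'
  rw [← Finset.sum_div, ← Nat.cast_sum]
  exact (div_self this).symm

/-- The spectral limit theorem for bounded rank perturbations of noise matrices, when the noise
tensors avoid the deviation sets. -/
theorem exists_isLimitMeasure_and_tendsto_empiricalSpectralMeasure {d : ℕ} (hd : 0 < d)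
    {n : ℕ → Fin d → ℕ} {c : Fin d → ℝ}
    (hn : Tendsto (fun k => totalDim (n k)) atTop atTop)
    (hc : ∀ ℓ, Tendsto (fun k => (n k ℓ : ℝ) / (totalDim (n k) : ℝ)) atTop (𝓝 (c ℓ)))
    {D : Set ℂ} (hDd : Dense D) (hD : ∀ z ∈ D, z.im ≠ 0)
    (hDI : ∀ y : ℕ, 0 < y → (y : ℂ) * Complex.I ∈ D)
    {a : (k : ℕ) → Vectors (n k)} (ha : ∀ᶠ k in atTop, ∀ ℓ, ‖a k ℓ‖ = 1)
    {w : (k : ℕ) → TensorSpace (n k)}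
    (hw : ∀ z ∈ D, ∀ t > 0, ∀ᶠ k in atTop, w k ∉ deviationSet (n k) z t)
    {M : (k : ℕ) → Matrix (BlockIndex (n k)) (BlockIndex (n k)) ℝ} (hM : ∀ k, (M k).IsHermitian)
    {J : Type*} [Fintype J] (hMw : ∀ k, ∃ f g : J → BlockIndex (n k) → ℝ, ∀ s t,
      M k s t - noiseMatrix (a k) (w k) s t = ∑ j, f j s * g j t) :
    ∃ μ : ProbabilityMeasure ℝ, IsLimitMeasure c μ ∧
      Tendsto (fun k => empiricalSpectralMeasure (M k) (hM k)) atTop (𝓝 μ.toFiniteMeasure) ∧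
      ∀ z : ℂ, z ∉ supportC μ →
        (∃ δ : ℝ, 0 < δ ∧ ∀ᶠ k in atTop, ∀ t ∈ spectrum ℝ (M k), δ ≤ ‖(t : ℂ) - z‖) →
        Tendsto (fun k => normalizedResolventTrace (M k) z) atTop (𝓝 (stieltjes μ z)) := by
  classical
  have hc0 : ∀ ℓ, 0 ≤ c ℓ := fun ℓ => ge_of_tendsto' (hc ℓ) fun k => by positivity
  have hne : ∀ᶠ k in atTop, Nonempty (BlockIndex (n k)) := by
    filter_upwards [hn.eventually_gt_atTop 0] with k hk
    rw [← card_blockIndex] at hk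
    exact Fintype.card_pos_iff.1 hk
  -- For an empty index set the empirical spectral measure is zero. The Dirac mass replaces it
  -- there, which does not affect the limit because the total dimension is eventually positive.
  let ν : ℕ → ProbabilityMeasure ℝ := fun k =>
    if h : Nonempty (BlockIndex (n k)) then
      ⟨empiricalSpectralMeasure (M k) (hM k), isProbabilityMeasure_empiricalSpectralMeasure (hM k)⟩
    else diracProba 0
  have hν : ∀ᶠ k in atTop, (ν k : Measure ℝ) = empiricalSpectralMeasure (M k) (hM k) := by
    filter_upwards [hne] with k hk
    have e : ν k = ⟨empiricalSpectralMeasure (M k) (hM k),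
        isProbabilityMeasure_empiricalSpectralMeasure (hM k)⟩ := dif_pos hk
    rw [e]
    rfl
  have hνz : ∀ z : ℂ, ∀ᶠ k in atTop, (∀ t ∈ spectrum ℝ (M k), (t : ℂ) ≠ z) →
      stieltjes (ν k) z = normalizedResolventTrace (M k) z := by
    intro z
    filter_upwards [hν] with k hk hz
    rw [hk]
    refine stieltjes_empiricalSpectralMeasure (hM k) fun j => hz _ ?_
    rw [(hM k).spectrum_real_eq_range_eigenvalues]
    exact ⟨j, rfl⟩
  have hm : ∀ᶠ k in atTop, ∀ z ∈ D, stieltjes (ν k) z = ∑ ℓ, blockTrace (M k) z ℓ := by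
    filter_upwards [hν] with k hk z hz
    rw [hk, sum_blockTrace]
    refine stieltjes_empiricalSpectralMeasure (hM k) fun j h => hD z hz ?_
    rw [← h, Complex.ofReal_im]
  obtain ⟨μ, hμ, hlim⟩ := exists_isLimitMeasure_and_tendsto hc0 (sum_eq_one_of_tendsto hn hc)
    (ν := ν) (m := fun k z ℓ => blockTrace (M k) z ℓ) hDd hD hDI hm
    (fun k z hz ℓ => norm_blockTrace_le (hM k) (hD z hz) ℓ)
    (fun z hz ℓ => tendsto_blockTrace_equation hd hn hc (hD z hz) ha (hw z hz) hM hMw ℓ)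
  refine ⟨μ, hμ, ?_, fun z hz ⟨δ, hδ, hδk⟩ => ?_⟩
  · refine ((ProbabilityMeasure.tendsto_nhds_iff_toFiniteMeasure_tendsto_nhds _).1 hlim).congr' ?_
    filter_upwards [hν] with k hk
    exact Subtype.ext hk
  · obtain ⟨δ', hδ', hμz⟩ := exists_ae_le_norm_sub (μ : Measure ℝ) hz
    -- The common distance must serve both the empirical measures, through the gap `δ` to the
    -- spectra, and `μ`, through the gap `δ'` to its support.
    have h := tendsto_stieltjes hlim (lt_min hδ hδ') (z := z) ?_
      (hμz.mono fun t ht => (min_le_right _ _).trans ht)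
    · refine h.congr' ?_
      filter_upwards [hνz z, hδk] with k hk hk2
      refine hk fun t ht h0 => ?_
      have := hk2 t ht
      rw [h0, sub_self, norm_zero] at this
      linarith
    · filter_upwards [hν, hδk] with k hk hk2
      rw [hk]
      exact (ae_empiricalSpectralMeasure_mem_spectrum (hM k)).mono fun t ht =>
        (min_le_left _ _).trans (hk2 t ht)

/-- Countably many null sets suffice: `D` is countable, and deviation sets shrink as `t` grows, so
the thresholds `1 / (j + 1)` cover all `t > 0`. -/
theorem ae_forall_eventually_notMem_deviationSet {d : ℕ} (hd : 0 < d) {Ω : Type*}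
    [MeasurableSpace Ω] (P : Measure Ω) [IsProbabilityMeasure P] (n : ℕ → Fin d → ℕ)
    (hn : Tendsto (fun k => totalDim (n k)) atTop atTop)
    (W : (s : Fin d → ℕ) → Ω → Tensor s) (hW : ∀ k, IsGaussianNoise P (W (n k)))
    {D : Set ℂ} (hDc : D.Countable) (hD : ∀ z ∈ D, z.im ≠ 0) :
    ∀ᵐ ω ∂P, ∀ z ∈ D, ∀ t > 0, ∀ᶠ k in atTop,
      (WithLp.toLp 2 (W (n k) ω) : TensorSpace (n k)) ∉ deviationSet (n k) z t := by
  rw [ae_ball_iff hDc]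
  intro z hz
  have h : ∀ᵐ ω ∂P, ∀ j : ℕ, ∀ᶠ k in atTop,
      (WithLp.toLp 2 (W (n k) ω) : TensorSpace (n k)) ∉ deviationSet (n k) z (1 / ((j : ℝ) + 1)) :=
    ae_all_iff.2 fun j => ae_eventually_notMem_deviationSet hd P n hn W hW (hD z hz) (by positivity)
  filter_upwards [h] with ω hω t ht
  obtain ⟨j, hj⟩ := exists_nat_one_div_lt ht
  refine (hω j).mono fun k hk hmem => hk ?_
  obtain ⟨a, ha, m, hm⟩ := hmem
  exact ⟨a, ha, m, (mul_le_mul_of_nonneg_left hj.le (Nat.cast_nonneg _)).trans_lt hm⟩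

end SpectralLimit

/-! ### The theorem. -/

theorem theorem1
    {Ω : Type*} [MeasurableSpace Ω] (P : Measure Ω) [IsProbabilityMeasure P]
    (d r : ℕ) (hd : 3 ≤ d) (hr : 1 ≤ r)
    -- the dimensions, which go to infinity with limiting proportions `c`
    (n : ℕ → Fin d → ℕ) (c : Fin d → ℝ)
    (hn : ∀ ℓ, Tendsto (fun k => n k ℓ) atTop atTop)
    (hc : ∀ ℓ, Tendsto (fun k => (n k ℓ : ℝ) / (totalDim (n k) : ℝ)) atTop (𝓝 (c ℓ)))
    -- the signal, with asymptotic cross-correlations `α`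
    (β : Fin r → ℝ) (hβ : ∀ i, 0 ≤ β i)
    (x : (k : ℕ) → Fin r → Vectors (n k)) (hx : ∀ k i ℓ, ‖x k i ℓ‖ = 1)
    (α : Fin r → Fin r → Fin d → ℝ)
    (hα : ∀ i j ℓ, Tendsto (fun k => |inner ℝ (x k i ℓ) (x k j ℓ)|) atTop (𝓝 (α i j ℓ)))
    -- the noise: one Gaussian tensor for each size, with any joint law of the different sizes
    (W : (s : Fin d → ℕ) → Ω → Tensor s) (hW : ∀ k, IsGaussianNoise P (W (n k)))
    -- the critical points found by the successive deflation steps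
    (lamHat : ℕ → Ω → Fin r → ℝ) (uHat : (k : ℕ) → Ω → Fin r → Vectors (n k))
    (hcrit : ∀ᵐ ω ∂P, ∀ᶠ k in atTop, ∀ i, IsCriticalPoint
      (deflated (spiked β (x k) (W (n k) ω)) (lamHat k ω) (uHat k ω) i)
      (lamHat k ω i) (uHat k ω i))
    -- their almost sure limits
    (lam : Fin r → ℝ) (ρ η : Fin r → Fin r → Fin d → ℝ)
    (hlam : ∀ i, ∀ᵐ ω ∂P, Tendsto (fun k => lamHat k ω i) atTop (𝓝 (lam i)))
    (hρ : ∀ i j ℓ, ∀ᵐ ω ∂P,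
      Tendsto (fun k => |inner ℝ (x k i ℓ) (uHat k ω j ℓ)|) atTop (𝓝 (ρ i j ℓ)))
    (hη : ∀ i j ℓ, ∀ᵐ ω ∂P,
      Tendsto (fun k => |inner ℝ (uHat k ω i ℓ) (uHat k ω j ℓ)|) atTop (𝓝 (η i j ℓ)))
    (hlam_supp : ∀ μ : ProbabilityMeasure ℝ, IsLimitMeasure c μ →
      ∀ i, lam i ∉ (μ : Measure ℝ).support)
    (hρ_pos : ∀ i j ℓ, 0 < ρ i j ℓ) :
    ∃ μ : ProbabilityMeasure ℝ,
      -- `μ` is the unique measure described by the equations for the Stieltjes transform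
      (IsLimitMeasure c μ ∧ ∀ ν : ProbabilityMeasure ℝ, IsLimitMeasure c ν → ν = μ) ∧
      ∀ i : Fin r, ∀ᵐ ω ∂P,
        -- weak convergence of the empirical spectral measures
        Tendsto (fun k => empiricalSpectralMeasure
            (blockMatrix
              (deflated (spiked β (x k) (W (n k) ω)) (lamHat k ω) (uHat k ω) i) (uHat k ω i))
            (blockMatrix_isHermitian _ _))
          atTop (𝓝 μ.toFiniteMeasure) ∧
        -- convergence of the normalized trace of the resolvent, off the real axis
        (∀ z : ℂ, z.im ≠ 0 →
          Tendsto (fun k => normalizedResolventTrace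
              (blockMatrix
                (deflated (spiked β (x k) (W (n k) ω)) (lamHat k ω) (uHat k ω) i) (uHat k ω i)) z)
            atTop (𝓝 (stieltjes μ z))) ∧
        -- and at every point off the support of `μ` from which the eigenvalues stay away
        (∀ z : ℂ, z ∉ supportC μ →
          (∃ δ : ℝ, 0 < δ ∧ ∀ᶠ k in atTop, ∀ t ∈ spectrum ℝ
            (blockMatrix
              (deflated (spiked β (x k) (W (n k) ω)) (lamHat k ω) (uHat k ω) i) (uHat k ω i)),
            δ ≤ ‖(t : ℂ) - z‖) →
          Tendsto (fun k => normalizedResolventTrace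
              (blockMatrix
                (deflated (spiked β (x k) (W (n k) ω)) (lamHat k ω) (uHat k ω) i) (uHat k ω i)) z)
            atTop (𝓝 (stieltjes μ z))) := by
  have hd0 : 0 < d := by omega
  have hN : Tendsto (fun k => totalDim (n k)) atTop atTop :=
    tendsto_atTop_mono (fun k => Finset.single_le_sum (f := n k) (fun _ _ => Nat.zero_le _)
      (Finset.mem_univ (⟨0, hd0⟩ : Fin d))) (hn ⟨0, hd0⟩)
  obtain ⟨D, hDc, hDd, hD, hDI⟩ := exists_countable_dense_im_ne_zero
  -- At this stage the limit measure may depend on `ω` and `i`; uniqueness removes the dependence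
  -- afterwards.
  have key : ∀ᵐ ω ∂P, ∀ i, ∃ μ : ProbabilityMeasure ℝ, IsLimitMeasure c μ ∧
      Tendsto (fun k => empiricalSpectralMeasure
        (blockMatrix
          (deflated (spiked β (x k) (W (n k) ω)) (lamHat k ω) (uHat k ω) i) (uHat k ω i))
        (blockMatrix_isHermitian _ _)) atTop (𝓝 μ.toFiniteMeasure) ∧
      ∀ z : ℂ, z ∉ supportC μ →
        (∃ δ : ℝ, 0 < δ ∧ ∀ᶠ k in atTop, ∀ t ∈ spectrum ℝ
          (blockMatrix
            (deflated (spiked β (x k) (W (n k) ω)) (lamHat k ω) (uHat k ω) i) (uHat k ω i)),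
          δ ≤ ‖(t : ℂ) - z‖) →
        Tendsto (fun k => normalizedResolventTrace
          (blockMatrix
            (deflated (spiked β (x k) (W (n k) ω)) (lamHat k ω) (uHat k ω) i) (uHat k ω i)) z)
          atTop (𝓝 (stieltjes μ z)) := by
    filter_upwards [hcrit, ae_forall_eventually_notMem_deviationSet hd0 P n hN W hW hDc hD]
      with ω hω hdev i
    refine exists_isLimitMeasure_and_tendsto_empiricalSpectralMeasure
      (J := (Fin r × Fin d) ⊕ (Fin r × Fin d)) hd0 hN hc hDd hD hDI
      (hω.mono fun k hk => (hk i).2.1) hdev (fun k => blockMatrix_isHermitian _ _) fun k => ?_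
    rw [noiseMatrix_eq]
    exact exists_blockMatrix_deflated_sub β (x k) (W (n k) ω) (lamHat k ω) (uHat k ω) i (uHat k ω i)
  have huniq : ∀ {μ ν : ProbabilityMeasure ℝ}, IsLimitMeasure c μ → IsLimitMeasure c ν → ν = μ :=
    fun hμ hν => eq_of_isLimitMeasure (fun ℓ => ge_of_tendsto' (hc ℓ) fun k => by positivity)
      (sum_eq_one_of_tendsto hN hc) hν hμ
  -- An event of full probability is not empty, and a single sample with the first index already
  -- produces the deterministic `μ`.
  obtain ⟨ω₀, hω₀⟩ := key.exists
  obtain ⟨μ, hμ, -⟩ := hω₀ ⟨0, hr⟩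
  refine ⟨μ, ⟨hμ, fun ν hν => huniq hμ hν⟩, fun i => key.mono fun ω hω => ?_⟩
  obtain ⟨ν, hν, hweak, hres⟩ := hω i
  obtain rfl := huniq hμ hν
  -- Off the real axis the required distance to the spectrum is automatic: the eigenvalues are real,
  -- so `|z.im|` works.
  refine ⟨hweak, fun z hz => hres z (notMem_supportC_of_im_ne_zero _ hz) ⟨|z.im|, abs_pos.2 hz,
    Eventually.of_forall fun k t _ => ?_⟩, hres⟩
  simpa using Complex.abs_im_le_norm ((t : ℂ) - z)
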